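/- **Theorem (Safety).** *Setting.* Let $(X_i,Y_i,\widehat Y_i)$, $i\ge1$, with $\widehat Y_i=(\widehat Y_{1,i},\dots,\widehat Y_{K,i})$, be i.i.d. copies of $(X,Y,\widehat Y)$, the joint law being arbitrary. Let $n<N$ be sample sizes along a sequence with $n\to\infty$; no limit of $n/N$ is assumed. The label $Y_i$ is used only for the labelled units $i\le n$. Let $\ell_\theta(x,y)$ be a loss, $\mathbf s(x,y;\theta)=\partial\ell_\theta(x,y)/\partial\theta\in\mathbb R^p$ its score, and $\mathcal S(x,\hat y;\theta)=(\mathbf s(x,\hat y_1;\theta)^T,\dots,\mathbf s(x,\hat y_K;\theta)^T)^T\in\mathbb R^{Kp}$. Assume: (i) $\Theta\subset\mathbb R^p$ is compact, $\theta^*$ is an interior point of $\Theta$, and $\mathbb E\,\mathbf s(X,Y;\theta^*)=0$; (ii) $\mathbb E\,\mathbf s(X,Y;\theta)\ne0$ for all $\theta\in\Theta\setminus\{\theta^*\}$; on some open convex set $O\supseteq\Theta$ the loss is convex and differentiable in $\theta$, and for every $\theta\in O$ the score is measurable in $(x,y)$ and $\mathbf s(X,Y;\theta)$ and $\mathbf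 s(X,\widehat Y_k;\theta)$, $k\le K$, are integrable; (iii) there is a neighbourhood $U$ of $\theta^*$ in which $\mathbf s(x,y;\theta)$ is differentiable in $\theta$ for all $(x,y)$, with $\|\partial\mathbf s(x,y;\theta)/\partial\theta\|\le b(x,y)$ for $\theta\in U$, where $b(X,Y)$ and all $b(X,\widehat Y_k)$ are integrable; the matrix $H=\mathbb E\{\partial\mathbf s(X,Y;\theta^*)^T/\partial\theta\}$ is nonsingular; (iv) the second moments of $\mathbf s(X,Y;\theta)$ and $\mathbf s(X,\widehat Y_k;\theta)$, $k\le K$, are bounded over $\theta\in U$, and $\operatorname{Var}(\mathcal S)$ is nonsingular. Here and below $\mathbf s=\mathbf s(X,Y;\theta^*)$ and $\mathcal S=\mathcal S(X,\widehat Y;\theta^*)$. Put $\rho=(N-n)/N$, $W^{\rm opt}=\rho\operatorname{Var}(\mathcal S)^{-1}\mathbb E[\mathcal S\mathbf s^T]$, $\Sigma_{\rm nv}=\operatorname{Var}(\mathbf s)$, $$\Sigma_g=\mathbb E[\mathbf s\mathcal S^T]\operatorname{Var}(\mathcal S)^{-1}\mathbb E[\mathcal S\mathbf s^T],\qquad \Sigma_{\rm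 opt}=\Sigma_{\rm nv}-\rho\,\Sigma_g .$$ (v) $\widehat W$ is any random $(Kp)\times p$ matrix (the estimated weight) with $\rho^{-1}(\widehat W-W^{\rm opt})\to0$ in probability. If $n/N$ is bounded away from $1$, this says $\widehat W-W^{\rm opt}\to0$ in probability. For a matrix $W\in\mathbb R^{(Kp)\times p}$ let $$\Psi_W(\theta)=\frac1n\sum_{i\le n}\mathbf s(X_i,Y_i;\theta)+W^T\Big\{\frac1{N-n}\sum_{n<i\le N}\mathcal S(X_i,\widehat Y_i;\theta)-\frac1n\sum_{i\le n}\mathcal S(X_i,\widehat Y_i;\theta)\Big\}.$$ The SADA estimator $\hat\theta^{\rm sada}$ is any random vector that, with probability tending to one, lies in $\Theta$ and solves $\Psi_{\widehat W}(\theta)=0$. A naive estimator $\hat\theta^{\rm nv}$ is defined likewise by $\Psi_0(\theta)=0$. *Conclusions.* 1. $\sqrt n(\hat\theta^{\rm sada}-\theta^*)\to N(0,H^{-1}\Sigma_{\rm opt}H^{-1})$ in distribution. As $\Sigma_{\rm opt}$ depends on $n/N$, this means that $\mathbb E f(\sqrt n(\hat\theta^{\rm sada}-\theta^*))-\int f\,dN(0,H^{-1}\Sigma_{\rm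 opt}H^{-1})\to0$ for every bounded continuous $f$; and if $(N-n)/N\to\rho_\infty$, there is convergence in distribution to the normal law with $\rho_\infty$ in place of $\rho$. The matrix $H^{-1}\Sigma_{\rm opt}H^{-1}$ is positive semidefinite. 2. Up to a negligible term the mean squared error of $\hat\theta^{\rm sada}$ is $\frac1nH^{-1}\Sigma_{\rm opt}H^{-1}$: we have $\hat\theta^{\rm sada}-\theta^*=T+o_p(n^{-1/2})$ with $T=-H^{-1}\Psi_{W^{\rm opt}}(\theta^*)$, $\mathbb E T=0$ and $\mathbb E[TT^T]=\frac1nH^{-1}\Sigma_{\rm opt}H^{-1}$ exactly (for $n\geq 1$). If moreover $n\|\hat\theta^{\rm sada}-\theta^*\|^2$ is uniformly integrable, then $\mathbb E[(\hat\theta^{\rm sada}-\theta^*)(\hat\theta^{\rm sada}-\theta^*)^T]$ and $\operatorname{Var}(\hat\theta^{\rm sada})$ both equal $\frac1nH^{-1}\Sigma_{\rm opt}H^{-1}+o(1/n)$. 3. $\Sigma_g$ is positive semidefinite. The statements in 1 and 2 hold for $\hat\theta^{\rm nv}$ with $\Sigma_{\rm nv}$ in place of $\Sigma_{\rm opt}$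 and $T=-H^{-1}\Psi_0(\theta^*)$. Moreover $H^{-1}\Sigma_{\rm opt}H^{-1}\preceq H^{-1}\Sigma_{\rm nv}H^{-1}$, so in this first-order sense $\operatorname{Var}(\hat\theta^{\rm sada})\preceq\operatorname{Var}(\hat\theta^{\rm nv})$. -/

import Mathlib

open MeasureTheory ProbabilityTheory Filter Topology Matrix
open scoped BoundedContinuousFunction ENNReal

noncomputable section

namespace SADA

/-- The Euclidean space `ℝᵖ` that contains the parameter set. -/
abbrev Par (p : ℕ) := EuclideanSpace ℝ (Fin p)

/-- A complete observation `(X, Y, Ŷ)` with `Ŷ = (Ŷ₁, …, Ŷ_K)`. For an unlabelled unit the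
coordinate `Y` exists but is never used by the estimators. -/
abbrev Obs (𝒳 𝒴 : Type*) (K : ℕ) := 𝒳 × 𝒴 × (Fin K → 𝒴)

section Score

variable {𝒳 𝒴 : Type*} {p K : ℕ}

/-- The score `s(x, y; θ) = ∂ ℓ_θ(x, y) / ∂θ`. -/
def score (ℓ : 𝒳 → 𝒴 → Par p → ℝ) (x : 𝒳) (y : 𝒴) (θ : Par p) : Par p :=
  gradient (ℓ x y) θ

/-- `s(X, Y; θ)`: the score at the true label. -/
def scoreTrue (ℓ : 𝒳 → 𝒴 → Par p → ℝ) (θ : Par p) (d : Obs 𝒳 𝒴 K) : Par p :=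
  score ℓ d.1 d.2.1 θ

/-- `s(X, Ŷ_k; θ)`: the score at the `k`-th predicted label. -/
def scorePred (ℓ : 𝒳 → 𝒴 → Par p → ℝ) (k : Fin K) (θ : Par p) (d : Obs 𝒳 𝒴 K) : Par p :=
  score ℓ d.1 (d.2.2 k) θ

/-- `𝒮(X, Ŷ; θ) ∈ ℝ^{Kp}`: the scores at the `K` predicted labels, stacked. -/
def stackedScore (ℓ : 𝒳 → 𝒴 → Par p → ℝ) (θ : Par p) (d : Obs 𝒳 𝒴 K) : Fin K × Fin p → ℝ :=
  fun a => scorePred ℓ a.1 θ d a.2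

end Score

section Population

/-- The matrix `E[U Vᵀ]`. -/
def crossMoment {α ι κ : Type*} [MeasurableSpace α] (μ : Measure α)
    (U : α → ι → ℝ) (V : α → κ → ℝ) : Matrix ι κ ℝ :=
  Matrix.of fun i j => ∫ a, U a i * V a j ∂μ

/-- The covariance matrix `var(U) = E[(U - E U)(U - E U)ᵀ]`. -/
def varMatrix {α ι : Type*} [MeasurableSpace α] (μ : Measure α) (U : α → ι → ℝ) : Matrix ι ι ℝ :=
  Matrix.of fun i j => cov[fun a => U a i, fun a => U a j; μ]

variable {𝒳 𝒴 : Type*} [MeasurableSpace 𝒳] [MeasurableSpace 𝒴] {p K : ℕ}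

/-- `H = E{∂ s(X, Y; θ)ᵀ / ∂θ}`: the `(i, j)` entry is the mean of `∂ s_j / ∂θ_i`. -/
def hessian (ℓ : 𝒳 → 𝒴 → Par p → ℝ) (μ : Measure (Obs 𝒳 𝒴 K)) (θ : Par p) :
    Matrix (Fin p) (Fin p) ℝ :=
  Matrix.of fun i j =>
    ∫ d, (fderiv ℝ (score ℓ d.1 d.2.1) θ (EuclideanSpace.single i (1 : ℝ))) j ∂μ

/-- `Σ_nv = var{s(X, Y; θ)}`. -/
def sigmaNaive (ℓ : 𝒳 → 𝒴 → Par p → ℝ) (μ : Measure (Obs 𝒳 𝒴 K)) (θ : Par p) :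
    Matrix (Fin p) (Fin p) ℝ :=
  varMatrix μ fun d i => scoreTrue ℓ θ d i

/-- `var{𝒮(X, Ŷ; θ)}`. -/
def varStacked (ℓ : 𝒳 → 𝒴 → Par p → ℝ) (μ : Measure (Obs 𝒳 𝒴 K)) (θ : Par p) :
    Matrix (Fin K × Fin p) (Fin K × Fin p) ℝ :=
  varMatrix μ (stackedScore ℓ θ)

/-- `E{𝒮(X, Ŷ; θ) s(X, Y; θ)ᵀ}`. -/
def crossStacked (ℓ : 𝒳 → 𝒴 → Par p → ℝ) (μ : Measure (Obs 𝒳 𝒴 K)) (θ : Par p) :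
    Matrix (Fin K × Fin p) (Fin p) ℝ :=
  crossMoment μ (stackedScore ℓ θ) fun d i => scoreTrue ℓ θ d i

/-- `Σ_g = E{s 𝒮ᵀ} var{𝒮}⁻¹ E{𝒮 sᵀ}`. -/
def sigmaGain (ℓ : 𝒳 → 𝒴 → Par p → ℝ) (μ : Measure (Obs 𝒳 𝒴 K)) (θ : Par p) :
    Matrix (Fin p) (Fin p) ℝ :=
  crossMoment μ (fun d i => scoreTrue ℓ θ d i) (stackedScore ℓ θ) *
    (varStacked ℓ μ θ)⁻¹ * crossStacked ℓ μ θ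

/-- `Σ_opt = Σ_nv - ρ Σ_g`, where `ρ = (N - n) / N`. -/
def sigmaOpt (ℓ : 𝒳 → 𝒴 → Par p → ℝ) (μ : Measure (Obs 𝒳 𝒴 K)) (θ : Par p) (ρ : ℝ) :
    Matrix (Fin p) (Fin p) ℝ :=
  sigmaNaive ℓ μ θ - ρ • sigmaGain ℓ μ θ

/-- `W^opt = ρ var{𝒮}⁻¹ E{𝒮 sᵀ}`, where `ρ = (N - n) / N`. -/
def optWeight (ℓ : 𝒳 → 𝒴 → Par p → ℝ) (μ : Measure (Obs 𝒳 𝒴 K)) (θ : Par p) (ρ : ℝ) :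
    Matrix (Fin K × Fin p) (Fin p) ℝ :=
  ρ • ((varStacked ℓ μ θ)⁻¹ * crossStacked ℓ μ θ)

/-- The asymptotic variance `H⁻¹ Σ_nv H⁻¹` of the naive estimator. -/
def asympVarNaive (ℓ : 𝒳 → 𝒴 → Par p → ℝ) (μ : Measure (Obs 𝒳 𝒴 K)) (θ : Par p) :
    Matrix (Fin p) (Fin p) ℝ :=
  (hessian ℓ μ θ)⁻¹ * sigmaNaive ℓ μ θ * (hessian ℓ μ θ)⁻¹

/-- The asymptotic variance `H⁻¹ Σ_opt H⁻¹` of the SADA estimator. -/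
def asympVarSada (ℓ : 𝒳 → 𝒴 → Par p → ℝ) (μ : Measure (Obs 𝒳 𝒴 K)) (θ : Par p) (ρ : ℝ) :
    Matrix (Fin p) (Fin p) ℝ :=
  (hessian ℓ μ θ)⁻¹ * sigmaOpt ℓ μ θ ρ * (hessian ℓ μ θ)⁻¹

end Population

section Sample

variable {𝒳 𝒴 Ω : Type*} {p K : ℕ}

/-- The proportion `(N - n) / N` of unlabelled units. -/
def unlabFrac (n N : ℕ) : ℝ := ((N : ℝ) - n) / N

/-- `n⁻¹ ∑_{i ≤ n} s(x_i, y_i; θ)`: the left-hand side of the naive estimating equation. The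
units with (zero-based) index below `n` are the labelled ones. -/
def naiveEE (ℓ : 𝒳 → 𝒴 → Par p → ℝ) (Z : ℕ → Ω → Obs 𝒳 𝒴 K) (n : ℕ) (ω : Ω) (θ : Par p) :
    Par p :=
  (n : ℝ)⁻¹ • ∑ i ∈ Finset.range n, scoreTrue ℓ θ (Z i ω)

/-- `(N - n)⁻¹ ∑_{n < i ≤ N} 𝒮(x_i, ŷ_i; θ) - n⁻¹ ∑_{i ≤ n} 𝒮(x_i, ŷ_i; θ)`. -/
def scoreContrast (ℓ : 𝒳 → 𝒴 → Par p → ℝ) (Z : ℕ → Ω → Obs 𝒳 𝒴 K) (n N : ℕ) (ω : Ω)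
    (θ : Par p) : Fin K × Fin p → ℝ :=
  ((N : ℝ) - n)⁻¹ • ∑ i ∈ Finset.Ico n N, stackedScore ℓ θ (Z i ω) -
    (n : ℝ)⁻¹ • ∑ i ∈ Finset.range n, stackedScore ℓ θ (Z i ω)

/-- The left-hand side of the estimating equation with weight matrix
`W = (W₁ᵀ, …, W_Kᵀ)ᵀ ∈ ℝ^{(Kp) × p}`:
`n⁻¹ ∑_{i ≤ n} s(x_i, y_i; θ) + Wᵀ {(N - n)⁻¹ ∑_{n < i ≤ N} 𝒮 - n⁻¹ ∑_{i ≤ n} 𝒮}`. -/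
def weightedEE (ℓ : 𝒳 → 𝒴 → Par p → ℝ) (Z : ℕ → Ω → Obs 𝒳 𝒴 K) (n N : ℕ)
    (W : Matrix (Fin K × Fin p) (Fin p) ℝ) (ω : Ω) (θ : Par p) : Par p :=
  naiveEE ℓ Z n ω θ + WithLp.toLp 2 (Wᵀ *ᵥ scoreContrast ℓ Z n N ω θ)

/-- `-H⁻¹ v`. -/
def negHessInv (H : Matrix (Fin p) (Fin p) ℝ) (v : Par p) : Par p :=
  -WithLp.toLp 2 (H⁻¹ *ᵥ WithLp.ofLp v)

/-- `θhat m` is a random vector that, with probability tending to one as `m → ∞`, lies in `Θ` and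
solves the estimating equation `Ψ m ω θ = 0`. -/
structure IsZEstimator [MeasurableSpace Ω] (P : Measure Ω) (Θ : Set (Par p))
    (Ψ : ℕ → Ω → Par p → Par p) (θhat : ℕ → Ω → Par p) : Prop where
  aemeasurable : ∀ m, AEMeasurable (θhat m) P
  solves : Tendsto (fun m => P {ω | ¬ (θhat m ω ∈ Θ ∧ Ψ m ω (θhat m ω) = 0)}) atTop (𝓝 0)

end Sample

/-- The regularity conditions on the convex loss `ℓ`, the law `μ` of `(X, Y, Ŷ)`, the parameter set
`Θ` and the true parameter `θ₀`. -/
structure Regularity {𝒳 𝒴 : Type*} [MeasurableSpace 𝒳] [MeasurableSpace 𝒴] {p K : ℕ}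
    (ℓ : 𝒳 → 𝒴 → Par p → ℝ) (μ : Measure (Obs 𝒳 𝒴 K)) (Θ : Set (Par p)) (θ₀ : Par p) :
    Prop where
  compact : IsCompact Θ
  mem_interior : θ₀ ∈ interior Θ
  /-- `θ₀` solves the population estimating equation ... -/
  solves : ∫ d, scoreTrue ℓ θ₀ d ∂μ = 0
  /-- ... and no other parameter does. -/
  identifiable : ∀ θ ∈ Θ, θ ≠ θ₀ → ∫ d, scoreTrue ℓ θ d ∂μ ≠ 0
  /-- On an open convex set containing `Θ` the loss is convex and differentiable in the parameter
  and the scores have means. -/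
  convex_loss : ∃ O : Set (Par p), IsOpen O ∧ Convex ℝ O ∧ Θ ⊆ O ∧
    (∀ x y, ConvexOn ℝ O (ℓ x y)) ∧
    (∀ x y, DifferentiableOn ℝ (ℓ x y) O) ∧
    (∀ θ ∈ O, Measurable fun z : 𝒳 × 𝒴 => score ℓ z.1 z.2 θ) ∧
    (∀ θ ∈ O, Integrable (scoreTrue ℓ θ) μ) ∧
    (∀ θ ∈ O, ∀ k, Integrable (scorePred ℓ k θ) μ)
  /-- In a neighbourhood of `θ₀` the score is differentiable in the parameter, its second moments
  are bounded, and its derivative is dominated by an integrable function. -/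
  local_smooth : ∃ U ∈ 𝓝 θ₀,
    (∀ x y, ∀ θ ∈ U, DifferentiableAt ℝ (score ℓ x y) θ) ∧
    (∃ C : ℝ, ∀ θ ∈ U,
      (MemLp (scoreTrue ℓ θ) 2 μ ∧ ∫ d, ‖scoreTrue ℓ θ d‖ ^ 2 ∂μ ≤ C) ∧
      ∀ k, MemLp (scorePred ℓ k θ) 2 μ ∧ ∫ d, ‖scorePred ℓ k θ d‖ ^ 2 ∂μ ≤ C) ∧
    (∃ b : 𝒳 → 𝒴 → ℝ,
      (∀ x y, ∀ θ ∈ U, ‖fderiv ℝ (score ℓ x y) θ‖ ≤ b x y) ∧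
      Integrable (fun d : Obs 𝒳 𝒴 K => b d.1 d.2.1) μ ∧
      ∀ k, Integrable (fun d : Obs 𝒳 𝒴 K => b d.1 (d.2.2 k)) μ)
  hessian_nonsing : IsUnit (hessian ℓ μ θ₀).det
  varStacked_nonsing : IsUnit (varStacked ℓ μ θ₀).det

/-- First-order asymptotics of `θhat m - θ₀` at rate `√(n m)`, with leading term `T m` and
(possibly `m`-dependent) asymptotic variance `V m`. -/
structure FirstOrderAsymptotics {Ω : Type*} [MeasurableSpace Ω] {p : ℕ} (P : Measure Ω)
    (n : ℕ → ℕ) (θhat : ℕ → Ω → Par p) (θ₀ : Par p) (T : ℕ → Ω → Par p)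
    (V : ℕ → Matrix (Fin p) (Fin p) ℝ) : Prop where
  posSemidef : ∀ m, (V m).PosSemidef
  /-- `√n (θhat - θ₀)` and `N(0, V m)` merge weakly. -/
  normal : ∀ f : Par p →ᵇ ℝ,
    Tendsto (fun m => ∫ ω, f (√(n m) • (θhat m ω - θ₀)) ∂P -
      ∫ v, f v ∂(multivariateGaussian 0 (V m))) atTop (𝓝 0)
  /-- `θhat - θ₀ = T + o_p(n^{-1/2})`. -/
  linear : TendstoInMeasure P (fun m ω => √(n m) • (θhat m ω - θ₀ - T m ω)) atTop fun _ => 0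
  memLp : ∀ m, MemLp (T m) 2 P
  mean : ∀ m, 0 < n m → ∫ ω, T m ω ∂P = 0
  /-- `E[T Tᵀ] = V / n` exactly. -/
  secondMoment : ∀ m, 0 < n m →
    crossMoment P (fun ω i => T m ω i) (fun ω i => T m ω i) = (n m : ℝ)⁻¹ • V m
  /-- If `n ‖θhat - θ₀‖²` is uniformly integrable, then the mean squared error matrix of `θhat` is
  `V / n + o(1 / n)`. -/
  mse : UniformIntegrable (fun m ω => √(n m) • (θhat m ω - θ₀)) 2 P → ∀ i j,
    Tendsto (fun m => (n m : ℝ) * crossMoment P (fun ω a => (θhat m ω - θ₀) a)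
      (fun ω a => (θhat m ω - θ₀) a) i j - V m i j) atTop (𝓝 0)
  /-- Under the same condition the covariance matrix of `θhat` is `V / n + o(1 / n)`. -/
  variance : UniformIntegrable (fun m ω => √(n m) • (θhat m ω - θ₀)) 2 P → ∀ i j,
    Tendsto (fun m => (n m : ℝ) * varMatrix P (fun ω a => θhat m ω a) i j - V m i j)
      atTop (𝓝 0)

end SADA

end

/-! Since the mean over all `N` units mixes the labelled and the unlabelled means, the
unlabelled-minus-labelled contrast equals `ρ⁻¹` times (mean over the first `N` units minus mean over
the first `n`), by `scoreContrast_eq`. The effective weight is thus `ρ⁻¹ Ŵ`, and the hypothesis on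
`Ŵ` says exactly that it converges to the fixed matrix `A = Var(𝒮)⁻¹ E[𝒮 sᵀ]`. Only means over
initial segments of one i.i.d. sequence remain; these behave well even if `N - n` stays bounded.

Consistency and linearisation are pathwise. Convexity bounds the scores near any parameter by the
scores at finitely many points, hence by an integrable function; this yields a uniform law of large
numbers on `Θ`. The contrast then vanishes in the limit, and identifiability gives consistency. Near
`θ₀` the dominated derivative makes sample means almost linear, uniformly in the sample size. In the
contrast the two linear parts cancel, so only `H` survives, and `zEstimator_expansion` bounds the
remainder by an arbitrarily small multiple of the leading term plus the contrast at `θ₀`. Both are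
`O(n^{-1/2})` in `L¹`, so the remainder is `o_p(n^{-1/2})`
(`tendstoInMeasure_zEstimator_sub_linear`).

The leading term is `n⁻¹ ∑_{i<n} h₁ + N⁻¹ ∑_{i<N} h₂` with `h₁ = -H⁻¹(s - Aᵀ𝒮̃)` and `h₂ =
-H⁻¹Aᵀ𝒮̃`, where `𝒮̃` is the centred stacked score. With `r = n/N`, its second moment times `n` is
`(1 - r) E[h₁h₁ᵀ] + r E[(h₁+h₂)(h₁+h₂)ᵀ]`. As `h₁ + h₂ = -H⁻¹s` is free of `A`, this equals
`H⁻¹(Σ_nv - ρ Σ_g)H⁻¹` at the optimal `A`. A quantitative expansion of characteristic functions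
gives the normal approximation; compactness of `[0, 1] ∋ n/N` replaces a limit of `n/N` by limits
along subsequences. Uniform integrability carries the approximation over to second moments
(`firstOrderAsymptotics_of_linear`).

The naive estimator is the case `N = n`, `A = 0`, and the comparison of variances reduces to `Σ_g ⪰
0`. -/

namespace SADA

/-! ### Gradients of differentiable convex functions. -/

section ConvexGradient

variable {E : Type*} [NormedAddCommGroup E] [InnerProductSpace ℝ E] [CompleteSpace E]
  {f : E → ℝ} {O : Set E} {x y : E}

lemma inner_gradient_le_sub (hf : ConvexOn ℝ O f) (hx : x ∈ O) (hd : DifferentiableAt ℝ f x)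
    (hy : y ∈ O) : inner ℝ (gradient f x) (y - x) ≤ f y - f x := by
  have hg : HasDerivAt (fun t : ℝ => f (x + t • (y - x))) (inner ℝ (gradient f x) (y - x)) 0 := by
    have h1 : HasFDerivAt f (fderiv ℝ f x) x := hd.hasFDerivAt
    have h2 := (h1.hasLineDerivAt (y - x))
    have h3 : fderiv ℝ f x (y - x) = inner ℝ (gradient f x) (y - x) := by
      rw [gradient, InnerProductSpace.toDual_symm_apply]
    rw [← h3]
    exact h2
  have hs := hg.tendsto_slope_zero_right
  refine le_of_tendsto hs ?_
  have : Set.Ioc (0 : ℝ) 1 ∈ 𝓝[>] (0 : ℝ) := Ioc_mem_nhdsGT one_pos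
  filter_upwards [this] with t ht
  have hc := hf.2 hx hy (sub_nonneg.2 ht.2) ht.1.le (by ring)
  have he : (1 - t) • x + t • y = x + t • (y - x) := by module
  rw [he] at hc
  simp only [smul_eq_mul, zero_add, zero_smul, add_zero] at hc ⊢
  rw [inv_mul_le_iff₀ ht.1]
  linarith

lemma inner_gradient_sub_nonneg (hf : ConvexOn ℝ O f) (hx : x ∈ O) (hy : y ∈ O)
    (hdx : DifferentiableAt ℝ f x) (hdy : DifferentiableAt ℝ f y) :
    0 ≤ inner ℝ (gradient f y - gradient f x) (y - x) := by
  have h1 := inner_gradient_le_sub hf hx hdx hy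
  have h2 := inner_gradient_le_sub hf hy hdy hx
  rw [← neg_sub y x, inner_neg_right] at h2
  rw [inner_sub_left]
  linarith

/-- The gradient inequality is tested at `z` in the direction of `u = ∇f(z) - ∇f(x)`. A step of
length `r/4` gains `‖u‖ r/4` over the linear part at `x`, while differentiability at `x` allows an
error of at most `ε/8 · (r/4 + r/2)`. Hence `‖u‖ ≤ 3ε/8`. -/
lemma continuousAt_gradient (hO : IsOpen O) (hf : ConvexOn ℝ O f)
    (hd : DifferentiableOn ℝ f O) (hx : x ∈ O) : ContinuousAt (gradient f) x := by
  have hdx : ∀ z ∈ O, DifferentiableAt ℝ f z := fun z hz => hd.differentiableAt (hO.mem_nhds hz)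
  rw [Metric.continuousAt_iff]
  intro ε hε
  have h0 : HasFDerivAt f (fderiv ℝ f x) x := (hdx x hx).hasFDerivAt
  have hlit := h0.isLittleO.def (show (0 : ℝ) < ε / 8 by positivity)
  obtain ⟨r, hr, hball⟩ := Metric.eventually_nhds_iff.1 (hlit.and (hO.mem_nhds hx))
  refine ⟨r / 4, by positivity, fun {z} hz => ?_⟩
  have hzO : z ∈ O := (hball (y := z) (by linarith)).2
  rw [dist_eq_norm]
  set u := gradient f z - gradient f x with hu
  by_cases hu0 : u = 0
  · rw [hu0, norm_zero]; exact hε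
  have hupos : 0 < ‖u‖ := norm_pos_iff.2 hu0
  set h : E := (r / 4 / ‖u‖) • u with hh
  have hhn : ‖h‖ = r / 4 := by
    rw [hh, norm_smul, Real.norm_of_nonneg (by positivity)]
    field_simp
  have hzx : ‖z - x‖ < r / 4 := by rwa [← dist_eq_norm]
  have hzh : dist (z + h) x < r := by
    rw [dist_eq_norm, show z + h - x = (z - x) + h by abel]
    linarith [norm_add_le (z - x) h]
  have hsub := inner_gradient_le_sub hf hzO (hdx z hzO) (hball hzh).2
  have hz1 := (hball (y := z) (by linarith)).1
  have hz2 := (hball hzh).1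
  have hin : ∀ v, fderiv ℝ f x v = inner ℝ (gradient f x) v := fun v => by
    rw [gradient, InnerProductSpace.toDual_symm_apply]
  rw [hin, Real.norm_eq_abs] at hz1 hz2
  have h1 := (abs_le.1 hz1).1
  have h2 := (abs_le.1 hz2).2
  have hn2 : ‖z + h - x‖ ≤ r / 2 := by
    rw [show z + h - x = (z - x) + h by abel]
    linarith [norm_add_le (z - x) h]
  have hinu : inner ℝ u h = r / 4 * ‖u‖ := by
    rw [hh, inner_smul_right, real_inner_self_eq_norm_sq]
    field_simp
  rw [show z + h - x = (z - x) + h by abel, inner_add_right] at h2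
  rw [show (z - x) + h = z + h - x by abel] at h2
  rw [add_sub_cancel_left] at hsub
  rw [hu, inner_sub_left] at hinu
  have : r / 4 * ‖u‖ ≤ ε / 8 * (r / 4) + ε / 8 * (r / 2) := by
    have e1 : ε / 8 * ‖z - x‖ ≤ ε / 8 * (r / 4) := by gcongr
    have e2 : ε / 8 * ‖z + h - x‖ ≤ ε / 8 * (r / 2) := by gcongr
    linarith
  have : r / 4 * ‖u‖ ≤ r / 4 * (3 / 8 * ε) := by linarith
  have := le_of_mul_le_mul_left this (by positivity)
  linarith

/-- The gradient of a convex function near `x` is bounded by its gradients at finitely many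
points. -/
lemma norm_gradient_le_sum {p : ℕ} {f : Par p → ℝ} {O : Set (Par p)} {x z : Par p} {t : ℝ}
    (hO : IsOpen O) (hf : ConvexOn ℝ O f) (hd : DifferentiableOn ℝ f O)
    (ht : 0 < t) (hball : Metric.closedBall x t ⊆ O)
    (hz : ‖z - x‖ ≤ t / (2 * (p + 1))) :
    ‖gradient f z‖ ≤ 4 * ∑ i, (‖gradient f (x + EuclideanSpace.single i t)‖ +
      ‖gradient f (x - EuclideanSpace.single i t)‖) := by
  have hdx : ∀ z ∈ O, DifferentiableAt ℝ f z := fun z hz => hd.differentiableAt (hO.mem_nhds hz)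
  set g := gradient f z with hg
  have hp1 : (1 : ℝ) ≤ p + 1 := by linarith [(Nat.cast_nonneg p : (0 : ℝ) ≤ p)]
  have hzt : ‖z - x‖ ≤ t := hz.trans (div_le_self ht.le (by linarith))
  have hzO : z ∈ O := hball (by rwa [Metric.mem_closedBall, dist_eq_norm])
  -- Monotonicity of the gradient between `z` and `x + w`. The last term is the price for `z ≠ x`;
  -- the factor `1 / (2(p+1))` keeps the sum of `p` such terms below `t‖g‖/2`.
  have key : ∀ w : Par p, ‖w‖ = t → inner ℝ g w ≤ ‖gradient f (x + w)‖ * (2 * t) +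
      ‖g‖ * (t / (2 * (p + 1))) := by
    intro w hw
    have hwO : x + w ∈ O := hball (by rw [Metric.mem_closedBall, dist_eq_norm]; simp [hw])
    have h := inner_gradient_sub_nonneg hf hzO hwO (hdx z hzO) (hdx _ hwO)
    rw [show x + w - z = w - (z - x) by abel, inner_sub_left, inner_sub_right g] at h
    have h1 : inner ℝ (gradient f (x + w)) (w - (z - x)) ≤ ‖gradient f (x + w)‖ * (2 * t) := by
      refine (real_inner_le_norm _ _).trans ?_
      gcongr
      linarith [norm_sub_le w (z - x)]
    have h2 : inner ℝ g (z - x) ≤ ‖g‖ * (t / (2 * (p + 1))) :=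
      (real_inner_le_norm _ _).trans (by gcongr)
    linarith
  have hcoord : ∀ i, t * ‖g i‖ ≤ (‖gradient f (x + EuclideanSpace.single i t)‖ +
      ‖gradient f (x - EuclideanSpace.single i t)‖) * (2 * t) + ‖g‖ * (t / (2 * (p + 1))) := by
    intro i
    have hnorm : ‖EuclideanSpace.single i t‖ = t := by simp [abs_of_pos ht]
    have h1 := key (EuclideanSpace.single i t) hnorm
    have h2 := key (-EuclideanSpace.single i t) (by rw [norm_neg, hnorm])
    rw [inner_neg_right, ← sub_eq_add_neg] at h2
    have hi : inner ℝ g (EuclideanSpace.single i t) = t * g i := by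
      simp [EuclideanSpace.inner_single_right]
    rw [hi] at h1 h2
    have a1 := mul_nonneg (norm_nonneg (gradient f (x + EuclideanSpace.single i t))) ht.le
    have a2 := mul_nonneg (norm_nonneg (gradient f (x - EuclideanSpace.single i t))) ht.le
    rw [Real.norm_eq_abs]
    rcases abs_cases (g i) with ⟨h, -⟩ | ⟨h, -⟩ <;> rw [h] <;> linarith
  have hsum : ‖g‖ ≤ ∑ i, ‖g i‖ := by
    conv_lhs => rw [← (EuclideanSpace.basisFun (Fin p) ℝ).sum_repr g]
    refine (norm_sum_le _ _).trans (le_of_eq ?_)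
    simp [norm_smul]
  -- Absorbing `t‖g‖/2` on the left doubles the factor `2t`, whence the constant `4`.
  have h3 : t * ‖g‖ ≤ (∑ i, (‖gradient f (x + EuclideanSpace.single i t)‖ +
      ‖gradient f (x - EuclideanSpace.single i t)‖)) * (2 * t) + ‖g‖ * (t / 2) := by
    calc t * ‖g‖ ≤ t * ∑ i, ‖g i‖ := by gcongr
      _ = ∑ i, t * ‖g i‖ := Finset.mul_sum ..
      _ ≤ ∑ i, ((‖gradient f (x + EuclideanSpace.single i t)‖ +
        ‖gradient f (x - EuclideanSpace.single i t)‖) * (2 * t) +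
          ‖g‖ * (t / (2 * (p + 1)))) := Finset.sum_le_sum fun i _ => hcoord i
      _ = (∑ i, (‖gradient f (x + EuclideanSpace.single i t)‖ +
        ‖gradient f (x - EuclideanSpace.single i t)‖)) * (2 * t) +
          p * (‖g‖ * (t / (2 * (p + 1)))) := by
        rw [Finset.sum_add_distrib, Finset.sum_mul]; simp
      _ ≤ _ := by
        have : p * (‖g‖ * (t / (2 * (p + 1)))) ≤ ‖g‖ * (t / 2) := by
          rw [show (p : ℝ) * (‖g‖ * (t / (2 * (p + 1)))) = (p / (p + 1)) * (‖g‖ * (t / 2)) by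
            field_simp]
          exact mul_le_of_le_one_left (by positivity) ((div_le_one (by positivity)).2 (by linarith))
        linarith
  exact le_of_mul_le_mul_left (by linarith) ht

end ConvexGradient

/-! ### Sample means over initial segments. -/

section SampleMean

variable {D F : Type*}

/-- The mean of `f` over the first `n` terms of the sample `z`. -/
noncomputable def sampleMean [AddCommGroup F] [Module ℝ F] (z : ℕ → D) (n : ℕ) (f : D → F) : F :=
  (n : ℝ)⁻¹ • ∑ i ∈ Finset.range n, f (z i)

lemma sampleMean_mono {z : ℕ → D} {n : ℕ} {f g : D → ℝ} (h : ∀ d, f d ≤ g d) :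
    sampleMean z n f ≤ sampleMean z n g := by
  unfold sampleMean
  simp only [smul_eq_mul]
  gcongr
  exact h _

lemma sampleMean_sub [AddCommGroup F] [Module ℝ F] {z : ℕ → D} {n : ℕ} (f g : D → F) :
    sampleMean z n (fun d => f d - g d) = sampleMean z n f - sampleMean z n g := by
  simp [sampleMean, Finset.sum_sub_distrib, smul_sub]

lemma norm_sampleMean_le [NormedAddCommGroup F] [NormedSpace ℝ F] {z : ℕ → D} {n : ℕ}
    (f : D → F) : ‖sampleMean z n f‖ ≤ sampleMean z n fun d => ‖f d‖ := by
  unfold sampleMean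
  rw [norm_smul, Real.norm_of_nonneg (by positivity), smul_eq_mul]
  gcongr
  exact norm_sum_le _ _

end SampleMean

/-! ### Envelopes with small mean, and uniform laws of large numbers. -/

section LawOfLargeNumbers

variable {D E F Ω : Type*} [MeasurableSpace D] [MeasurableSpace Ω] {μ : Measure D}

/-- The suprema of `φ d` over shrinking balls are dominated and tend to zero for each `d`, so some
radius makes their mean less than `ε`. This serves twice: for the oscillation of the score, and for
its linearisation error divided by the distance to `θ₀`. -/
lemma exists_small_envelope [PseudoMetricSpace E] [TopologicalSpace.SeparableSpace E]
    {φ : D → E → ℝ} {x₀ : E} {r : ℝ} (hr : 0 < r) {g₀ : D → ℝ} (hg₀ : Integrable g₀ μ)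
    (hmeas : ∀ x ∈ Metric.ball x₀ r, Measurable fun d => φ d x)
    (hcont : ∀ d, ∀ x ∈ Metric.ball x₀ r, x ≠ x₀ → ContinuousAt (φ d) x)
    (hdom : ∀ d, ∀ x ∈ Metric.ball x₀ r, φ d x ≤ g₀ d)
    (h0 : ∀ d, φ d x₀ = 0) (hlim : ∀ d, ContinuousAt (φ d) x₀) {ε : ℝ} (hε : 0 < ε) :
    ∃ δ > 0, ∃ g : D → ℝ, Measurable g ∧ Integrable g μ ∧ ∫ d, g d ∂μ < ε ∧
      ∀ d x, dist x x₀ < δ → φ d x ≤ g d := by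
  obtain ⟨S, hSc, hSd⟩ := TopologicalSpace.exists_countable_dense E
  set δ : ℕ → ℝ := fun k => r / (k + 1) with hδ
  have hδpos : ∀ k, 0 < δ k := fun k => by positivity
  have hδr : ∀ k, δ k ≤ r := fun k =>
    div_le_self hr.le (by linarith [(Nat.cast_nonneg k : (0 : ℝ) ≤ k)])
  have hδ0 : Tendsto δ atTop (𝓝 0) := by
    have := tendsto_one_div_add_atTop_nhds_zero_nat (𝕜 := ℝ) |>.const_mul r
    simpa [hδ, div_eq_mul_inv] using this
  -- The supremum runs over a countable dense set to be measurable, and in `ℝ≥0∞` so that it always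
  -- exists. Continuity extends the bound to the whole ball below.
  set G : ℕ → D → ℝ≥0∞ := fun k d => ⨆ x ∈ S ∩ Metric.ball x₀ (δ k), ENNReal.ofReal (φ d x)
    with hG
  have hball : ∀ k, Metric.ball x₀ (δ k) ⊆ Metric.ball x₀ r :=
    fun k => Metric.ball_subset_ball (hδr k)
  have hGm : ∀ k, Measurable (G k) := fun k =>
    Measurable.biSup _ (hSc.mono Set.inter_subset_left) fun x hx =>
      (hmeas x (hball k hx.2)).ennreal_ofReal
  have hGdom : ∀ k d, G k d ≤ ENNReal.ofReal (g₀ d) := fun k d =>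
    iSup₂_le fun x hx => ENNReal.ofReal_le_ofReal (hdom d x (hball k hx.2))
  have hG0 : ∀ d, Tendsto (fun k => G k d) atTop (𝓝 0) := by
    intro d
    rw [ENNReal.tendsto_atTop_zero]
    intro η hη
    by_cases hηt : η = ∞
    · exact ⟨0, fun _ _ => hηt ▸ le_top⟩
    have hη' : 0 < η.toReal := ENNReal.toReal_pos hη.ne' hηt
    have hev : ∀ᶠ x in 𝓝 x₀, φ d x < η.toReal := by
      have := hlim d
      rw [ContinuousAt, h0] at this
      exact this.eventually_lt_const hη'
    obtain ⟨s, hs, hsx⟩ := Metric.eventually_nhds_iff_ball.1 hev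
    obtain ⟨k₀, hk₀⟩ := eventually_atTop.1 (hδ0.eventually_lt_const hs)
    refine ⟨k₀, fun k hk => iSup₂_le fun x hx => ?_⟩
    refine ENNReal.ofReal_le_of_le_toReal (hsx x ?_).le
    exact lt_trans hx.2 (hk₀ k hk)
  have hlint : Tendsto (fun k => ∫⁻ d, G k d ∂μ) atTop (𝓝 0) := by
    have := tendsto_lintegral_of_dominated_convergence (μ := μ) (F := G) (f := fun _ => 0)
      (fun d => ENNReal.ofReal (g₀ d)) hGm (fun k => ae_of_all _ (hGdom k))
      hg₀.lintegral_lt_top.ne (ae_of_all _ hG0)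
    simpa using this
  obtain ⟨k, hk⟩ := (hlint.eventually_lt_const (ENNReal.ofReal_pos.2 hε)).exists
  have hfin : ∀ d, G k d ≠ ∞ := fun d => ((hGdom k d).trans_lt ENNReal.ofReal_lt_top).ne
  have hkt : ∫⁻ d, G k d ∂μ ≠ ∞ := (hk.trans ENNReal.ofReal_lt_top).ne
  refine ⟨δ k, hδpos k, fun d => (G k d).toReal, (hGm k).ennreal_toReal,
    integrable_toReal_of_lintegral_ne_top (hGm k).aemeasurable hkt, ?_, fun d x hx => ?_⟩
  · rw [integral_toReal (hGm k).aemeasurable (ae_of_all _ fun d => (hfin d).lt_top)]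
    exact (ENNReal.toReal_lt_of_lt_ofReal hk)
  · by_cases hxx : x = x₀
    · rw [hxx, h0]; exact ENNReal.toReal_nonneg
    have hcl : x ∈ closure (S ∩ Metric.ball x₀ (δ k)) := by
      rw [Set.inter_comm]
      exact hSd.open_subset_closure_inter Metric.isOpen_ball hx
    refine le_of_tendsto_of_frequently (hcont d x (hball k hx) hxx)
      ((mem_closure_iff_frequently.1 hcl).mono fun y hy => ?_)
    exact (ENNReal.ofReal_le_iff_le_toReal (hfin d)).1
      (le_iSup₂ (f := fun x (_ : x ∈ S ∩ Metric.ball x₀ (δ k)) => ENNReal.ofReal (φ d x)) y hy)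

variable {P : Measure Ω} {Z : ℕ → Ω → D}

lemma ae_tendsto_sampleMean [NormedAddCommGroup F] [NormedSpace ℝ F] [CompleteSpace F]
    [MeasurableSpace F] [BorelSpace F] [SecondCountableTopology F]
    (hlaw : ∀ i, HasLaw (Z i) μ P) (hindep : iIndepFun Z P)
    {f : D → F} (hf : Measurable f) (hfi : Integrable f μ) :
    ∀ᵐ ω ∂P, Tendsto (fun n => sampleMean (fun i => Z i ω) n f) atTop (𝓝 (∫ d, f d ∂μ)) := by
  have hid : ∀ i, IdentDistrib (Z i) (Z 0) P P := fun i =>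
    ⟨(hlaw i).aemeasurable, (hlaw 0).aemeasurable, by rw [(hlaw i).map_eq, (hlaw 0).map_eq]⟩
  have hi : Integrable (f ∘ Z 0) P :=
    ((hlaw 0).map_eq ▸ hfi).comp_aemeasurable (hlaw 0).aemeasurable
  have h := strong_law_ae (fun i => f ∘ Z i) hi
    (fun i j hij => (hindep.indepFun hij).comp hf hf) (fun i => (hid i).comp hf)
  have he : ∫ ω, (f ∘ Z 0) ω ∂P = ∫ d, f d ∂μ := by
    rw [← (hlaw 0).map_eq, integral_map (hlaw 0).aemeasurable hf.aestronglyMeasurable]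
    rfl
  rw [he] at h
  exact h

/-- A uniform law of large numbers under local domination of the oscillation. -/
lemma ae_tendstoUniformlyOn_sampleMean [PseudoMetricSpace E]
    [NormedAddCommGroup F] [NormedSpace ℝ F] [CompleteSpace F]
    [MeasurableSpace F] [BorelSpace F] [SecondCountableTopology F]
    (hlaw : ∀ i, HasLaw (Z i) μ P) (hindep : iIndepFun Z P) {Θ : Set E} (hΘ : IsCompact Θ)
    {q : D → E → F} (hqm : ∀ θ ∈ Θ, Measurable fun d => q d θ)
    (hqi : ∀ θ ∈ Θ, Integrable (fun d => q d θ) μ)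
    (hosc : ∀ θ ∈ Θ, ∀ ε > 0, ∃ δ > 0, ∃ g : D → ℝ, Measurable g ∧ Integrable g μ ∧
      ∫ d, g d ∂μ < ε ∧ ∀ d x, dist x θ < δ → ‖q d x - q d θ‖ ≤ g d) :
    ∀ᵐ ω ∂P, TendstoUniformlyOn (fun n θ => sampleMean (fun i => Z i ω) n fun d => q d θ)
      (fun θ => ∫ d, q d θ ∂μ) atTop Θ := by
  have hmain : ∀ ε > 0, ∀ᵐ ω ∂P, ∀ᶠ n in atTop, ∀ θ ∈ Θ,
      ‖sampleMean (fun i => Z i ω) n (fun d => q d θ) - ∫ d, q d θ ∂μ‖ < 3 * ε := by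
    intro ε hε
    choose! δ hδ g hgm hgi hgε hg using fun θ hθ => hosc θ hθ ε hε
    -- Finitely many balls suffice. The `3ε` consists of the oscillation of the sample mean, the
    -- error at a centre, and the oscillation of the population mean.
    obtain ⟨t, htΘ, htc⟩ := hΘ.elim_nhds_subcover (fun θ => Metric.ball θ (δ θ))
      fun θ hθ => Metric.ball_mem_nhds θ (hδ θ hθ)
    have h1 : ∀ᵐ ω ∂P, ∀ θ ∈ t, Tendsto (fun n => sampleMean (fun i => Z i ω) n fun d => q d θ)
        atTop (𝓝 (∫ d, q d θ ∂μ)) :=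
      (ae_ball_iff t.countable_toSet).2 fun θ hθ =>
        ae_tendsto_sampleMean hlaw hindep (hqm θ (htΘ θ hθ)) (hqi θ (htΘ θ hθ))
    have h2 : ∀ᵐ ω ∂P, ∀ θ ∈ t, Tendsto (fun n => sampleMean (fun i => Z i ω) n (g θ))
        atTop (𝓝 (∫ d, g θ d ∂μ)) :=
      (ae_ball_iff t.countable_toSet).2 fun θ hθ =>
        ae_tendsto_sampleMean hlaw hindep (hgm θ (htΘ θ hθ)) (hgi θ (htΘ θ hθ))
    filter_upwards [h1, h2] with ω hω1 hω2
    have h3 : ∀ᶠ n in atTop, ∀ θ ∈ t,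
        ‖sampleMean (fun i => Z i ω) n (fun d => q d θ) - ∫ d, q d θ ∂μ‖ < ε ∧
        sampleMean (fun i => Z i ω) n (g θ) < ε := by
      rw [Filter.eventually_all_finset]
      intro θ hθ
      refine ((Metric.tendsto_nhds.1 (hω1 θ hθ) ε hε).mono fun n hn => ?_).and
        ((hω2 θ hθ).eventually_lt_const (hgε θ (htΘ θ hθ)))
      rwa [dist_eq_norm] at hn
    filter_upwards [h3] with n hn θ hθ
    obtain ⟨θ', hθ't, hθθ'⟩ := Set.mem_iUnion₂.1 (htc hθ)
    have hd : ∀ d, ‖q d θ - q d θ'‖ ≤ g θ' d := fun d => hg θ' (htΘ θ' hθ't) d θ hθθ'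
    have e1 : ‖sampleMean (fun i => Z i ω) n (fun d => q d θ) -
        sampleMean (fun i => Z i ω) n (fun d => q d θ')‖ < ε := by
      rw [← sampleMean_sub]
      exact ((norm_sampleMean_le _).trans (sampleMean_mono hd)).trans_lt (hn θ' hθ't).2
    have e2 : ‖∫ d, q d θ' ∂μ - ∫ d, q d θ ∂μ‖ < ε := by
      rw [norm_sub_rev, ← integral_sub (hqi θ hθ) (hqi θ' (htΘ θ' hθ't))]
      exact (norm_integral_le_of_norm_le (hgi θ' (htΘ θ' hθ't)) (ae_of_all _ hd)).trans_lt
        (hgε θ' (htΘ θ' hθ't))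
    have e3 := (hn θ' hθ't).1
    calc _ = ‖(sampleMean (fun i => Z i ω) n (fun d => q d θ) -
            sampleMean (fun i => Z i ω) n (fun d => q d θ')) +
          (sampleMean (fun i => Z i ω) n (fun d => q d θ') - ∫ d, q d θ' ∂μ) +
          (∫ d, q d θ' ∂μ - ∫ d, q d θ ∂μ)‖ := by congr 1; abel
      _ < 3 * ε := by
        refine (norm_add₃_le).trans_lt ?_
        linarith
  -- The exceptional null set depends on `ε`, so `ε` is restricted to a countable sequence.
  have hall : ∀ᵐ ω ∂P, ∀ k : ℕ, ∀ᶠ n in atTop, ∀ θ ∈ Θ,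
      ‖sampleMean (fun i => Z i ω) n (fun d => q d θ) - ∫ d, q d θ ∂μ‖ < 3 * (1 / ((k : ℝ) + 1)) :=
    ae_all_iff.2 fun k => hmain _ (by positivity)
  filter_upwards [hall] with ω hω
  rw [Metric.tendstoUniformlyOn_iff]
  intro ε hε
  obtain ⟨k, hk⟩ := exists_nat_one_div_lt (show 0 < ε / 3 by positivity)
  filter_upwards [hω k] with n hn θ hθ
  rw [dist_eq_norm, norm_sub_rev]
  linarith [hn θ hθ]

lemma continuousOn_integral_of_oscillation [PseudoMetricSpace E]
    [NormedAddCommGroup F] [NormedSpace ℝ F] {Θ : Set E} {q : D → E → F}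
    (hqi : ∀ θ ∈ Θ, Integrable (fun d => q d θ) μ)
    (hosc : ∀ θ ∈ Θ, ∀ ε > 0, ∃ δ > 0, ∃ g : D → ℝ, Measurable g ∧ Integrable g μ ∧
      ∫ d, g d ∂μ < ε ∧ ∀ d x, dist x θ < δ → ‖q d x - q d θ‖ ≤ g d) :
    ContinuousOn (fun θ => ∫ d, q d θ ∂μ) Θ := by
  rw [Metric.continuousOn_iff]
  intro θ hθ ε hε
  obtain ⟨δ, hδ, g, -, hgi, hgε, hg⟩ := hosc θ hθ ε hε
  refine ⟨δ, hδ, fun x hx hxθ => ?_⟩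
  rw [dist_eq_norm, ← integral_sub (hqi x hx) (hqi θ hθ)]
  exact (norm_integral_le_of_norm_le hgi (ae_of_all _ fun d => hg d x hxθ)).trans_lt hgε

/-- Sample means are, uniformly in the sample size, almost linear near `θ₀`. -/
lemma ae_sampleMean_almost_linear [NormedAddCommGroup E] [NormedSpace ℝ E]
    [FiniteDimensional ℝ E] [NormedAddCommGroup F] [NormedSpace ℝ F] [FiniteDimensional ℝ F]
    [MeasurableSpace (E →L[ℝ] F)] [BorelSpace (E →L[ℝ] F)]
    (hlaw : ∀ i, HasLaw (Z i) μ P) (hindep : iIndepFun Z P) {θ₀ : E}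
    {q : D → E → F} {q' : D → E →L[ℝ] F} (hqm : Measurable q') (hqi : Integrable q' μ)
    (hlin : ∀ ε > 0, ∃ δ > 0, ∃ g : D → ℝ, Measurable g ∧ Integrable g μ ∧
      ∫ d, g d ∂μ < ε ∧ ∀ d x, dist x θ₀ < δ →
        ‖q d x - q d θ₀ - q' d (x - θ₀)‖ ≤ g d * ‖x - θ₀‖) :
    ∀ᵐ ω ∂P, ∀ ε > 0, ∃ δ > 0, ∀ᶠ n in atTop, ∀ x, dist x θ₀ < δ →
      ‖sampleMean (fun i => Z i ω) n (fun d => q d x) -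
        sampleMean (fun i => Z i ω) n (fun d => q d θ₀) - (∫ d, q' d ∂μ) (x - θ₀)‖
          ≤ ε * ‖x - θ₀‖ := by
  have hmain : ∀ ε > 0, ∀ᵐ ω ∂P, ∃ δ > 0, ∀ᶠ n in atTop, ∀ x, dist x θ₀ < δ →
      ‖sampleMean (fun i => Z i ω) n (fun d => q d x) -
        sampleMean (fun i => Z i ω) n (fun d => q d θ₀) - (∫ d, q' d ∂μ) (x - θ₀)‖
          ≤ 2 * ε * ‖x - θ₀‖ := by
    intro ε hε
    obtain ⟨δ, hδ, g, hgm, hgi, hgε, hg⟩ := hlin ε hε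
    have : ProperSpace (E →L[ℝ] F) := FiniteDimensional.proper ℝ _
    have : CompleteSpace F := FiniteDimensional.complete ℝ F
    filter_upwards [ae_tendsto_sampleMean hlaw hindep hqm hqi,
      ae_tendsto_sampleMean hlaw hindep hgm hgi] with ω h1 h2
    refine ⟨δ, hδ, ?_⟩
    filter_upwards [Metric.tendsto_nhds.1 h1 ε hε, h2.eventually_lt_const hgε] with n hn1 hn2 x hx
    set z := fun i => Z i ω
    have e1 : sampleMean z n (fun d => q' d (x - θ₀)) = sampleMean z n q' (x - θ₀) := by
      simp [sampleMean]
    have e2 : ‖sampleMean z n (fun d => q d x) - sampleMean z n (fun d => q d θ₀) -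
        sampleMean z n q' (x - θ₀)‖ ≤ ε * ‖x - θ₀‖ := by
      rw [← e1, ← sampleMean_sub, ← sampleMean_sub]
      refine (norm_sampleMean_le _).trans ((sampleMean_mono fun d => hg d x hx).trans ?_)
      have : sampleMean z n (fun d => g d * ‖x - θ₀‖) = sampleMean z n g * ‖x - θ₀‖ := by
        simp [sampleMean, ← Finset.sum_mul, mul_assoc]
      rw [this]
      gcongr
    have e3 : ‖sampleMean z n q' (x - θ₀) - (∫ d, q' d ∂μ) (x - θ₀)‖ ≤ ε * ‖x - θ₀‖ := by
      rw [← _root_.sub_apply]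
      refine (ContinuousLinearMap.le_opNorm _ _).trans ?_
      rw [dist_eq_norm] at hn1
      gcongr
    calc _ = ‖(sampleMean z n (fun d => q d x) - sampleMean z n (fun d => q d θ₀) -
        sampleMean z n q' (x - θ₀)) +
          (sampleMean z n q' (x - θ₀) - (∫ d, q' d ∂μ) (x - θ₀))‖ := by congr 1; abel
      _ ≤ _ := (norm_add_le _ _).trans (by linarith)
  have hall := ae_all_iff.2 fun k : ℕ => hmain (1 / ((k : ℝ) + 1)) (by positivity)
  filter_upwards [hall] with ω hω ε hε
  obtain ⟨k, hk⟩ := exists_nat_one_div_lt (show 0 < ε / 2 by positivity)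
  obtain ⟨δ, hδ, h⟩ := hω k
  refine ⟨δ, hδ, h.mono fun n hn x hx => (hn x hx).trans ?_⟩
  gcongr
  linarith

end LawOfLargeNumbers

/-! ### Deterministic expansion of roots of an estimating equation. -/

section ZEstimation

variable {E F : Type*} [NormedAddCommGroup E] [NormedSpace ℝ E]
  [NormedAddCommGroup F] [NormedSpace ℝ F]

/-- Away from `θ₀` the norm of `φ` has a positive minimum on the compact set, so small values force
closeness to `θ₀`. -/
lemma tendsto_of_tendsto_norm_comp_zero {E F : Type*} [PseudoMetricSpace E]
    [NormedAddCommGroup F] {Θ : Set E} (hΘ : IsCompact Θ) {φ : E → F} (hφ : ContinuousOn φ Θ)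
    {θ₀ : E} (hid : ∀ θ ∈ Θ, θ ≠ θ₀ → φ θ ≠ 0) {θ : ℕ → E} (hmem : ∀ᶠ m in atTop, θ m ∈ Θ)
    (h0 : Tendsto (fun m => ‖φ (θ m)‖) atTop (𝓝 0)) : Tendsto θ atTop (𝓝 θ₀) := by
  rw [Metric.tendsto_nhds]
  intro ε hε
  set K := Θ \ Metric.ball θ₀ ε with hK
  have hKc : IsCompact K := hΘ.diff Metric.isOpen_ball
  rcases K.eq_empty_or_nonempty with hKe | hKn
  · filter_upwards [hmem] with m hm
    by_contra hcon
    have : θ m ∈ K := ⟨hm, fun h => hcon h⟩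
    rw [hKe] at this
    exact this
  · obtain ⟨x, hx, hmin⟩ := hKc.exists_isMinOn hKn
      (hφ.norm.mono (Set.sdiff_subset : K ⊆ Θ))
    have hpos : 0 < ‖φ x‖ := by
      refine norm_pos_iff.2 (hid x hx.1 fun h => hx.2 ?_)
      rw [h]; exact Metric.mem_ball_self hε
    filter_upwards [hmem, h0.eventually_lt_const hpos] with m hm hlt
    by_contra hcon
    have h2 : ‖φ x‖ ≤ ‖φ (θ m)‖ := hmin (show θ m ∈ K from ⟨hm, fun h => hcon h⟩)
    linarith

/-- A statement about a single sample path. `S (N m)` and `S (n m)` share their limit, so the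
weighted contrast is uniformly negligible and the root is consistent. They also share the derivative
`J'`, so the contrast adds nothing to the linear part and only `J` has to be inverted. The term `‖S
(N m) θ₀ - S (n m) θ₀‖` in the bound pays for replacing `B m` by its limit. -/
lemma zEstimator_expansion {Θ : Set E} (hΘ : IsCompact Θ) {θ₀ : E}
    {s : ℕ → E → E} {S : ℕ → E → F} {sLim : E → E} {SLim : E → F}
    (hs : TendstoUniformlyOn s sLim atTop Θ) (hS : TendstoUniformlyOn S SLim atTop Θ)
    (hcont : ContinuousOn sLim Θ) (hid : ∀ θ ∈ Θ, θ ≠ θ₀ → sLim θ ≠ 0)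
    {J : E ≃L[ℝ] E} {J' : E →L[ℝ] F}
    (hsl : ∀ ε > 0, ∃ δ > 0, ∀ᶠ n in atTop, ∀ x, dist x θ₀ < δ →
      ‖s n x - s n θ₀ - J (x - θ₀)‖ ≤ ε * ‖x - θ₀‖)
    (hSl : ∀ ε > 0, ∃ δ > 0, ∀ᶠ n in atTop, ∀ x, dist x θ₀ < δ →
      ‖S n x - S n θ₀ - J' (x - θ₀)‖ ≤ ε * ‖x - θ₀‖)
    {n N : ℕ → ℕ} (hn : Tendsto n atTop atTop) (hN : Tendsto N atTop atTop)
    {B : ℕ → F →L[ℝ] E} {B₀ : F →L[ℝ] E} (hB : Tendsto B atTop (𝓝 B₀))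
    {θ : ℕ → E} (hθ : ∀ᶠ m in atTop, θ m ∈ Θ ∧
      s (n m) (θ m) + B m (S (N m) (θ m) - S (n m) (θ m)) = 0) {ε : ℝ} (hε : 0 < ε) :
    ∀ᶠ m in atTop,
      ‖θ m - θ₀ - -J.symm (s (n m) θ₀ + B₀ (S (N m) θ₀ - S (n m) θ₀))‖ ≤
        ε * (‖-J.symm (s (n m) θ₀ + B₀ (S (N m) θ₀ - S (n m) θ₀))‖ +
          ‖S (N m) θ₀ - S (n m) θ₀‖) := by
  set M : ℝ := ‖B₀‖ + 1 with hM
  have hMpos : 0 < M := by positivity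
  have hBM : ∀ᶠ m in atTop, ‖B m‖ ≤ M :=
    (hB.norm.eventually_lt_const (show ‖B₀‖ < M by linarith)).mono fun _ h => h.le
  have hcons : Tendsto θ atTop (𝓝 θ₀) := by
    refine tendsto_of_tendsto_norm_comp_zero hΘ hcont hid (hθ.mono fun m h => h.1) ?_
    rw [Metric.tendsto_nhds]
    intro η hη
    -- One share for `s`, and `M` times two shares for the difference of the two `S`.
    have hη' : 0 < η / (1 + 2 * M) := by positivity
    filter_upwards [hθ, hBM, hn.eventually (Metric.tendstoUniformlyOn_iff.1 hs _ hη'),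
      hn.eventually (Metric.tendstoUniformlyOn_iff.1 hS _ hη'),
      hN.eventually (Metric.tendstoUniformlyOn_iff.1 hS _ hη')] with m hm hBm h1 h2 h3
    obtain ⟨hmΘ, hm0⟩ := hm
    have h1 := h1 _ hmΘ
    have h2 := h2 _ hmΘ
    have h3 := h3 _ hmΘ
    rw [dist_eq_norm] at h1 h2 h3
    have hS2 : ‖S (N m) (θ m) - S (n m) (θ m)‖ ≤ 2 * (η / (1 + 2 * M)) := by
      rw [show S (N m) (θ m) - S (n m) (θ m) =
        (SLim (θ m) - S (n m) (θ m)) - (SLim (θ m) - S (N m) (θ m)) by abel]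
      refine (norm_sub_le _ _).trans ?_
      linarith
    have hbd : ‖B m (S (N m) (θ m) - S (n m) (θ m))‖ ≤ M * (2 * (η / (1 + 2 * M))) :=
      (ContinuousLinearMap.le_opNorm _ _).trans (by gcongr)
    have he : sLim (θ m) = (sLim (θ m) - s (n m) (θ m)) -
        B m (S (N m) (θ m) - S (n m) (θ m)) := by
      rw [eq_neg_of_add_eq_zero_left hm0]; abel
    rw [dist_zero_right, norm_norm, he]
    refine (norm_sub_le _ _).trans_lt ?_
    have : η = η / (1 + 2 * M) + M * (2 * (η / (1 + 2 * M))) := by field_simp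
    linarith
  set c : ℝ := ‖(J.symm : E →L[ℝ] E)‖ with hc
  have hc0 : 0 ≤ c := norm_nonneg _
  -- The first bound lets half of `‖h - T‖` be absorbed on the left; the second gives the final `ε`
  -- after the resulting doubling. The witness uses `c + 1` because `c` may be zero.
  obtain ⟨η, hη, hη1, hη2⟩ : ∃ η > 0, c * η ≤ 1 / 2 ∧ 2 * c * η ≤ ε := by
    refine ⟨min (1 / (2 * (c + 1))) (ε / (2 * (c + 1))), by positivity, ?_, ?_⟩
    · calc c * _ ≤ (c + 1) * (1 / (2 * (c + 1))) := by
            gcongr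
            · linarith
            · exact min_le_left _ _
        _ = 1 / 2 := by field_simp
    · calc 2 * c * _ ≤ 2 * (c + 1) * (ε / (2 * (c + 1))) := by
            gcongr
            · linarith
            · exact min_le_right _ _
        _ = ε := by field_simp
  have hη' : 0 < η / (1 + 2 * M) := by positivity
  obtain ⟨δ₁, hδ₁, h1⟩ := hsl _ hη'
  obtain ⟨δ₂, hδ₂, h2⟩ := hSl _ hη'
  filter_upwards [hθ, hBM, Metric.tendsto_nhds.1 hcons _ hδ₁, Metric.tendsto_nhds.1 hcons _ hδ₂,
    hn.eventually h1, hn.eventually h2, hN.eventually h2,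
    Metric.tendsto_nhds.1 hB _ hη] with m hm hBm hd1 hd2 e1 e2 e3 hBη
  have e1 := e1 _ hd1
  have e2 := e2 _ hd2
  have e3 := e3 _ hd2
  obtain ⟨-, hm0⟩ := hm
  rw [dist_eq_norm] at hBη
  set h := θ m - θ₀ with hh
  set D := S (N m) θ₀ - S (n m) θ₀ with hD
  set T := -J.symm (s (n m) θ₀ + B₀ D) with hT
  -- All linearisation errors together. The two terms `J' h` cancel, so `R` differs from the plain
  -- increments only by `J h`.
  set R := (s (n m) (θ m) - s (n m) θ₀ - J h) + B m ((S (N m) (θ m) - S (N m) θ₀ - J' h) -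
    (S (n m) (θ m) - S (n m) θ₀ - J' h)) with hR
  have hRb : ‖R‖ ≤ η * ‖h‖ := by
    have hb : ‖B m ((S (N m) (θ m) - S (N m) θ₀ - J' h) -
        (S (n m) (θ m) - S (n m) θ₀ - J' h))‖ ≤ M * (2 * (η / (1 + 2 * M) * ‖h‖)) := by
      refine (ContinuousLinearMap.le_opNorm _ _).trans ?_
      gcongr
      exact (norm_sub_le _ _).trans (by linarith)
    refine (norm_add_le _ _).trans ?_
    have : η * ‖h‖ = η / (1 + 2 * M) * ‖h‖ + M * (2 * (η / (1 + 2 * M) * ‖h‖)) := by field_simp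
    linarith
  have hJ : J (h - T) = -((B m - B₀) D + R) := by
    rw [map_sub, hT, map_neg, ContinuousLinearEquiv.apply_symm_apply, hR, hD, _root_.sub_apply]
    simp only [map_sub, sub_neg_eq_add] at hm0 ⊢
    have := eq_neg_of_add_eq_zero_left hm0
    rw [this]
    abel
  have hh' : h - T = J.symm (-((B m - B₀) D + R)) := by
    rw [← hJ, ContinuousLinearEquiv.symm_apply_apply]
  have hb1 : ‖h - T‖ ≤ c * (η * ‖D‖ + η * ‖h‖) := by
    rw [hh']
    refine ((J.symm : E →L[ℝ] E).le_opNorm _).trans ?_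
    rw [norm_neg]
    gcongr
    refine (norm_add_le _ _).trans (add_le_add ?_ hRb)
    exact (ContinuousLinearMap.le_opNorm _ _).trans (by gcongr)
  have hb2 : ‖h‖ ≤ ‖T‖ + ‖h - T‖ := by
    have := norm_add_le T (h - T)
    rwa [add_sub_cancel] at this
  have hb3 : ‖h - T‖ ≤ c * η * ‖D‖ + c * η * ‖T‖ + 1 / 2 * ‖h - T‖ := by
    calc ‖h - T‖ ≤ c * (η * ‖D‖ + η * (‖T‖ + ‖h - T‖)) := hb1.trans (by gcongr)
      _ = c * η * ‖D‖ + c * η * ‖T‖ + c * η * ‖h - T‖ := by ring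
      _ ≤ _ := by gcongr
  calc ‖h - T‖ ≤ 2 * c * η * (‖T‖ + ‖D‖) := by linarith
    _ ≤ _ := by gcongr

end ZEstimation

/-! ### Calculus of convergence in probability. -/

section InProbability

variable {Ω : Type*} [MeasurableSpace Ω] {P : Measure Ω}

/-- A sequence tending to zero in measure, times a sequence bounded in `L¹`. -/
lemma tendstoInMeasure_mul_of_lintegral_le {X Y : ℕ → Ω → ℝ}
    (hX : TendstoInMeasure P X atTop fun _ => 0) (hY : ∀ m, AEMeasurable (Y m) P) {C : ℝ≥0∞}
    (hC : C ≠ ∞) (hYC : ∀ᶠ m in atTop, ∫⁻ ω, ‖Y m ω‖ₑ ∂P ≤ C) :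
    TendstoInMeasure P (fun m ω => X m ω * Y m ω) atTop fun _ => 0 := by
  rw [tendstoInMeasure_iff_norm] at hX ⊢
  intro ε hε
  simp only [sub_zero] at hX ⊢
  rw [ENNReal.tendsto_nhds_zero]
  intro η hη
  -- By Markov's inequality `Y` exceeds `M` with probability at most `C / M`; below `M`, the product
  -- is small as soon as `X` is below `ε / M`.
  obtain ⟨M, hM, hMη⟩ : ∃ M : ℝ, 0 < M ∧ C / ENNReal.ofReal M ≤ η / 2 := by
    have hlim : Tendsto (fun M : ℝ => C / ENNReal.ofReal M) atTop (𝓝 0) := by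
      have := ENNReal.Tendsto.div (tendsto_const_nhds (x := C))
        (Or.inr ENNReal.top_ne_zero) ENNReal.tendsto_ofReal_atTop (Or.inr hC)
      simpa using this
    exact ((eventually_gt_atTop 0).and
      (hlim.eventually_le_const (ENNReal.half_pos hη.ne'))).exists
  have h1 := ENNReal.tendsto_nhds_zero.1 (hX (ε / M) (by positivity)) _ (ENNReal.half_pos hη.ne')
  filter_upwards [h1, hYC] with m hm hYm
  have hsub : {ω | ε ≤ ‖X m ω * Y m ω‖} ⊆
      {ω | ε / M ≤ ‖X m ω‖} ∪ {ω | ENNReal.ofReal M ≤ ‖Y m ω‖ₑ} := by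
    intro ω hω
    by_contra hcon
    simp only [Set.mem_union, Set.mem_ofPred_eq, not_or, not_le, ← ofReal_norm] at hcon hω
    obtain ⟨c1, c2⟩ := hcon
    rw [ENNReal.ofReal_lt_ofReal_iff hM] at c2
    rw [norm_mul] at hω
    have : ‖X m ω‖ * ‖Y m ω‖ < ε / M * M :=
      mul_lt_mul'' c1 c2 (norm_nonneg _) (norm_nonneg _)
    rw [div_mul_cancel₀ _ hM.ne'] at this
    linarith
  have hmk : P {ω | ENNReal.ofReal M ≤ ‖Y m ω‖ₑ} ≤ C / ENNReal.ofReal M :=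
    (meas_ge_le_lintegral_div (hY m).enorm (ENNReal.ofReal_pos.2 hM).ne'
      ENNReal.ofReal_ne_top).trans (by gcongr)
  calc P {ω | ε ≤ ‖X m ω * Y m ω‖} ≤ _ := measure_mono hsub
    _ ≤ _ := measure_union_le _ _
    _ ≤ η / 2 + η / 2 := add_le_add hm (hmk.trans hMη)
    _ = η := ENNReal.add_halves η

lemma TendstoInMeasure.add_of_norm {E : Type*} [NormedAddCommGroup E] {X Y : ℕ → Ω → E}
    (hX : TendstoInMeasure P X atTop fun _ => 0) (hY : TendstoInMeasure P Y atTop fun _ => 0) :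
    TendstoInMeasure P (fun m ω => X m ω + Y m ω) atTop fun _ => 0 := by
  rw [tendstoInMeasure_iff_norm] at hX hY ⊢
  intro ε hε
  have h := (hX (ε / 2) (by positivity)).add (hY (ε / 2) (by positivity))
  rw [add_zero] at h
  refine tendsto_of_tendsto_of_tendsto_of_le_of_le tendsto_const_nhds h (fun _ => zero_le)
    fun m => (measure_mono fun ω hω => ?_).trans (measure_union_le _ _)
  simp only [sub_zero, Set.mem_ofPred_eq, Set.mem_union] at hω ⊢
  by_contra hcon
  push Not at hcon
  linarith [norm_add_le (X m ω) (Y m ω)]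

end InProbability

/-! ### Second-order expansion of characteristic functions. -/

section CentralLimit

/-- The third-order error for `|x| ≤ 1` is merged with the trivial quadratic bound for `|x| > 1`.
The factor `min 1 |x|` keeps the error integrable under second moments alone, yet negligible against
`x²` for small `x`. -/
lemma norm_cexp_taylor_two_le (x : ℝ) :
    ‖Complex.exp (x * Complex.I) - (1 + x * Complex.I - (x : ℂ) ^ 2 / 2)‖ ≤
      4 * x ^ 2 * min 1 |x| := by
  have hn : ‖(x : ℂ) * Complex.I‖ = |x| := by simp
  have hsq : x ^ 2 = |x| ^ 2 := (sq_abs x).symm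
  rcases le_or_gt |x| 1 with hx | hx
  · have h := Complex.exp_bound (x := x * Complex.I) (by rw [hn]; exact hx) (n := 3) (by norm_num)
    have he : ∑ m ∈ Finset.range 3, ((x : ℂ) * Complex.I) ^ m / (m.factorial : ℂ) =
        1 + x * Complex.I - (x : ℂ) ^ 2 / 2 := by
      simp only [Finset.sum_range_succ, Finset.sum_range_zero, Nat.factorial, mul_pow,
        Complex.I_sq]
      push_cast
      ring
    rw [he, hn] at h
    refine h.trans ?_
    rw [min_eq_right hx, hsq]
    norm_num [Nat.factorial]
    nlinarith [pow_nonneg (abs_nonneg x) 3]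
  · rw [min_eq_left hx.le, hsq]
    have h1 : ‖Complex.exp (x * Complex.I)‖ = 1 := Complex.norm_exp_ofReal_mul_I x
    have h2 : ‖1 + x * Complex.I - (x : ℂ) ^ 2 / 2‖ ≤ 1 + |x| + |x| ^ 2 / 2 := by
      refine (norm_sub_le _ _).trans (add_le_add ((norm_add_le _ _).trans ?_) ?_)
      · rw [hn]; simp
      · simp
    refine (norm_sub_le _ _).trans ?_
    rw [h1]
    nlinarith

lemma abs_exp_neg_sub_le {x : ℝ} (hx : 0 ≤ x) : |Real.exp (-x) - (1 - x)| ≤ x ^ 2 := by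
  rcases le_or_gt x 1 with h | h
  · have := Real.norm_exp_sub_one_sub_id_le (x := -x) (by simpa [abs_of_nonneg hx] using h)
    rw [Real.norm_eq_abs, norm_neg, Real.norm_of_nonneg hx] at this
    convert this using 2
    ring
  · have h1 : Real.exp (-x) ≤ 1 := Real.exp_le_one_iff.2 (by linarith)
    have h2 := Real.exp_pos (-x)
    rw [abs_le]
    constructor <;> nlinarith

/-- Factors are exchanged one at a time; all the others have modulus at most one. -/
lemma norm_prod_sub_prod_le {ι : Type*} (t : Finset ι) {a b : ι → ℂ} (ha : ∀ i ∈ t, ‖a i‖ ≤ 1)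
    (hb : ∀ i ∈ t, ‖b i‖ ≤ 1) : ‖∏ i ∈ t, a i - ∏ i ∈ t, b i‖ ≤ ∑ i ∈ t, ‖a i - b i‖ := by
  classical
  induction t using Finset.induction_on with
  | empty => simp
  | insert j t hj ih =>
    rw [Finset.prod_insert hj, Finset.prod_insert hj, Finset.sum_insert hj]
    have ha' : ‖∏ i ∈ t, a i‖ ≤ 1 := by
      rw [norm_prod]
      exact Finset.prod_le_one (fun _ _ => norm_nonneg _)
        fun i hi => ha i (Finset.mem_insert_of_mem hi)
    have ih' := ih (fun i hi => ha i (Finset.mem_insert_of_mem hi))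
      (fun i hi => hb i (Finset.mem_insert_of_mem hi))
    have hbj := hb j (Finset.mem_insert_self j t)
    calc ‖a j * ∏ i ∈ t, a i - b j * ∏ i ∈ t, b i‖
        = ‖(a j - b j) * ∏ i ∈ t, a i + b j * (∏ i ∈ t, a i - ∏ i ∈ t, b i)‖ := by
          congr 1; ring
      _ ≤ ‖a j - b j‖ * 1 + 1 * ‖∏ i ∈ t, a i - ∏ i ∈ t, b i‖ := by
          refine (norm_add_le _ _).trans ?_
          rw [norm_mul, norm_mul]
          gcongr
      _ ≤ _ := by linarith

variable {D : Type*} [MeasurableSpace D] {μ : Measure D}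

/-- The truncated second moment that controls the second-order expansion of characteristic
functions. -/
noncomputable def truncatedMoment (μ : Measure D) (G : D → ℝ) (c : ℝ) : ℝ :=
  ∫ d, G d ^ 2 * min 1 (c * G d) ∂μ

lemma integrable_truncated {G : D → ℝ} (hG : MemLp G 2 μ) (hG0 : ∀ d, 0 ≤ G d) {c : ℝ}
    (hc : 0 ≤ c) : Integrable (fun d => G d ^ 2 * min 1 (c * G d)) μ := by
  have hm := hG.aestronglyMeasurable
  refine hG.integrable_sq.mono ?_ (ae_of_all _ fun d => ?_)
  · exact (hm.pow 2).mul (aestronglyMeasurable_const.inf (hm.const_mul c))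
  · have h1 : 0 ≤ min 1 (c * G d) := le_min zero_le_one (mul_nonneg hc (hG0 d))
    rw [norm_mul, Real.norm_of_nonneg h1]
    exact mul_le_of_le_one_right (norm_nonneg _) (min_le_left _ _)

/-- Plays the part of the Lindeberg condition: the integrand is dominated by `G²` and vanishes
pointwise as the scale `c` does. -/
lemma tendsto_truncatedMoment {G : D → ℝ} (hG : MemLp G 2 μ) (hG0 : ∀ d, 0 ≤ G d)
    {c : ℕ → ℝ} (hc : ∀ m, 0 ≤ c m) (hlim : Tendsto c atTop (𝓝 0)) :
    Tendsto (fun m => truncatedMoment μ G (c m)) atTop (𝓝 0) := by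
  have hm := hG.aestronglyMeasurable
  have := tendsto_integral_of_dominated_convergence (μ := μ)
    (F := fun m d => G d ^ 2 * min 1 (c m * G d)) (f := fun _ => 0) (fun d => G d ^ 2)
    (fun m => (hm.pow 2).mul (aestronglyMeasurable_const.inf (hm.const_mul _)))
    hG.integrable_sq (fun m => ae_of_all _ fun d => ?_) (ae_of_all _ fun d => ?_)
  · unfold truncatedMoment
    simpa using this
  · have h1 : 0 ≤ min 1 (c m * G d) := le_min zero_le_one (mul_nonneg (hc m) (hG0 d))
    rw [norm_mul, Real.norm_of_nonneg h1, Real.norm_of_nonneg (sq_nonneg _)]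
    exact mul_le_of_le_one_right (sq_nonneg _) (min_le_left _ _)
  · have h1 : Tendsto (fun m => min 1 (c m * G d)) atTop (𝓝 (min 1 (0 * G d))) :=
      tendsto_const_nhds.min (hlim.mul_const _)
    have := h1.const_mul (G d ^ 2)
    simpa using this

variable [IsProbabilityMeasure μ]

/-- Quantitative second-order expansion of the characteristic function of a centred variable. -/
lemma norm_integral_cexp_sub_exp_le {L G : D → ℝ} (hL : Measurable L) (hG : MemLp G 2 μ)
    (hG0 : ∀ d, 0 ≤ G d) {c : ℝ} (hc : 0 ≤ c) (hLG : ∀ d, |L d| ≤ c * G d)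
    (hL0 : ∫ d, L d ∂μ = 0) :
    ‖∫ d, Complex.exp (L d * Complex.I) ∂μ - (Real.exp (-((∫ d, L d ^ 2 ∂μ) / 2)) : ℂ)‖ ≤
      c ^ 2 * (4 * truncatedMoment μ G c + c ^ 2 * (∫ d, G d ^ 2 ∂μ) ^ 2) := by
  have hL2 : MemLp L 2 μ := by
    refine (hG.const_mul c).mono hL.aestronglyMeasurable (ae_of_all _ fun d => ?_)
    rw [Real.norm_eq_abs, Real.norm_of_nonneg (mul_nonneg hc (hG0 d))]
    exact hLG d
  have hLi : Integrable L μ := hL2.integrable one_le_two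
  have hLsq : Integrable (fun d => L d ^ 2) μ := hL2.integrable_sq
  have hGsq : Integrable (fun d => G d ^ 2) μ := hG.integrable_sq
  set σ := ∫ d, L d ^ 2 ∂μ with hσ
  have hσ0 : 0 ≤ σ := integral_nonneg fun d => sq_nonneg _
  have hσG : σ ≤ c ^ 2 * ∫ d, G d ^ 2 ∂μ := by
    rw [hσ, ← integral_const_mul]
    refine integral_mono hLsq (hGsq.const_mul _) fun d => ?_
    simp only [← mul_pow]
    rw [← sq_abs]
    exact pow_le_pow_left₀ (abs_nonneg _) (hLG d) 2
  have hexp : Integrable (fun d => Complex.exp (L d * Complex.I)) μ := by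
    refine Integrable.of_bound (C := 1) (by fun_prop) (ae_of_all _ fun d => ?_)
    rw [Complex.norm_exp_ofReal_mul_I]
  have hquad : Integrable (fun d => 1 + L d * Complex.I - (L d : ℂ) ^ 2 / 2) μ := by
    refine ((integrable_const _).add (hLi.ofReal.mul_const _)).sub (Integrable.div_const ?_ _)
    simpa using hLsq.ofReal (𝕜 := ℂ)
  have hquadi : ∫ d, (1 + L d * Complex.I - (L d : ℂ) ^ 2 / 2) ∂μ = ((1 - σ / 2 : ℝ) : ℂ) := by
    have e1 : ∫ d, (L d : ℂ) * Complex.I ∂μ = 0 := by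
      rw [integral_mul_const, integral_complex_ofReal, hL0]; simp
    have e2 : ∫ d, (L d : ℂ) ^ 2 / 2 ∂μ = (σ : ℂ) / 2 := by
      rw [integral_div, hσ, ← integral_complex_ofReal]; simp
    have i1 : Integrable (fun d => (1 : ℂ) + L d * Complex.I) μ :=
      (integrable_const _).add (hLi.ofReal.mul_const _)
    have i2 : Integrable (fun d => (L d : ℂ) ^ 2 / 2) μ := by
      refine Integrable.div_const ?_ _
      simpa using hLsq.ofReal (𝕜 := ℂ)
    rw [integral_sub i1 i2, integral_add (integrable_const _) (hLi.ofReal.mul_const _), e1, e2]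
    simp
  -- Both the characteristic function and the Gaussian factor are compared with `1 - σ/2`. The
  -- bounds involve `L` only through `c` and `G`, so one envelope serves units with different
  -- weights.
  have hfirst : ‖∫ d, Complex.exp (L d * Complex.I) ∂μ - ((1 - σ / 2 : ℝ) : ℂ)‖ ≤
      c ^ 2 * (4 * truncatedMoment μ G c) := by
    rw [← hquadi, ← integral_sub hexp hquad, truncatedMoment, ← integral_const_mul,
      ← integral_const_mul]
    refine norm_integral_le_of_norm_le
      (((integrable_truncated hG hG0 hc).const_mul 4).const_mul (c ^ 2))
      (ae_of_all _ fun d => (norm_cexp_taylor_two_le (L d)).trans ?_)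
    have h1 : L d ^ 2 ≤ c ^ 2 * G d ^ 2 := by
      rw [← sq_abs, ← mul_pow]
      exact pow_le_pow_left₀ (abs_nonneg _) (hLG d) 2
    have h2 : min 1 |L d| ≤ min 1 (c * G d) := min_le_min_left _ (hLG d)
    have h3 : 0 ≤ min 1 |L d| := le_min zero_le_one (abs_nonneg _)
    calc 4 * L d ^ 2 * min 1 |L d| ≤ 4 * (c ^ 2 * G d ^ 2) * min 1 (c * G d) := by gcongr
      _ = _ := by ring
  have hsecond : ‖((1 - σ / 2 : ℝ) : ℂ) - (Real.exp (-(σ / 2)) : ℂ)‖ ≤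
      c ^ 2 * (c ^ 2 * (∫ d, G d ^ 2 ∂μ) ^ 2) := by
    rw [← Complex.ofReal_sub, Complex.norm_real, norm_sub_rev, Real.norm_eq_abs]
    refine (abs_exp_neg_sub_le (by positivity)).trans ?_
    have : (σ / 2) ^ 2 ≤ (c ^ 2 * ∫ d, G d ^ 2 ∂μ) ^ 2 := by gcongr; linarith
    exact this.trans (le_of_eq (by ring))
  calc _ ≤ _ := norm_sub_le_norm_sub_add_norm_sub _ ((1 - σ / 2 : ℝ) : ℂ) _
    _ ≤ _ := (add_le_add hfirst hsecond).trans (le_of_eq (by ring))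

end CentralLimit

/-! ### The statistic `n⁻¹ ∑_{i<n} h₁ + N⁻¹ ∑_{i<N} h₂`: moments and characteristic function. -/

section LinearStatistic

variable {D Ω : Type*} [MeasurableSpace D] [MeasurableSpace Ω] {μ : Measure D} {P : Measure Ω}
  {Z : ℕ → Ω → D} {p : ℕ}

lemma integral_comp_of_hasLaw (hlaw : ∀ i, HasLaw (Z i) μ P) {F : Type*} [NormedAddCommGroup F]
    [NormedSpace ℝ F] {f : D → F} (hf : AEStronglyMeasurable f μ) (i : ℕ) :
    ∫ ω, f (Z i ω) ∂P = ∫ d, f d ∂μ := by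
  have h := hlaw i
  rw [← h.map_eq, integral_map h.aemeasurable (by rwa [h.map_eq])]

lemma memLp_comp_of_hasLaw (hlaw : ∀ i, HasLaw (Z i) μ P) {F : Type*} [NormedAddCommGroup F]
    {f : D → F} {q : ℝ≥0∞} (hf : MemLp f q μ) (i : ℕ) : MemLp (fun ω => f (Z i ω)) q P := by
  have h := hlaw i
  exact (show MemLp f q (P.map (Z i)) by rwa [h.map_eq]).comp_of_map h.aemeasurable

/-- Sums of independent centred variables are uncorrelated across units. -/
lemma integral_sum_mul_sum (hlaw : ∀ i, HasLaw (Z i) μ P) (hindep : iIndepFun Z P)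
    {a b : ℕ → D → ℝ} (ham : ∀ k, Measurable (a k)) (hbm : ∀ k, Measurable (b k))
    (ha : ∀ k, MemLp (a k) 2 μ) (hb : ∀ k, MemLp (b k) 2 μ)
    (ha0 : ∀ k, ∫ d, a k d ∂μ = 0) (M : ℕ) :
    ∫ ω, (∑ k ∈ Finset.range M, a k (Z k ω)) * (∑ k ∈ Finset.range M, b k (Z k ω)) ∂P =
      ∑ k ∈ Finset.range M, ∫ d, a k d * b k d ∂μ := by
  have hint : ∀ k l, Integrable (fun ω => a k (Z k ω) * b l (Z l ω)) P := fun k l =>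
    (memLp_comp_of_hasLaw hlaw (ha k) k).integrable_mul (memLp_comp_of_hasLaw hlaw (hb l) l)
  simp_rw [Finset.sum_mul_sum]
  rw [integral_finsetSum _ fun k _ => integrable_finsetSum _ fun l _ => hint k l]
  refine Finset.sum_congr rfl fun k hk => ?_
  rw [integral_finsetSum _ fun l _ => hint k l, Finset.sum_eq_single k]
  · exact integral_comp_of_hasLaw hlaw (f := fun d => a k d * b k d)
      ((ham k).mul (hbm k)).aestronglyMeasurable k
  · intro l _ hl
    have hind : IndepFun (fun ω => a k (Z k ω)) (fun ω => b l (Z l ω)) P :=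
      (hindep.indepFun hl.symm).comp (ham k) (hbm l)
    rw [hind.integral_fun_mul_eq_mul_integral
      (memLp_comp_of_hasLaw hlaw (ha k) k).aestronglyMeasurable
      (memLp_comp_of_hasLaw hlaw (hb l) l).aestronglyMeasurable,
      integral_comp_of_hasLaw hlaw (ham k).aestronglyMeasurable, ha0, zero_mul]
  · intro h; exact absurd hk h

/-- The contribution of unit `k` to `n⁻¹ ∑_{i < n} h₁(zᵢ) + N⁻¹ ∑_{i < N} h₂(zᵢ)`. -/
noncomputable def unitTerm {D E : Type*} [AddCommGroup E] [Module ℝ E] (n N : ℕ) (h₁ h₂ : D → E)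
    (k : ℕ) : D → E :=
  (if k < n then (n : ℝ)⁻¹ else 0) • h₁ + (N : ℝ)⁻¹ • h₂

lemma unitTerm_apply {D E : Type*} [AddCommGroup E] [Module ℝ E] (n N : ℕ) (h₁ h₂ : D → E)
    (k : ℕ) (d : D) : unitTerm n N h₁ h₂ k d =
      (if k < n then (n : ℝ)⁻¹ else 0) • h₁ d + (N : ℝ)⁻¹ • h₂ d :=
  rfl

lemma sampleMean_add_sampleMean {D E : Type*} [AddCommGroup E] [Module ℝ E] {n N : ℕ}
    (hnN : n ≤ N) (h₁ h₂ : D → E) (z : ℕ → D) :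
    sampleMean z n h₁ + sampleMean z N h₂ =
      ∑ k ∈ Finset.range N, unitTerm n N h₁ h₂ k (z k) := by
  unfold sampleMean
  simp_rw [unitTerm_apply]
  rw [Finset.sum_add_distrib, ← Finset.smul_sum, Finset.smul_sum]
  congr 1
  simp_rw [ite_smul, zero_smul]
  rw [← Finset.sum_filter]
  congr 1
  ext k
  simp only [Finset.mem_range, Finset.mem_filter]
  omega

lemma sum_range_ite_lt {n N : ℕ} (hnN : n ≤ N) (c : ℝ) :
    ∑ k ∈ Finset.range N, (if k < n then c else 0) = n * c := by
  rw [← Finset.sum_filter, Finset.sum_const, nsmul_eq_mul]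
  congr 2
  rw [show (Finset.range N).filter (· < n) = Finset.range n by
    ext k; simp only [Finset.mem_range, Finset.mem_filter]; omega, Finset.card_range]

/-- The moment matrix of `√n (n⁻¹ ∑_{i < n} h₁ + N⁻¹ ∑_{i < N} h₂)`, with `r = n / N`. -/
noncomputable def mixedMoment (μ : Measure D) (h₁ h₂ : D → Par p) (r : ℝ) :
    Matrix (Fin p) (Fin p) ℝ :=
  crossMoment μ (fun d i => h₁ d i) (fun d i => h₁ d i) +
    r • (crossMoment μ (fun d i => h₁ d i) (fun d i => h₂ d i) +
      crossMoment μ (fun d i => h₂ d i) (fun d i => h₁ d i) +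
      crossMoment μ (fun d i => h₂ d i) (fun d i => h₂ d i))

lemma memLp_coord {h : D → Par p} (hh : MemLp h 2 μ) (i : Fin p) :
    MemLp (fun d => h d i) 2 μ := by
  refine hh.mono ?_ (ae_of_all _ fun d => PiLp.norm_apply_le (h d) i)
  exact (EuclideanSpace.proj i : Par p →L[ℝ] ℝ).continuous.comp_aestronglyMeasurable
    hh.aestronglyMeasurable

lemma measurable_coord {h : D → Par p} (hh : Measurable h) (i : Fin p) :
    Measurable (fun d => h d i) :=
  (EuclideanSpace.proj i : Par p →L[ℝ] ℝ).continuous.measurable.comp hh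

lemma integral_coord {h : D → Par p} (hh : Integrable h μ) (i : Fin p) :
    ∫ d, h d i ∂μ = (∫ d, h d ∂μ) i :=
  (EuclideanSpace.proj i : Par p →L[ℝ] ℝ).integral_comp_comm hh

variable {h₁ h₂ : D → Par p}

lemma measurable_unitTerm (hm₁ : Measurable h₁) (hm₂ : Measurable h₂) (n N k : ℕ) :
    Measurable (unitTerm n N h₁ h₂ k) := by
  unfold unitTerm
  exact (hm₁.const_smul _).add (hm₂.const_smul _)

lemma memLp_unitTerm (hL₁ : MemLp h₁ 2 μ) (hL₂ : MemLp h₂ 2 μ) (n N k : ℕ) :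
    MemLp (unitTerm n N h₁ h₂ k) 2 μ := by
  unfold unitTerm
  exact (hL₁.const_smul _).add (hL₂.const_smul _)

lemma memLp_sampleMean (hlaw : ∀ i, HasLaw (Z i) μ P) {h : D → Par p} (hL : MemLp h 2 μ)
    (n : ℕ) : MemLp (fun ω => sampleMean (fun i => Z i ω) n h) 2 P := by
  unfold sampleMean
  exact (memLp_finsetSum _ fun i _ => memLp_comp_of_hasLaw hlaw hL i).const_smul (n : ℝ)⁻¹

lemma integral_sampleMean_eq_zero (hlaw : ∀ i, HasLaw (Z i) μ P) {h : D → Par p}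
    (hL : Integrable h μ) (h0 : ∫ d, h d ∂μ = 0) (n : ℕ) :
    ∫ ω, sampleMean (fun i => Z i ω) n h ∂P = 0 := by
  unfold sampleMean
  rw [integral_smul, integral_finsetSum]
  · rw [Finset.sum_eq_zero, smul_zero]
    intro i _
    rw [integral_comp_of_hasLaw hlaw hL.aestronglyMeasurable, h0]
  · intro i _
    exact memLp_one_iff_integrable.1
      (memLp_comp_of_hasLaw hlaw (memLp_one_iff_integrable.2 hL) i)

lemma integral_unitTerm [IsProbabilityMeasure μ] (hL₁ : MemLp h₁ 2 μ) (hL₂ : MemLp h₂ 2 μ) (h0₁ : ∫ d, h₁ d ∂μ = 0)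
    (h0₂ : ∫ d, h₂ d ∂μ = 0) (n N k : ℕ) : ∫ d, unitTerm n N h₁ h₂ k d ∂μ = 0 := by
  have i₁ := hL₁.integrable one_le_two
  have i₂ := hL₂.integrable one_le_two
  unfold unitTerm
  generalize (if k < n then (n : ℝ)⁻¹ else 0) = c
  rw [integral_add' (i₁.smul _) (i₂.smul _)]
  simp [integral_smul, h0₁, h0₂]

lemma integral_unitTerm_mul (hL₁ : MemLp h₁ 2 μ) (hL₂ : MemLp h₂ 2 μ) (n N k : ℕ) (i j : Fin p) :
    ∫ d, unitTerm n N h₁ h₂ k d i * unitTerm n N h₁ h₂ k d j ∂μ =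
      (if k < n then (n : ℝ)⁻¹ else 0) ^ 2 * crossMoment μ (fun d i => h₁ d i) (fun d i => h₁ d i) i j
      + ((if k < n then (n : ℝ)⁻¹ else 0) * (N : ℝ)⁻¹) *
        (crossMoment μ (fun d i => h₁ d i) (fun d i => h₂ d i) i j +
          crossMoment μ (fun d i => h₂ d i) (fun d i => h₁ d i) i j)
      + (N : ℝ)⁻¹ ^ 2 * crossMoment μ (fun d i => h₂ d i) (fun d i => h₂ d i) i j := by
  set c := (if k < n then (n : ℝ)⁻¹ else 0)
  have i11 : Integrable (fun d => h₁ d i * h₁ d j) μ :=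
    (memLp_coord hL₁ i).integrable_mul (memLp_coord hL₁ j)
  have i12 : Integrable (fun d => h₁ d i * h₂ d j) μ :=
    (memLp_coord hL₁ i).integrable_mul (memLp_coord hL₂ j)
  have i21 : Integrable (fun d => h₂ d i * h₁ d j) μ :=
    (memLp_coord hL₂ i).integrable_mul (memLp_coord hL₁ j)
  have i22 : Integrable (fun d => h₂ d i * h₂ d j) μ :=
    (memLp_coord hL₂ i).integrable_mul (memLp_coord hL₂ j)
  have he : ∀ d, unitTerm n N h₁ h₂ k d i * unitTerm n N h₁ h₂ k d j =
      c ^ 2 * (h₁ d i * h₁ d j) + (c * (N : ℝ)⁻¹) * (h₁ d i * h₂ d j + h₂ d i * h₁ d j) +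
        (N : ℝ)⁻¹ ^ 2 * (h₂ d i * h₂ d j) := fun d => by
    simp only [unitTerm_apply, PiLp.add_apply, PiLp.smul_apply, smul_eq_mul]
    ring
  simp_rw [he]
  rw [integral_add, integral_add, integral_const_mul, integral_const_mul, integral_const_mul,
    integral_add i12 i21]
  · rfl
  · exact i11.const_mul _
  · exact (i12.add i21).const_mul _
  · exact (i11.const_mul _).add ((i12.add i21).const_mul _)
  · exact i22.const_mul _

/-- The squared weights of `h₁` sum to `n · n⁻² = n⁻¹`, the mixed weights to `n · n⁻¹N⁻¹ = N⁻¹`, and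
those of `h₂` to `N · N⁻² = N⁻¹`. Factoring out `n⁻¹` leaves `r = n/N` on all terms that involve
`h₂`. -/
lemma sum_integral_unitTerm_mul (hL₁ : MemLp h₁ 2 μ) (hL₂ : MemLp h₂ 2 μ) {n N : ℕ}
    (hn : 0 < n) (hnN : n ≤ N) (i j : Fin p) :
    ∑ k ∈ Finset.range N, ∫ d, unitTerm n N h₁ h₂ k d i * unitTerm n N h₁ h₂ k d j ∂μ =
      (n : ℝ)⁻¹ * mixedMoment μ h₁ h₂ (n / N) i j := by
  have hN0 : (N : ℝ) ≠ 0 := by exact_mod_cast (hn.trans_le hnN).ne'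
  have hn0 : (n : ℝ) ≠ 0 := by exact_mod_cast hn.ne'
  simp_rw [integral_unitTerm_mul hL₁ hL₂]
  rw [Finset.sum_add_distrib, Finset.sum_add_distrib, ← Finset.sum_mul, ← Finset.sum_mul,
    Finset.sum_const, Finset.card_range, ← Finset.sum_mul,
    sum_range_ite_lt hnN]
  have : ∀ k, (if k < n then (n : ℝ)⁻¹ else 0) ^ 2 = if k < n then ((n : ℝ)⁻¹) ^ 2 else 0 := by
    intro k; split_ifs <;> simp
  simp_rw [this]
  rw [sum_range_ite_lt hnN]
  simp only [mixedMoment, Matrix.add_apply, Matrix.smul_apply, smul_eq_mul, nsmul_eq_mul]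
  field_simp
  ring

variable [IsProbabilityMeasure μ]

/-- The second moment matrix of `n⁻¹ ∑_{i < n} h₁ + N⁻¹ ∑_{i < N} h₂`. -/
lemma crossMoment_linearStatistic (hlaw : ∀ i, HasLaw (Z i) μ P) (hindep : iIndepFun Z P)
    (hm₁ : Measurable h₁) (hm₂ : Measurable h₂) (hL₁ : MemLp h₁ 2 μ) (hL₂ : MemLp h₂ 2 μ)
    (h0₁ : ∫ d, h₁ d ∂μ = 0) (h0₂ : ∫ d, h₂ d ∂μ = 0) {n N : ℕ} (hn : 0 < n) (hnN : n ≤ N) :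
    crossMoment P
      (fun ω i => (sampleMean (fun i => Z i ω) n h₁ + sampleMean (fun i => Z i ω) N h₂) i)
      (fun ω i => (sampleMean (fun i => Z i ω) n h₁ + sampleMean (fun i => Z i ω) N h₂) i) =
      (n : ℝ)⁻¹ • mixedMoment μ h₁ h₂ (n / N) := by
  ext i j
  simp_rw [sampleMean_add_sampleMean hnN]
  simp only [crossMoment, Matrix.of_apply, WithLp.ofLp_sum, Finset.sum_apply, Matrix.smul_apply,
    smul_eq_mul]
  rw [← sum_integral_unitTerm_mul hL₁ hL₂ hn hnN]
  refine integral_sum_mul_sum hlaw hindep (a := fun k d => unitTerm n N h₁ h₂ k d i)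
    (b := fun k d => unitTerm n N h₁ h₂ k d j)
    (fun k => measurable_coord (measurable_unitTerm hm₁ hm₂ n N k) i)
    (fun k => measurable_coord (measurable_unitTerm hm₁ hm₂ n N k) j)
    (fun k => memLp_coord (memLp_unitTerm hL₁ hL₂ n N k) i)
    (fun k => memLp_coord (memLp_unitTerm hL₁ hL₂ n N k) j) (fun k => ?_) N
  rw [integral_coord ((memLp_unitTerm hL₁ hL₂ n N k).integrable one_le_two),
    integral_unitTerm hL₁ hL₂ h0₁ h0₂]
  rfl

variable [IsProbabilityMeasure P]

/-- The characteristic function of `√n (n⁻¹ ∑_{i < n} h₁ + N⁻¹ ∑_{i < N} h₂)` merges with that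
of the centred normal law with the same second moments. -/
lemma tendsto_charFun_linearStatistic_sub (hlaw : ∀ i, HasLaw (Z i) μ P)
    (hindep : iIndepFun Z P)
    (hm₁ : Measurable h₁) (hm₂ : Measurable h₂) (hL₁ : MemLp h₁ 2 μ) (hL₂ : MemLp h₂ 2 μ)
    (h0₁ : ∫ d, h₁ d ∂μ = 0) (h0₂ : ∫ d, h₂ d ∂μ = 0) {n N : ℕ → ℕ}
    (hn : Tendsto n atTop atTop) (hnN : ∀ m, n m ≤ N m) (t : Par p) :
    Tendsto (fun m => charFun (P.map fun ω => √(n m) • (sampleMean (fun i => Z i ω) (n m) h₁ +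
        sampleMean (fun i => Z i ω) (N m) h₂)) t -
      (Real.exp (-((t ⬝ᵥ mixedMoment μ h₁ h₂ (n m / N m) *ᵥ t) / 2)) : ℂ)) atTop (𝓝 0) := by
  set G : D → ℝ := fun d => ‖h₁ d‖ + ‖h₂ d‖ with hG
  have hGL : MemLp G 2 μ := hL₁.norm.add hL₂.norm
  have hG0 : ∀ d, 0 ≤ G d := fun d => by positivity
  -- A scale common to all units: both weights are at most `n⁻¹`, and multiplication by `√n` leaves
  -- `n^{-1/2}`.
  set κ : ℕ → ℝ := fun m => 2 * ‖t‖ / √(n m) with hκ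
  have hκ0 : ∀ m, 0 ≤ κ m := fun m => by positivity
  have hκlim : Tendsto κ atTop (𝓝 0) :=
    tendsto_const_nhds.div_atTop
      (Real.tendsto_sqrt_atTop.comp (tendsto_natCast_atTop_atTop.comp hn))
  set B : ℕ → ℝ := fun m =>
    4 * truncatedMoment μ G (κ m) + κ m ^ 2 * (∫ d, G d ^ 2 ∂μ) ^ 2 with hB
  have hBlim : Tendsto B atTop (𝓝 0) := by
    have := ((tendsto_truncatedMoment hGL hG0 hκ0 hκlim).const_mul 4).add
      ((hκlim.pow 2).mul_const ((∫ d, G d ^ 2 ∂μ) ^ 2))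
    simpa using this
  have hlimB : Tendsto (fun m => 4 * ‖t‖ ^ 2 * B m) atTop (𝓝 0) := by
    simpa using hBlim.const_mul (4 * ‖t‖ ^ 2)
  refine squeeze_zero_norm' ?_ hlimB
  filter_upwards [hn.eventually_gt_atTop 0] with m hm
  have hn0 : (0 : ℝ) < n m := by exact_mod_cast hm
  have hNn : (n m : ℝ) ≤ N m := by exact_mod_cast hnN m
  have hN0 : (0 : ℝ) < N m := hn0.trans_le hNn
  have hsq : √(n m : ℝ) ^ 2 = n m := Real.sq_sqrt hn0.le
  have hsqpos : 0 < √(n m : ℝ) := Real.sqrt_pos.2 hn0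
  set g : ℕ → D → Par p := fun k d => √(n m) • unitTerm (n m) (N m) h₁ h₂ k d with hg
  have hgm : ∀ k, Measurable (g k) := fun k =>
    (measurable_unitTerm hm₁ hm₂ (n m) (N m) k).const_smul (√(n m : ℝ))
  have hgZ : ∀ k, AEMeasurable (fun ω => g k (Z k ω)) P := fun k =>
    (hgm k).comp_aemeasurable (hlaw k).aemeasurable
  have hgL : ∀ k, MemLp (g k) 2 μ := fun k =>
    (memLp_unitTerm hL₁ hL₂ (n m) (N m) k).const_smul (√(n m : ℝ))
  set c : ℕ → ℝ := fun k =>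
    ‖t‖ * √(n m) * ((if k < n m then (n m : ℝ)⁻¹ else 0) + (N m : ℝ)⁻¹) with hc
  have hite : ∀ k, 0 ≤ (if k < n m then (n m : ℝ)⁻¹ else 0) := fun k => by split_ifs <;> positivity
  have hite' : ∀ k, (if k < n m then (n m : ℝ)⁻¹ else 0) ≤ (n m : ℝ)⁻¹ := fun k => by
    split_ifs
    · exact le_rfl
    · positivity
  have hc0 : ∀ k, 0 ≤ c k := fun k => by have := hite k; positivity
  have hcκ : ∀ k, c k ≤ κ m := fun k => by
    have h1 : (N m : ℝ)⁻¹ ≤ (n m : ℝ)⁻¹ := inv_anti₀ hn0 hNn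
    calc c k ≤ ‖t‖ * √(n m) * ((n m : ℝ)⁻¹ + (n m : ℝ)⁻¹) := by
          simp only [hc]
          gcongr
          exact hite' k
      _ = κ m := by
          have : (n m : ℝ)⁻¹ = (√(n m : ℝ))⁻¹ ^ 2 := by rw [inv_pow, hsq]
          simp only [hκ]
          rw [this]
          field_simp
          ring
  -- The squared scales are bounded by `2‖t‖² n (n⁻² 1_{k<n} + N⁻²)`, whose sum is `2‖t‖²(1 + n/N)`.
  -- The total error is therefore a bounded multiple of `B m`, however large `N` is.
  have hcsum : ∑ k ∈ Finset.range (N m), c k ^ 2 ≤ 4 * ‖t‖ ^ 2 := by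
    have h1 : ∀ k, c k ^ 2 ≤ 2 * ‖t‖ ^ 2 * n m *
        ((if k < n m then ((n m : ℝ)⁻¹) ^ 2 else 0) + ((N m : ℝ)⁻¹) ^ 2) := fun k => by
      have e : (if k < n m then (n m : ℝ)⁻¹ else 0) ^ 2 =
        if k < n m then ((n m : ℝ)⁻¹) ^ 2 else 0 := by split_ifs <;> simp
      simp only [hc]
      rw [mul_pow, mul_pow, hsq, ← e]
      have := add_sq_le (a := (if k < n m then (n m : ℝ)⁻¹ else 0)) (b := (N m : ℝ)⁻¹)
      have h2 : 0 ≤ ‖t‖ ^ 2 * n m := by positivity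
      nlinarith [mul_le_mul_of_nonneg_left this h2]
    refine (Finset.sum_le_sum fun k _ => h1 k).trans ?_
    rw [← Finset.mul_sum, Finset.sum_add_distrib, sum_range_ite_lt (hnN m), Finset.sum_const,
      Finset.card_range, nsmul_eq_mul]
    have h2 : (n m : ℝ) / N m ≤ 1 := (div_le_one hN0).2 hNn
    have h3 : 2 * ‖t‖ ^ 2 * (n m : ℝ) * (n m * ((n m : ℝ)⁻¹) ^ 2 + N m * ((N m : ℝ)⁻¹) ^ 2) =
      2 * ‖t‖ ^ 2 * (1 + n m / N m) := by field_simp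
    rw [h3]
    nlinarith [sq_nonneg ‖t‖]
  have hunit : ∀ k, ‖charFun (P.map fun ω => g k (Z k ω)) t -
      (Real.exp (-((∫ d, (inner ℝ (g k d) t) ^ 2 ∂μ) / 2)) : ℂ)‖ ≤ c k ^ 2 * B m := by
    intro k
    have hLm : Measurable fun d => inner ℝ (g k d) t := (hgm k).inner measurable_const
    have hcf : charFun (P.map fun ω => g k (Z k ω)) t =
        ∫ d, Complex.exp ((inner ℝ (g k d) t : ℝ) * Complex.I) ∂μ := by
      rw [charFun_apply, integral_map (hgZ k) (by fun_prop)]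
      exact integral_comp_of_hasLaw hlaw
        (f := fun d => Complex.exp ((inner ℝ (g k d) t : ℝ) * Complex.I)) (by fun_prop) k
    have hbound : ∀ d, |inner ℝ (g k d) t| ≤ c k * G d := fun d => by
      refine (abs_real_inner_le_norm _ _).trans ?_
      have e1 : ‖unitTerm (n m) (N m) h₁ h₂ k d‖ ≤
          (if k < n m then (n m : ℝ)⁻¹ else 0) * ‖h₁ d‖ + (N m : ℝ)⁻¹ * ‖h₂ d‖ := by
        refine (norm_add_le _ _).trans ?_
        rw [Pi.smul_apply, Pi.smul_apply, norm_smul, norm_smul, Real.norm_of_nonneg (hite k),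
          Real.norm_of_nonneg (by positivity)]
      have e2 : (if k < n m then (n m : ℝ)⁻¹ else 0) * ‖h₁ d‖ + (N m : ℝ)⁻¹ * ‖h₂ d‖ ≤
          ((if k < n m then (n m : ℝ)⁻¹ else 0) + (N m : ℝ)⁻¹) * G d := by
        have a1 := mul_nonneg (hite k) (norm_nonneg (h₂ d))
        have a2 : 0 ≤ (N m : ℝ)⁻¹ * ‖h₁ d‖ := by positivity
        simp only [hG]
        nlinarith
      simp only [hg, hc]
      rw [norm_smul, Real.norm_of_nonneg hsqpos.le]
      calc _ ≤ √(n m) * (((if k < n m then (n m : ℝ)⁻¹ else 0) + (N m : ℝ)⁻¹) * G d) * ‖t‖ := by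
            gcongr; exact e1.trans e2
        _ = _ := by ring
    have hmean : ∫ d, inner ℝ (g k d) t ∂μ = 0 := by
      have h1 : ∫ d, g k d ∂μ = 0 := by
        simp only [hg]
        rw [integral_smul, integral_unitTerm hL₁ hL₂ h0₁ h0₂, smul_zero]
      have h2 := integral_inner (𝕜 := ℝ) ((hgL k).integrable one_le_two) t
      simp_rw [real_inner_comm t] at h2 ⊢
      rw [h2, h1, inner_zero_right]
    rw [hcf]
    refine (norm_integral_cexp_sub_exp_le hLm hGL hG0 (hc0 k) hbound hmean).trans ?_
    have hT : truncatedMoment μ G (c k) ≤ truncatedMoment μ G (κ m) := by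
      refine integral_mono (integrable_truncated hGL hG0 (hc0 k))
        (integrable_truncated hGL hG0 (hκ0 m)) fun d => ?_
      have := hG0 d
      have := hcκ k
      dsimp only
      gcongr
    have h1 : c k ^ 2 ≤ κ m ^ 2 := pow_le_pow_left₀ (hc0 k) (hcκ k) 2
    simp only [hB]
    gcongr
  have hfun : (fun ω => √(n m) • (sampleMean (fun i => Z i ω) (n m) h₁ +
      sampleMean (fun i => Z i ω) (N m) h₂)) =
      fun ω => ∑ k ∈ Finset.range (N m), g k (Z k ω) := by
    funext ω
    rw [sampleMean_add_sampleMean (hnN m), Finset.smul_sum]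
  have hprod : charFun (P.map fun ω => √(n m) • (sampleMean (fun i => Z i ω) (n m) h₁ +
      sampleMean (fun i => Z i ω) (N m) h₂)) t =
      ∏ k ∈ Finset.range (N m), charFun (P.map fun ω => g k (Z k ω)) t := by
    rw [hfun]
    have hind : iIndepFun (fun k ω => g k (Z k ω)) P := hindep.comp (fun k d => g k d) hgm
    have := (hind.restrict (Finset.range (N m))).charFun_map_fun_finsetSum_eq_prod
      (s := Finset.range (N m)) (X := fun k ω => g k (Z k ω))
      (fun k _ => hgZ k)
    rw [this, Finset.prod_apply]
  have hvar : ∑ k ∈ Finset.range (N m), ∫ d, (inner ℝ (g k d) t) ^ 2 ∂μ =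
      t ⬝ᵥ mixedMoment μ h₁ h₂ (n m / N m) *ᵥ t := by
    have e1 : ∀ k, ∫ d, (inner ℝ (g k d) t) ^ 2 ∂μ = ∑ i, ∑ j, n m * (t i * t j *
        ∫ d, unitTerm (n m) (N m) h₁ h₂ k d i * unitTerm (n m) (N m) h₁ h₂ k d j ∂μ) := by
      intro k
      have hu := memLp_unitTerm hL₁ hL₂ (n m) (N m) k
      have hij : ∀ i j, Integrable (fun d => unitTerm (n m) (N m) h₁ h₂ k d i *
          unitTerm (n m) (N m) h₁ h₂ k d j) μ :=
        fun i j => (memLp_coord hu i).integrable_mul (memLp_coord hu j)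
      have e2 : ∀ d, (inner ℝ (g k d) t) ^ 2 = ∑ i, ∑ j, n m * (t i * t j *
          (unitTerm (n m) (N m) h₁ h₂ k d i * unitTerm (n m) (N m) h₁ h₂ k d j)) := fun d => by
        simp only [hg]
        rw [inner_smul_left, mul_pow, PiLp.inner_apply, sq (∑ i, _), Finset.sum_mul_sum]
        simp only [conj_trivial, hsq, Finset.mul_sum, RCLike.inner_apply]
        refine Finset.sum_congr rfl fun i _ => Finset.sum_congr rfl fun j _ => ?_
        ring
      simp_rw [e2]
      rw [integral_finsetSum _ fun i _ => integrable_finsetSum _ fun j _ =>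
        ((hij i j).const_mul _).const_mul _]
      refine Finset.sum_congr rfl fun i _ => ?_
      rw [integral_finsetSum _ fun j _ => ((hij i j).const_mul _).const_mul _]
      refine Finset.sum_congr rfl fun j _ => ?_
      rw [integral_const_mul, integral_const_mul]
    simp_rw [e1]
    rw [Finset.sum_comm]
    simp only [dotProduct, Matrix.mulVec, Finset.mul_sum]
    refine Finset.sum_congr rfl fun i _ => ?_
    rw [Finset.sum_comm]
    refine Finset.sum_congr rfl fun j _ => ?_
    rw [← Finset.mul_sum, ← Finset.mul_sum, sum_integral_unitTerm_mul hL₁ hL₂ hm (hnN m)]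
    field_simp
  have hexp : (Real.exp (-((t ⬝ᵥ mixedMoment μ h₁ h₂ (n m / N m) *ᵥ t) / 2)) : ℂ) =
      ∏ k ∈ Finset.range (N m), (Real.exp (-((∫ d, (inner ℝ (g k d) t) ^ 2 ∂μ) / 2)) : ℂ) := by
    rw [← Complex.ofReal_prod, ← Real.exp_sum, ← hvar, Finset.sum_neg_distrib, Finset.sum_div]
  rw [hprod, hexp]
  -- Independence and the exponential of a sum turn both sides into products over the units, so the
  -- error is the sum of the errors in `hunit`.
  refine (norm_prod_sub_prod_le _ (fun k _ => ?_) (fun k _ => ?_)).trans ?_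
  · have := Measure.isProbabilityMeasure_map (μ := P) (hgZ k)
    exact norm_charFun_le_one (μ := P.map fun ω => g k (Z k ω)) t
  · rw [Complex.norm_real, Real.norm_of_nonneg (Real.exp_pos _).le]
    exact Real.exp_le_one_iff.2 (by
      have : 0 ≤ ∫ d, (inner ℝ (g k d) t) ^ 2 ∂μ := integral_nonneg fun d => sq_nonneg _
      linarith)
  · refine (Finset.sum_le_sum fun k _ => hunit k).trans ?_
    rw [← Finset.sum_mul]
    have hBn : 0 ≤ B m := by
      have : 0 ≤ truncatedMoment μ G (κ m) := integral_nonneg fun d =>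
        mul_nonneg (sq_nonneg _) (le_min zero_le_one (mul_nonneg (hκ0 m) (hG0 d)))
      simp only [hB]
      positivity
    gcongr

end LinearStatistic

/-! ### Positivity and continuity of the asymptotic variance. -/

section SecondMoments

variable {D : Type*} [MeasurableSpace D] {μ : Measure D}

lemma posSemidef_crossMoment_self {ι : Type*} [Fintype ι] {U : D → ι → ℝ}
    (hU : ∀ i, MemLp (fun d => U d i) 2 μ) : (crossMoment μ U U).PosSemidef := by
  refine Matrix.PosSemidef.of_dotProduct_mulVec_nonneg ?_ fun x => ?_
  · ext i j
    simp [crossMoment, mul_comm]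
  · have hint : ∀ i j, Integrable (fun d => U d i * U d j) μ := fun i j =>
      (hU i).integrable_mul (hU j)
    have he : star x ⬝ᵥ (crossMoment μ U U *ᵥ x) = ∫ d, (∑ i, x i * U d i) ^ 2 ∂μ := by
      have h1 : ∀ d, (∑ i, x i * U d i) ^ 2 = ∑ i, ∑ j, x i * x j * (U d i * U d j) := fun d => by
        rw [sq, Finset.sum_mul_sum]
        refine Finset.sum_congr rfl fun i _ => Finset.sum_congr rfl fun j _ => ?_
        ring
      simp_rw [h1]
      rw [integral_finsetSum _ fun i _ => integrable_finsetSum _ fun j _ =>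
        (hint i j).const_mul _]
      simp only [dotProduct, Matrix.mulVec, crossMoment, Matrix.of_apply, Finset.mul_sum]
      refine Finset.sum_congr rfl fun i _ => ?_
      rw [integral_finsetSum _ fun j _ => (hint i j).const_mul _]
      refine Finset.sum_congr rfl fun j _ => ?_
      rw [integral_const_mul]
      simp only [Pi.star_apply, star_trivial]
      ring
    rw [he]
    exact integral_nonneg fun d => sq_nonneg _

variable {p : ℕ} {h₁ h₂ : D → Par p}

/-- For `r ∈ [0, 1]` this is a convex combination of two second moment matrices, hence positive
semidefinite. In the application `h₁ + h₂` does not depend on the weight matrix. -/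
lemma mixedMoment_eq (hL₁ : MemLp h₁ 2 μ) (hL₂ : MemLp h₂ 2 μ) (r : ℝ) :
    mixedMoment μ h₁ h₂ r = (1 - r) • crossMoment μ (fun d i => h₁ d i) (fun d i => h₁ d i) +
      r • crossMoment μ (fun d i => (h₁ d + h₂ d) i) (fun d i => (h₁ d + h₂ d) i) := by
  ext i j
  have i11 : Integrable (fun d => h₁ d i * h₁ d j) μ :=
    (memLp_coord hL₁ i).integrable_mul (memLp_coord hL₁ j)
  have i12 : Integrable (fun d => h₁ d i * h₂ d j) μ :=
    (memLp_coord hL₁ i).integrable_mul (memLp_coord hL₂ j)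
  have i21 : Integrable (fun d => h₂ d i * h₁ d j) μ :=
    (memLp_coord hL₂ i).integrable_mul (memLp_coord hL₁ j)
  have i22 : Integrable (fun d => h₂ d i * h₂ d j) μ :=
    (memLp_coord hL₂ i).integrable_mul (memLp_coord hL₂ j)
  have he : ∫ d, (h₁ d + h₂ d) i * (h₁ d + h₂ d) j ∂μ = ∫ d, h₁ d i * h₁ d j ∂μ +
      ∫ d, h₁ d i * h₂ d j ∂μ + ∫ d, h₂ d i * h₁ d j ∂μ + ∫ d, h₂ d i * h₂ d j ∂μ := by
    have h1 : ∀ d, (h₁ d + h₂ d) i * (h₁ d + h₂ d) j = h₁ d i * h₁ d j + h₁ d i * h₂ d j +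
        h₂ d i * h₁ d j + h₂ d i * h₂ d j := fun d => by
      simp only [PiLp.add_apply]
      ring
    simp_rw [h1]
    rw [integral_add, integral_add, integral_add i11 i12]
    exacts [i11.add i12, i21, (i11.add i12).add i21, i22]
  simp only [mixedMoment, crossMoment, Matrix.add_apply, Matrix.smul_apply, Matrix.of_apply,
    smul_eq_mul, he]
  ring

lemma posSemidef_mixedMoment (hL₁ : MemLp h₁ 2 μ) (hL₂ : MemLp h₂ 2 μ) {r : ℝ} (hr0 : 0 ≤ r)
    (hr1 : r ≤ 1) : (mixedMoment μ h₁ h₂ r).PosSemidef := by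
  rw [mixedMoment_eq hL₁ hL₂]
  exact ((posSemidef_crossMoment_self fun i => memLp_coord hL₁ i).smul (by linarith)).add
    ((posSemidef_crossMoment_self fun i => memLp_coord (hL₁.add hL₂) i).smul hr0)

lemma continuous_mixedMoment_apply (i j : Fin p) :
    Continuous fun r => mixedMoment μ h₁ h₂ r i j := by
  simp only [mixedMoment, Matrix.add_apply, Matrix.smul_apply, smul_eq_mul]
  fun_prop

end SecondMoments

/-! ### Weak convergence, Gaussian limits and convergence of moments. -/

section WeakConvergence

variable {Ω : Type*} [MeasurableSpace Ω] {P : Measure Ω} {p : ℕ}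

lemma charFun_multivariateGaussian_zero {V : Matrix (Fin p) (Fin p) ℝ} (hV : V.PosSemidef)
    (t : Par p) : charFun (multivariateGaussian 0 V) t =
      (Real.exp (-((t ⬝ᵥ V *ᵥ t) / 2)) : ℂ) := by
  rw [charFun_multivariateGaussian hV, inner_zero_right]
  push_cast
  congr 1
  simp

lemma tendsto_integral_multivariateGaussian {V : ℕ → Matrix (Fin p) (Fin p) ℝ}
    {V₀ : Matrix (Fin p) (Fin p) ℝ} (hV : ∀ m, (V m).PosSemidef) (hV₀ : V₀.PosSemidef)
    (hlim : ∀ i j, Tendsto (fun m => V m i j) atTop (𝓝 (V₀ i j))) (f : Par p →ᵇ ℝ) :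
    Tendsto (fun m => ∫ v, f v ∂(multivariateGaussian 0 (V m))) atTop
      (𝓝 (∫ v, f v ∂(multivariateGaussian 0 V₀))) := by
  have h : Tendsto (β := ProbabilityMeasure (Par p))
      (fun m => ⟨multivariateGaussian 0 (V m), inferInstance⟩) atTop
      (𝓝 ⟨multivariateGaussian 0 V₀, inferInstance⟩) := by
    refine ProbabilityMeasure.tendsto_iff_tendsto_charFun.2 fun t => ?_
    simp only [ProbabilityMeasure.coe_mk]
    simp_rw [charFun_multivariateGaussian_zero (hV _), charFun_multivariateGaussian_zero hV₀]
    refine (Complex.continuous_ofReal.tendsto _).comp ((Real.continuous_exp.tendsto _).comp ?_)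
    refine Tendsto.neg (Tendsto.div_const ?_ 2)
    simp only [dotProduct, Matrix.mulVec]
    exact tendsto_finsetSum _ fun i _ => (tendsto_finsetSum _ fun j _ =>
      (hlim i j).mul_const _).const_mul _
  exact (ProbabilityMeasure.tendsto_iff_forall_integral_tendsto.1 h) f

lemma integral_coord_mul_multivariateGaussian {V : Matrix (Fin p) (Fin p) ℝ}
    (hV : V.PosSemidef) (i j : Fin p) :
    ∫ v : Par p, v i * v j ∂(multivariateGaussian 0 V) = V i j := by
  have hm : ∀ i, ∫ v : Par p, v i ∂(multivariateGaussian 0 V) = 0 := fun i => by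
    have h1 : Integrable (fun v : Par p => v) (multivariateGaussian 0 V) :=
      IsGaussian.integrable_fun_id
    rw [integral_coord h1]
    simp
  have := covariance_eval_multivariateGaussian (μ := 0) hV i j
  rw [covariance, hm, hm] at this
  simpa using this

lemma integral_coord_multivariateGaussian {V : Matrix (Fin p) (Fin p) ℝ} (i : Fin p) :
    ∫ v : Par p, v i ∂(multivariateGaussian 0 V) = 0 := by
  have h1 : Integrable (fun v : Par p => v) (multivariateGaussian 0 V) :=
    IsGaussian.integrable_fun_id
  rw [integral_coord h1]
  simp

lemma tendstoInDistribution_of_tendsto_charFun [IsProbabilityMeasure P] {X : ℕ → Ω → Par p}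
    (hX : ∀ m, AEMeasurable (X m) P) {ν : Measure (Par p)} [IsProbabilityMeasure ν]
    (h : ∀ t, Tendsto (fun m => charFun (P.map (X m)) t) atTop (𝓝 (charFun ν t))) :
    TendstoInDistribution X atTop id (fun _ => P) ν where
  forall_aemeasurable := hX
  aemeasurable_limit := aemeasurable_id
  tendsto := by
    refine ProbabilityMeasure.tendsto_iff_tendsto_charFun.2 fun t => ?_
    simpa using h t

lemma TendstoInDistribution.tendsto_integral [IsProbabilityMeasure P] {X : ℕ → Ω → Par p}
    {ν : Measure (Par p)} [IsProbabilityMeasure ν]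
    (h : TendstoInDistribution X atTop id (fun _ => P) ν) (f : Par p →ᵇ ℝ) :
    Tendsto (fun m => ∫ ω, f (X m ω) ∂P) atTop (𝓝 (∫ v, f v ∂ν)) := by
  have h1 := (ProbabilityMeasure.tendsto_iff_forall_integral_tendsto.1 h.tendsto) f
  simp only [ProbabilityMeasure.coe_mk, Measure.map_id] at h1
  have h2 : ∀ m, ∫ v, f v ∂(P.map (X m)) = ∫ ω, f (X m ω) ∂P := fun m =>
    integral_map (h.forall_aemeasurable m) f.continuous.aestronglyMeasurable
  simpa only [h2] using h1

/-- Truncating a function of at most quadratic growth changes its mean little. -/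
lemma abs_integral_sub_integral_clamp_le [IsProbabilityMeasure P] {E : Type*}
    [NormedAddCommGroup E] {X : Ω → E} (hX : MemLp X 2 P) {φ : E → ℝ} (hφ : Continuous φ)
    (hgrow : ∀ x, |φ x| ≤ 1 + ‖x‖ ^ 2) {C : NNReal} {ε : ℝ} (hε : 0 < ε)
    (hC : eLpNorm ({ω | C ≤ ‖X ω‖₊}.indicator X) 2 P ≤ ENNReal.ofReal ε) {M : ℝ}
    (hM : (C : ℝ) ^ 2 + 2 ≤ M) :
    |∫ ω, φ (X ω) ∂P - ∫ ω, max (-M) (min M (φ (X ω))) ∂P| ≤ 2 * ε ^ 2 := by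
  set Y := {ω | C ≤ ‖X ω‖₊}.indicator X with hY
  have hXm := hX.aestronglyMeasurable
  have hset : NullMeasurableSet {ω | C ≤ ‖X ω‖₊} P :=
    nullMeasurableSet_le aemeasurable_const hXm.nnnorm.aemeasurable
  have hYm : AEStronglyMeasurable Y P := hXm.indicator₀ hset
  have hYL : MemLp Y 2 P := ⟨hYm, hC.trans_lt ENNReal.ofReal_lt_top⟩
  have hY2 : ∫ ω, ‖Y ω‖ ^ 2 ∂P ≤ ε ^ 2 := by
    have h1 := eLpNorm_nnreal_pow_eq_lintegral (μ := P) (f := Y) (p := 2) two_ne_zero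
    have h2 : ∫ ω, ‖Y ω‖ ^ 2 ∂P = (∫⁻ ω, ‖Y ω‖ₑ ^ 2 ∂P).toReal := by
      rw [integral_eq_lintegral_of_nonneg_ae (ae_of_all _ fun ω => sq_nonneg _)
        (hYm.norm.pow 2)]
      congr 1
      refine lintegral_congr fun ω => ?_
      rw [ENNReal.ofReal_pow (norm_nonneg _), ofReal_norm]
    rw [h2]
    refine ENNReal.toReal_le_of_le_ofReal (sq_nonneg _) ?_
    rw [ENNReal.ofReal_pow hε.le]
    simp only [NNReal.coe_ofNat, ENNReal.rpow_ofNat, ENNReal.coe_ofNat] at h1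
    rw [← h1]
    gcongr
  have hφi : Integrable (fun ω => φ (X ω)) P := by
    refine Integrable.mono ((integrable_const (1 : ℝ)).add (hX.integrable_norm_pow two_ne_zero))
      (hφ.comp_aestronglyMeasurable hXm) (ae_of_all _ fun ω => ?_)
    rw [Real.norm_eq_abs, Real.norm_of_nonneg (by simp only [Pi.add_apply]; positivity)]
    exact hgrow _
  have hM0 : 0 ≤ M := by nlinarith [sq_nonneg (C : ℝ)]
  have hclamp : Continuous fun x => max (-M) (min M (φ x)) := by fun_prop
  have hci : Integrable (fun ω => max (-M) (min M (φ (X ω)))) P := by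
    refine Integrable.of_bound (C := M) (hclamp.comp_aestronglyMeasurable hXm)
      (ae_of_all _ fun ω => ?_)
    rw [Real.norm_eq_abs, abs_le]
    exact ⟨le_max_left _ _, max_le (by linarith) (min_le_left _ _)⟩
  rw [← integral_sub hφi hci, ← Real.norm_eq_abs]
  have hbound : ∀ ω, ‖φ (X ω) - max (-M) (min M (φ (X ω)))‖ ≤ 2 * ‖Y ω‖ ^ 2 := fun ω => by
    by_cases hφM : |φ (X ω)| ≤ M
    · have h1 := abs_le.1 hφM
      rw [min_eq_right h1.2, max_eq_right h1.1]
      simp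
    -- Where truncation acts, `C² + 2 < 1 + ‖X‖²`. So `‖X‖ ≥ C`, which puts `ω` into the tail event,
    -- and `‖X‖² ≥ 1`, which turns `1 + ‖X‖²` into `2‖X‖²`.
    · push Not at hφM
      have hg := hgrow (X ω)
      have hCX : (C : ℝ) ≤ ‖X ω‖ := by
        refine le_of_sq_le_sq ?_ (norm_nonneg _)
        linarith
      have hmem : ω ∈ {ω | C ≤ ‖X ω‖₊} := by
        exact_mod_cast hCX
      rw [hY, Set.indicator_of_mem hmem, Real.norm_eq_abs]
      have h3 : |φ (X ω) - max (-M) (min M (φ (X ω)))| ≤ |φ (X ω)| := by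
        rcases le_total 0 (φ (X ω)) with h | h
        · rw [abs_of_nonneg h] at hφM ⊢
          rw [min_eq_left hφM.le, max_eq_right (by linarith), abs_of_nonneg (by linarith)]
          linarith
        · rw [abs_of_nonpos h] at hφM ⊢
          rw [min_eq_right (by linarith), max_eq_left (by linarith), abs_of_nonpos (by linarith)]
          linarith
      nlinarith [sq_nonneg (C : ℝ)]
  calc ‖∫ ω, (φ (X ω) - max (-M) (min M (φ (X ω)))) ∂P‖ ≤ ∫ ω, 2 * ‖Y ω‖ ^ 2 ∂P :=
        norm_integral_le_of_norm_le ((hYL.integrable_norm_pow two_ne_zero).const_mul 2)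
          (ae_of_all _ hbound)
    _ ≤ 2 * ε ^ 2 := by rw [integral_const_mul]; gcongr

/-- Convergence in distribution and uniform square integrability give convergence of the means
of continuous functions of at most quadratic growth. -/
lemma tendsto_integral_of_uniformIntegrable [IsProbabilityMeasure P] {X : ℕ → Ω → Par p}
    {ν : Measure (Par p)} [IsProbabilityMeasure ν]
    (h : TendstoInDistribution X atTop id (fun _ => P) ν) (hν : MemLp (fun x : Par p => x) 2 ν)
    (hX : ∀ m, MemLp (X m) 2 P)
    (hUI : ∀ ε : ℝ, 0 < ε → ∃ C : NNReal, ∀ m,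
      eLpNorm ({ω | C ≤ ‖X m ω‖₊}.indicator (X m)) 2 P ≤ ENNReal.ofReal ε)
    {φ : Par p → ℝ} (hφ : Continuous φ) (hgrow : ∀ x, |φ x| ≤ 1 + ‖x‖ ^ 2) :
    Tendsto (fun m => ∫ ω, φ (X m ω) ∂P) atTop (𝓝 (∫ x, φ x ∂ν)) := by
  rw [Metric.tendsto_nhds]
  intro η hη
  -- Truncation costs `2ε²` under the laws of the `X m` and another `2ε²` under the limit law.
  obtain ⟨ε, hε, hεη⟩ : ∃ ε : ℝ, 0 < ε ∧ 4 * ε ^ 2 ≤ η / 2 := by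
    refine ⟨min 1 (η / 8), by positivity, ?_⟩
    have h1 : min 1 (η / 8) ≤ 1 := min_le_left _ _
    have h2 : min 1 (η / 8) ≤ η / 8 := min_le_right _ _
    have h3 : 0 < min 1 (η / 8) := by positivity
    nlinarith
  obtain ⟨C, hC⟩ := hUI ε hε
  obtain ⟨C', hC'⟩ := (uniformIntegrable_const (ι := Unit) one_le_two ENNReal.ofNat_ne_top
    hν).spec two_ne_zero ENNReal.ofNat_ne_top hε
  -- A single level that is admissible for both tail bounds.
  set M : ℝ := (C : ℝ) ^ 2 + (C' : ℝ) ^ 2 + 2 with hM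
  have hclamp : Continuous fun x => max (-M) (min M (φ x)) := by fun_prop
  have hM0 : 0 ≤ M := by positivity
  let f : Par p →ᵇ ℝ := BoundedContinuousFunction.ofNormedAddCommGroup
    (fun x => max (-M) (min M (φ x))) hclamp M fun x => by
      rw [Real.norm_eq_abs, abs_le]
      exact ⟨le_max_left _ _, max_le (by linarith) (min_le_left _ _)⟩
  have hf := TendstoInDistribution.tendsto_integral h f
  have h1 : ∀ m, |∫ ω, φ (X m ω) ∂P - ∫ ω, f (X m ω) ∂P| ≤ 2 * ε ^ 2 := fun m =>
    abs_integral_sub_integral_clamp_le (hX m) hφ hgrow hε (hC m)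
      (by rw [hM]; nlinarith [sq_nonneg (C' : ℝ)])
  have h2 : |∫ x, φ x ∂ν - ∫ x, f x ∂ν| ≤ 2 * ε ^ 2 :=
    abs_integral_sub_integral_clamp_le hν hφ hgrow hε (hC' ())
      (by rw [hM]; nlinarith [sq_nonneg (C : ℝ)])
  filter_upwards [Metric.tendsto_nhds.1 hf (η / 2) (by positivity)] with m hm
  rw [Real.dist_eq] at hm ⊢
  have a1 := abs_le.1 (h1 m)
  have a2 := abs_le.1 h2
  have a3 := abs_lt.1 hm
  rw [abs_lt]
  constructor <;> linarith

end WeakConvergence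

/-! ### From asymptotic linearity to first-order asymptotics. -/

section AsymptoticLinearity

variable {D Ω : Type*} [MeasurableSpace D] [MeasurableSpace Ω] {μ : Measure D} {P : Measure Ω}
  [IsProbabilityMeasure μ] [IsProbabilityMeasure P] {Z : ℕ → Ω → D} {p : ℕ}
  {h₁ h₂ : D → Par p} {n N : ℕ → ℕ} {θhat : ℕ → Ω → Par p} {θ₀ : Par p}

lemma div_mem_Icc_of_le {n N : ℕ} (h : n ≤ N) : (n : ℝ) / N ∈ Set.Icc (0 : ℝ) 1 :=
  ⟨by positivity, div_le_one_of_le₀ (by exact_mod_cast h) (by positivity)⟩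

/-- When `n/N` converges, merging characteristic functions become convergent ones. Slutsky's theorem
then transfers the limit from the linear part to the estimator. -/
lemma tendstoInDistribution_of_linear (hlaw : ∀ i, HasLaw (Z i) μ P) (hindep : iIndepFun Z P)
    (hm₁ : Measurable h₁) (hm₂ : Measurable h₂) (hL₁ : MemLp h₁ 2 μ) (hL₂ : MemLp h₂ 2 μ)
    (h0₁ : ∫ d, h₁ d ∂μ = 0) (h0₂ : ∫ d, h₂ d ∂μ = 0)
    (hn : Tendsto n atTop atTop) (hnN : ∀ m, n m ≤ N m) (hθ : ∀ m, AEMeasurable (θhat m) P)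
    (hlin : TendstoInMeasure P (fun m ω => √(n m) • (θhat m ω - θ₀ -
      (sampleMean (fun i => Z i ω) (n m) h₁ + sampleMean (fun i => Z i ω) (N m) h₂)))
      atTop fun _ => 0)
    {r : ℝ} (hr : Tendsto (fun m => (n m : ℝ) / N m) atTop (𝓝 r)) :
    TendstoInDistribution (fun m ω => √(n m) • (θhat m ω - θ₀)) atTop id (fun _ => P)
      (multivariateGaussian 0 (mixedMoment μ h₁ h₂ r)) := by
  have hr01 : r ∈ Set.Icc (0 : ℝ) 1 :=
    isClosed_Icc.mem_of_tendsto hr (Eventually.of_forall fun m => div_mem_Icc_of_le (hnN m))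
  have hV := posSemidef_mixedMoment hL₁ hL₂ hr01.1 hr01.2
  have hTm : ∀ m, AEMeasurable (fun ω => √(n m) • (sampleMean (fun i => Z i ω) (n m) h₁ +
      sampleMean (fun i => Z i ω) (N m) h₂)) P := fun m =>
    (((memLp_sampleMean hlaw hL₁ (n m)).add
      (memLp_sampleMean hlaw hL₂ (N m))).aestronglyMeasurable.aemeasurable.const_smul (√(n m : ℝ)))
  have hT : TendstoInDistribution (fun m ω => √(n m) • (sampleMean (fun i => Z i ω) (n m) h₁ +
      sampleMean (fun i => Z i ω) (N m) h₂)) atTop id (fun _ => P)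
      (multivariateGaussian 0 (mixedMoment μ h₁ h₂ r)) := by
    refine tendstoInDistribution_of_tendsto_charFun hTm fun t => ?_
    have h1 := tendsto_charFun_linearStatistic_sub hlaw hindep hm₁ hm₂ hL₁ hL₂ h0₁ h0₂ hn hnN t
    have h2 : Tendsto (fun m => (Real.exp (-((t ⬝ᵥ mixedMoment μ h₁ h₂ (n m / N m) *ᵥ t) / 2)) : ℂ))
        atTop (𝓝 (charFun (multivariateGaussian 0 (mixedMoment μ h₁ h₂ r)) t)) := by
      rw [charFun_multivariateGaussian_zero hV]
      refine (Complex.continuous_ofReal.tendsto _).comp ((Real.continuous_exp.tendsto _).comp ?_)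
      refine Tendsto.neg (Tendsto.div_const ?_ 2)
      simp only [dotProduct, Matrix.mulVec]
      exact tendsto_finsetSum _ fun i _ => (tendsto_finsetSum _ fun j _ =>
        (((continuous_mixedMoment_apply i j).tendsto r).comp hr).mul_const _).const_mul _
    simpa using h1.add h2
  refine tendstoInDistribution_of_tendstoInMeasure_sub _ _ hT ?_
    fun m => ((hθ m).sub_const θ₀).const_smul (√(n m : ℝ))
  refine hlin.congr (fun m => ae_of_all _ fun ω => ?_) (ae_of_all _ fun ω => rfl)
  simp only [Pi.sub_apply]
  rw [← smul_sub]

/-- A statistic that is asymptotically linear in the first `n` and the first `N` units has the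
first-order asymptotics of its linear part. -/
theorem firstOrderAsymptotics_of_linear (hlaw : ∀ i, HasLaw (Z i) μ P) (hindep : iIndepFun Z P)
    (hm₁ : Measurable h₁) (hm₂ : Measurable h₂) (hL₁ : MemLp h₁ 2 μ) (hL₂ : MemLp h₂ 2 μ)
    (h0₁ : ∫ d, h₁ d ∂μ = 0) (h0₂ : ∫ d, h₂ d ∂μ = 0)
    (hn : Tendsto n atTop atTop) (hnN : ∀ m, n m ≤ N m) (hθ : ∀ m, AEMeasurable (θhat m) P)
    (hlin : TendstoInMeasure P (fun m ω => √(n m) • (θhat m ω - θ₀ -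
      (sampleMean (fun i => Z i ω) (n m) h₁ + sampleMean (fun i => Z i ω) (N m) h₂)))
      atTop fun _ => 0) :
    FirstOrderAsymptotics P n θhat θ₀
      (fun m ω => sampleMean (fun i => Z i ω) (n m) h₁ + sampleMean (fun i => Z i ω) (N m) h₂)
      (fun m => mixedMoment μ h₁ h₂ (n m / N m)) := by
  have hV : ∀ m, (mixedMoment μ h₁ h₂ (n m / N m)).PosSemidef := fun m =>
    posSemidef_mixedMoment hL₁ hL₂ (div_mem_Icc_of_le (hnN m)).1 (div_mem_Icc_of_le (hnN m)).2
  set X : ℕ → Ω → Par p := fun m ω => √(n m) • (θhat m ω - θ₀) with hX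
  -- `n/N` need not converge, but it stays in `[0, 1]`. Every subsequence has a further one along
  -- which there is a genuine Gaussian limit, and it is enough to check each merging statement
  -- there.
  have hsub : ∀ ns : ℕ → ℕ, Tendsto ns atTop atTop → ∃ ms : ℕ → ℕ, ∃ r : ℝ,
      (mixedMoment μ h₁ h₂ r).PosSemidef ∧
      (∀ i j, Tendsto (fun k => mixedMoment μ h₁ h₂ (n (ns (ms k)) / N (ns (ms k))) i j) atTop
        (𝓝 (mixedMoment μ h₁ h₂ r i j))) ∧
      TendstoInDistribution (fun k => X (ns (ms k))) atTop id (fun _ => P)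
        (multivariateGaussian 0 (mixedMoment μ h₁ h₂ r)) := by
    intro ns hns
    obtain ⟨r, hr, ms, hms, hlim⟩ := isCompact_Icc.tendsto_subseq
      (x := fun k => (n (ns k) : ℝ) / N (ns k)) fun k => div_mem_Icc_of_le (hnN (ns k))
    have hcomp : Tendsto (fun k => ns (ms k)) atTop atTop := hns.comp hms.tendsto_atTop
    refine ⟨ms, r, posSemidef_mixedMoment hL₁ hL₂ hr.1 hr.2, fun i j =>
      ((continuous_mixedMoment_apply i j).tendsto r).comp hlim, ?_⟩
    exact tendstoInDistribution_of_linear (n := fun k => n (ns (ms k)))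
      (N := fun k => N (ns (ms k))) (θhat := fun k => θhat (ns (ms k))) hlaw hindep hm₁ hm₂ hL₁ hL₂
      h0₁ h0₂ (hn.comp hcomp) (fun k => hnN _) (fun k => hθ _) (hlin.comp hcomp) hlim
  have hgauss : ∀ r, MemLp (fun x : Par p => x) 2
      (multivariateGaussian 0 (mixedMoment μ h₁ h₂ r)) := fun r => IsGaussian.memLp_two_id
  have hspec : UniformIntegrable X 2 P → ∀ ε : ℝ, 0 < ε → ∃ C : NNReal, ∀ m,
      eLpNorm ({ω | C ≤ ‖X m ω‖₊}.indicator (X m)) 2 P ≤ ENNReal.ofReal ε :=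
    fun hUI ε hε => hUI.spec two_ne_zero ENNReal.ofNat_ne_top hε
  have hmem : UniformIntegrable X 2 P → ∀ m, MemLp (X m) 2 P := fun hUI m => hUI.memLp m
  have hcoordgrow : ∀ (i : Fin p) (x : Par p), |x i| ≤ 1 + ‖x‖ ^ 2 := fun i x => by
    have h1 : |x i| ≤ ‖x‖ := by simpa using PiLp.norm_apply_le x i
    nlinarith [sq_nonneg (‖x‖ - 1)]
  have hprodgrow : ∀ (i j : Fin p) (x : Par p), |x i * x j| ≤ 1 + ‖x‖ ^ 2 := fun i j x => by
    have h1 : |x i| ≤ ‖x‖ := by simpa using PiLp.norm_apply_le x i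
    have h2 : |x j| ≤ ‖x‖ := by simpa using PiLp.norm_apply_le x j
    rw [abs_mul]
    nlinarith [abs_nonneg (x i), abs_nonneg (x j), norm_nonneg x]
  have hmse : UniformIntegrable X 2 P → ∀ i j, Tendsto (fun m => ∫ ω, X m ω i * X m ω j ∂P -
      mixedMoment μ h₁ h₂ (n m / N m) i j) atTop (𝓝 0) := by
    intro hUI i j
    refine tendsto_of_subseq_tendsto fun ns hns => ?_
    obtain ⟨ms, r, hVr, hVlim, hdist⟩ := hsub ns hns
    refine ⟨ms, ?_⟩
    have h1 := tendsto_integral_of_uniformIntegrable hdist (hgauss r) (fun k => hmem hUI _)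
      (fun ε hε => (hspec hUI ε hε).imp fun C hC k => hC _)
      (φ := fun x => x i * x j) (by fun_prop) (hprodgrow i j)
    rw [integral_coord_mul_multivariateGaussian hVr] at h1
    simpa using h1.sub (hVlim i j)
  have hmean : UniformIntegrable X 2 P → ∀ i, Tendsto (fun m => ∫ ω, X m ω i ∂P) atTop (𝓝 0) := by
    intro hUI i
    refine tendsto_of_subseq_tendsto fun ns hns => ?_
    obtain ⟨ms, r, hVr, hVlim, hdist⟩ := hsub ns hns
    refine ⟨ms, ?_⟩
    have h1 := tendsto_integral_of_uniformIntegrable hdist (hgauss r) (fun k => hmem hUI _)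
      (fun ε hε => (hspec hUI ε hε).imp fun C hC k => hC _)
      (φ := fun x => x i) (by fun_prop) (hcoordgrow i)
    rwa [integral_coord_multivariateGaussian] at h1
  refine ⟨hV, fun f => ?_, hlin, fun m => ?_, fun m hm => ?_, fun m hm => ?_, fun hUI i j => ?_,
    fun hUI i j => ?_⟩
  · refine tendsto_of_subseq_tendsto fun ns hns => ?_
    obtain ⟨ms, r, hVr, hVlim, hdist⟩ := hsub ns hns
    refine ⟨ms, ?_⟩
    have h1 := TendstoInDistribution.tendsto_integral hdist f
    have h2 := tendsto_integral_multivariateGaussian (fun k => hV (ns (ms k))) hVr hVlim f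
    simpa using h1.sub h2
  · exact (memLp_sampleMean hlaw hL₁ (n m)).add (memLp_sampleMean hlaw hL₂ (N m))
  · rw [integral_add ((memLp_sampleMean hlaw hL₁ (n m)).integrable one_le_two)
      ((memLp_sampleMean hlaw hL₂ (N m)).integrable one_le_two),
      integral_sampleMean_eq_zero hlaw (hL₁.integrable one_le_two) h0₁,
      integral_sampleMean_eq_zero hlaw (hL₂.integrable one_le_two) h0₂, add_zero]
  · exact crossMoment_linearStatistic hlaw hindep hm₁ hm₂ hL₁ hL₂ h0₁ h0₂ hm (hnN m)
  · refine (hmse hUI i j).congr fun m => ?_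
    congr 1
    simp only [crossMoment, Matrix.of_apply]
    rw [← integral_const_mul]
    refine integral_congr_ae (ae_of_all _ fun ω => ?_)
    simp only [hX, PiLp.smul_apply, smul_eq_mul]
    have := Real.mul_self_sqrt (Nat.cast_nonneg (α := ℝ) (n m))
    linear_combination ((θhat m ω - θ₀) i * (θhat m ω - θ₀) j) * this
  -- The covariance is the second moment minus the product of the means, and the means of the
  -- rescaled errors tend to zero.
  · have h1 := (hmse hUI i j).sub ((hmean hUI i).mul (hmean hUI j))
    simp only [mul_zero, sub_zero] at h1
    refine h1.congr' ?_
    filter_upwards [hn.eventually_gt_atTop 0] with m hm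
    have hn0 : (0 : ℝ) < n m := by exact_mod_cast hm
    have hsq0 : √(n m : ℝ) ≠ 0 := (Real.sqrt_pos.2 hn0).ne'
    have hXi : ∀ a, MemLp (fun ω => X m ω a) 2 P := fun a => memLp_coord (hmem hUI m) a
    have hcov : cov[fun ω => X m ω i, fun ω => X m ω j; P] =
        n m * cov[fun ω => θhat m ω i, fun ω => θhat m ω j; P] := by
      have hθL : ∀ a, Integrable (fun ω => θhat m ω a) P := fun a => by
        have h2 := (((hXi a).integrable one_le_two).const_mul (√(n m : ℝ))⁻¹).add
          (integrable_const (θ₀ a))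
        refine h2.congr (ae_of_all _ fun ω => ?_)
        simp only [hX, Pi.add_apply, PiLp.smul_apply, PiLp.sub_apply, smul_eq_mul]
        field_simp
        ring
      have e1 : ∀ a, (fun ω => X m ω a) = fun ω => √(n m) * (θhat m ω a - θ₀ a) := fun a => by
        funext ω
        simp [hX]
      rw [e1, e1, covariance_const_mul_left, covariance_const_mul_right,
        covariance_sub_const_left (hθL i), covariance_sub_const_right (hθL j), ← mul_assoc,
        Real.mul_self_sqrt hn0.le]
    rw [covariance_eq_sub (hXi i) (hXi j)] at hcov
    simp only [varMatrix, Matrix.of_apply]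
    rw [← hcov]
    simp only [Pi.mul_apply]
    ring

end AsymptoticLinearity

/-! ### Domination, measurability and linearisation of the score. -/

section ScoreFamily

lemma measurable_clm_of_apply {D F : Type*} [MeasurableSpace D] [NormedAddCommGroup F]
    [NormedSpace ℝ F] [FiniteDimensional ℝ F] [MeasurableSpace F] [BorelSpace F] {p : ℕ}
    {q : D → Par p →L[ℝ] F} (h : ∀ v, Measurable fun d => q d v) : Measurable q := by
  have he : q = fun d => ∑ i, ContinuousLinearMap.smulRightL ℝ (Par p) F (EuclideanSpace.proj i)
      (q d (EuclideanSpace.single i 1)) := by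
    funext d
    ext v
    conv_lhs => rw [← (EuclideanSpace.basisFun (Fin p) ℝ).sum_repr v]
    simp
  rw [he]
  refine Finset.measurable_fun_sum _ fun i _ => ?_
  exact (ContinuousLinearMap.continuous _).measurable.comp (h _)

variable {𝒳 𝒴 D : Type*} [MeasurableSpace D]
  {μ : Measure D} {p : ℕ} {ℓ : 𝒳 → 𝒴 → Par p → ℝ} {O : Set (Par p)} {sel : D → 𝒳 × 𝒴}

lemma continuousAt_score (hO : IsOpen O) (hconv : ∀ x y, ConvexOn ℝ O (ℓ x y))
    (hdiff : ∀ x y, DifferentiableOn ℝ (ℓ x y) O) {θ : Par p} (hθ : θ ∈ O) (x : 𝒳) (y : 𝒴) :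
    ContinuousAt (score ℓ x y) θ :=
  continuousAt_gradient hO (hconv x y) (hdiff x y) hθ

/-- Convexity replaces a domination hypothesis: on a small ball the score is bounded by its
integrable values at `θ` shifted by `±t` along each axis, and it is continuous there. -/
lemma exists_oscillation_envelope (hO : IsOpen O) (hconv : ∀ x y, ConvexOn ℝ O (ℓ x y))
    (hdiff : ∀ x y, DifferentiableOn ℝ (ℓ x y) O)
    (hmeas : ∀ θ ∈ O, Measurable fun d => score ℓ (sel d).1 (sel d).2 θ)
    (hint : ∀ θ ∈ O, Integrable (fun d => score ℓ (sel d).1 (sel d).2 θ) μ)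
    {θ : Par p} (hθ : θ ∈ O) {ε : ℝ} (hε : 0 < ε) :
    ∃ δ > 0, ∃ g : D → ℝ, Measurable g ∧ Integrable g μ ∧ ∫ d, g d ∂μ < ε ∧
      ∀ d x, dist x θ < δ →
        ‖score ℓ (sel d).1 (sel d).2 x - score ℓ (sel d).1 (sel d).2 θ‖ ≤ g d := by
  obtain ⟨t, ht, hball⟩ := Metric.nhds_basis_closedBall.mem_iff.1 (hO.mem_nhds hθ)
  set r : ℝ := t / (2 * (p + 1)) with hr
  have hrpos : 0 < r := by positivity
  have hrt : r ≤ t := div_le_self ht.le (by linarith [(Nat.cast_nonneg p : (0 : ℝ) ≤ p)])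
  have hsub : Metric.ball θ r ⊆ O :=
    (Metric.ball_subset_closedBall.trans (Metric.closedBall_subset_closedBall hrt)).trans hball
  have hplus : ∀ i : Fin p, θ + EuclideanSpace.single i t ∈ O := fun i => hball (by
    rw [Metric.mem_closedBall, dist_eq_norm]; simp [abs_of_pos ht])
  have hminus : ∀ i : Fin p, θ - EuclideanSpace.single i t ∈ O := fun i => hball (by
    rw [Metric.mem_closedBall, dist_eq_norm]; simp [abs_of_pos ht])
  refine exists_small_envelope (μ := μ)
    (φ := fun d x => ‖score ℓ (sel d).1 (sel d).2 x - score ℓ (sel d).1 (sel d).2 θ‖) hrpos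
    (g₀ := fun d => 4 * ∑ i, (‖score ℓ (sel d).1 (sel d).2 (θ + EuclideanSpace.single i t)‖ +
      ‖score ℓ (sel d).1 (sel d).2 (θ - EuclideanSpace.single i t)‖) +
      ‖score ℓ (sel d).1 (sel d).2 θ‖) ?_ ?_ ?_ ?_ ?_ ?_ hε
  · refine ((integrable_finsetSum _ fun i _ => ?_).const_mul 4).add (hint θ hθ).norm
    exact (hint _ (hplus i)).norm.add (hint _ (hminus i)).norm
  · exact fun x hx => ((hmeas x (hsub hx)).sub (hmeas θ hθ)).norm
  · exact fun d x hx _ =>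
      ((continuousAt_score hO hconv hdiff (hsub hx) _ _).sub continuousAt_const).norm
  · intro d x hx
    refine (norm_sub_le _ _).trans (add_le_add ?_ le_rfl)
    refine norm_gradient_le_sum hO (hconv _ _) (hdiff _ _) ht hball ?_
    rw [← dist_eq_norm]
    exact (Metric.mem_ball.1 hx).le
  · intro d; simp
  · exact fun d => ((continuousAt_score hO hconv hdiff hθ _ _).sub continuousAt_const).norm

variable {U : Set (Par p)} {θ₀ : Par p} {b : 𝒳 → 𝒴 → ℝ}

lemma measurable_fderiv_score (hO : O ∈ 𝓝 θ₀)
    (hmeas : ∀ θ ∈ O, Measurable fun d => score ℓ (sel d).1 (sel d).2 θ)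
    (hd : ∀ x y, DifferentiableAt ℝ (score ℓ x y) θ₀) :
    Measurable fun d => fderiv ℝ (score ℓ (sel d).1 (sel d).2) θ₀ := by
  refine measurable_clm_of_apply fun v => ?_
  obtain ⟨r, hr, hball⟩ := Metric.mem_nhds_iff.1 hO
  -- Scaled so that `‖v‖ / c n < r` for every `n`: the difference quotients then use only parameters
  -- at which the score is measurable.
  set c : ℕ → ℝ := fun n => ((n : ℝ) + 1) * ((‖v‖ + 1) / r) with hc
  have hcpos : ∀ n, 0 < c n := fun n => by positivity
  have hclim : Tendsto (fun n => ‖c n‖) atTop atTop := by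
    have h1 : Tendsto c atTop atTop :=
      (tendsto_atTop_add_const_right _ 1 tendsto_natCast_atTop_atTop).atTop_mul_const
        (by positivity)
    exact h1.congr fun n => (Real.norm_of_nonneg (hcpos n).le).symm
  have hmem : ∀ n, θ₀ + (c n)⁻¹ • v ∈ O := fun n => hball (by
    rw [Metric.mem_ball, dist_eq_norm, add_sub_cancel_left, norm_smul, norm_inv,
      Real.norm_of_nonneg (hcpos n).le, inv_mul_lt_iff₀ (hcpos n)]
    have : c n * r = ((n : ℝ) + 1) * (‖v‖ + 1) := by simp only [hc]; field_simp
    rw [this]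
    nlinarith [norm_nonneg v, (Nat.cast_nonneg n : (0 : ℝ) ≤ n)])
  refine measurable_of_tendsto_metrizable (f := fun n d =>
    c n • (score ℓ (sel d).1 (sel d).2 (θ₀ + (c n)⁻¹ • v) - score ℓ (sel d).1 (sel d).2 θ₀))
    (fun n => ((hmeas _ (hmem n)).sub (hmeas _ (mem_of_mem_nhds hO))).const_smul (c n)) ?_
  rw [tendsto_pi_nhds]
  exact fun d => (hd _ _).hasFDerivAt.lim v hclim

/-- The remainder divided by `‖x - θ₀‖` is at most `2b` by the mean value inequality, and tends to
zero pointwise by differentiability. `exists_small_envelope` makes this uniform in mean. -/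
lemma exists_linearization_envelope (hO : O ∈ 𝓝 θ₀)
    (hmeas : ∀ θ ∈ O, Measurable fun d => score ℓ (sel d).1 (sel d).2 θ) (hU : U ∈ 𝓝 θ₀)
    (hd : ∀ x y, ∀ θ ∈ U, DifferentiableAt ℝ (score ℓ x y) θ)
    (hb : ∀ x y, ∀ θ ∈ U, ‖fderiv ℝ (score ℓ x y) θ‖ ≤ b x y)
    (hbi : Integrable (fun d => b (sel d).1 (sel d).2) μ) {ε : ℝ} (hε : 0 < ε) :
    ∃ δ > 0, ∃ g : D → ℝ, Measurable g ∧ Integrable g μ ∧ ∫ d, g d ∂μ < ε ∧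
      ∀ d x, dist x θ₀ < δ →
        ‖score ℓ (sel d).1 (sel d).2 x - score ℓ (sel d).1 (sel d).2 θ₀ -
          fderiv ℝ (score ℓ (sel d).1 (sel d).2) θ₀ (x - θ₀)‖ ≤ g d * ‖x - θ₀‖ := by
  have hd₀ : ∀ x y, DifferentiableAt ℝ (score ℓ x y) θ₀ := fun x y => hd x y _ (mem_of_mem_nhds hU)
  obtain ⟨r, hr, hball⟩ := Metric.mem_nhds_iff.1 (inter_mem hO hU)
  have hdm := measurable_fderiv_score hO hmeas hd₀
  set R : D → Par p → Par p := fun d x => score ℓ (sel d).1 (sel d).2 x -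
    score ℓ (sel d).1 (sel d).2 θ₀ - fderiv ℝ (score ℓ (sel d).1 (sel d).2) θ₀ (x - θ₀) with hR
  have hRb : ∀ d, ∀ x ∈ Metric.ball θ₀ r, ‖R d x‖ ≤ 2 * b (sel d).1 (sel d).2 * ‖x - θ₀‖ := by
    intro d x hx
    have h1 := (convex_ball θ₀ r).norm_image_sub_le_of_norm_fderiv_le (𝕜 := ℝ)
      (fun z hz => hd (sel d).1 (sel d).2 z (hball hz).2)
      (fun z hz => hb (sel d).1 (sel d).2 z (hball hz).2) (Metric.mem_ball_self hr) hx
    have h2 : ‖fderiv ℝ (score ℓ (sel d).1 (sel d).2) θ₀ (x - θ₀)‖ ≤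
        b (sel d).1 (sel d).2 * ‖x - θ₀‖ :=
      (ContinuousLinearMap.le_opNorm _ _).trans (by
        gcongr; exact hb _ _ _ (mem_of_mem_nhds hU))
    exact (norm_sub_le _ _).trans (by linarith)
  have key : ∃ δ > 0, ∃ g : D → ℝ, Measurable g ∧ Integrable g μ ∧ ∫ d, g d ∂μ < ε ∧
      ∀ d x, dist x θ₀ < δ → ‖R d x‖ / ‖x - θ₀‖ ≤ g d := by
    refine exists_small_envelope (φ := fun d x => ‖R d x‖ / ‖x - θ₀‖) hr
      (g₀ := fun d => 2 * b (sel d).1 (sel d).2) (hbi.const_mul 2) ?_ ?_ ?_ ?_ ?_ hε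
    · intro x hx
      have h1 : Measurable fun d => fderiv ℝ (score ℓ (sel d).1 (sel d).2) θ₀ (x - θ₀) :=
        (ContinuousLinearMap.apply ℝ (Par p) (x - θ₀)).continuous.measurable.comp hdm
      exact ((((hmeas x (hball hx).1).sub (hmeas θ₀ (mem_of_mem_nhds hO))).sub h1).norm).div_const _
    · intro d x hx hne
      have h1 : ContinuousAt (score ℓ (sel d).1 (sel d).2) x :=
        (hd _ _ x (hball hx).2).continuousAt
      have h2 : ‖x - θ₀‖ ≠ 0 := (norm_pos_iff.2 (sub_ne_zero.2 hne)).ne'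
      refine ContinuousAt.div ?_ (by fun_prop) h2
      exact ((h1.sub continuousAt_const).sub (by fun_prop)).norm
    · intro d x hx
      have h0 : 0 ≤ b (sel d).1 (sel d).2 :=
        (norm_nonneg _).trans (hb (sel d).1 (sel d).2 _ (mem_of_mem_nhds hU))
      exact div_le_of_le_mul₀ (norm_nonneg _) (by positivity) (hRb d x hx)
    -- At `x = θ₀` the quotient is `0 / 0 = 0`, the value that makes it continuous there.
    · intro d; simp
    · intro d
      have h1 : Tendsto (fun x => ‖R d x‖ / ‖x - θ₀‖) (𝓝 θ₀) (𝓝 0) :=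
        (hd₀ (sel d).1 (sel d).2).hasFDerivAt.isLittleO.norm_norm.tendsto_div_nhds_zero
      rw [ContinuousAt]
      simpa using h1
  obtain ⟨δ, hδ, g, hgm, hgi, hgε, hg⟩ := key
  refine ⟨min δ r, lt_min hδ hr, g, hgm, hgi, hgε, fun d x hx => ?_⟩
  rcases eq_or_ne x θ₀ with rfl | hne
  · simp
  · have hpos : 0 < ‖x - θ₀‖ := norm_pos_iff.2 (sub_ne_zero.2 hne)
    exact (div_le_iff₀ hpos).1 (hg d x (hx.trans_le (min_le_left _ _)))

lemma integrable_fderiv_score (hO : O ∈ 𝓝 θ₀)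
    (hmeas : ∀ θ ∈ O, Measurable fun d => score ℓ (sel d).1 (sel d).2 θ) (hU : U ∈ 𝓝 θ₀)
    (hd : ∀ x y, ∀ θ ∈ U, DifferentiableAt ℝ (score ℓ x y) θ)
    (hb : ∀ x y, ∀ θ ∈ U, ‖fderiv ℝ (score ℓ x y) θ‖ ≤ b x y)
    (hbi : Integrable (fun d => b (sel d).1 (sel d).2) μ) :
    Integrable (fun d => fderiv ℝ (score ℓ (sel d).1 (sel d).2) θ₀) μ :=
  hbi.mono' (measurable_fderiv_score hO hmeas fun x y =>
    hd x y _ (mem_of_mem_nhds hU)).aestronglyMeasurable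
    (ae_of_all _ fun _ => hb _ _ _ (mem_of_mem_nhds hU))

end ScoreFamily

/-! ### Limit theorems for score means, and the matrix `H`. -/

section ScoreMeans

variable {𝒳 𝒴 Ω : Type*} [MeasurableSpace 𝒳] [MeasurableSpace 𝒴] [MeasurableSpace Ω] {p K : ℕ}
  {ℓ : 𝒳 → 𝒴 → Par p → ℝ} {μ : Measure (Obs 𝒳 𝒴 K)} {Θ : Set (Par p)} {θ₀ : Par p}
  {P : Measure Ω} {Z : ℕ → Ω → Obs 𝒳 𝒴 K}

/-- The mean derivative of the score at the label selected by `sel`. -/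
noncomputable def meanDeriv (ℓ : 𝒳 → 𝒴 → Par p → ℝ) (μ : Measure (Obs 𝒳 𝒴 K))
    (sel : Obs 𝒳 𝒴 K → 𝒳 × 𝒴) (θ : Par p) : Par p →L[ℝ] Par p :=
  ∫ d, fderiv ℝ (score ℓ (sel d).1 (sel d).2) θ ∂μ

/-- Observation and true label. -/
def selTrue (d : Obs 𝒳 𝒴 K) : 𝒳 × 𝒴 := (d.1, d.2.1)

/-- Observation and `k`-th predicted label. -/
def selPred (k : Fin K) (d : Obs 𝒳 𝒴 K) : 𝒳 × 𝒴 := (d.1, d.2.2 k)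

lemma measurable_selTrue : Measurable (selTrue : Obs 𝒳 𝒴 K → 𝒳 × 𝒴) := by
  unfold selTrue
  fun_prop

lemma measurable_selPred (k : Fin K) : Measurable (selPred k : Obs 𝒳 𝒴 K → 𝒳 × 𝒴) := by
  unfold selPred
  fun_prop

/-- The sample means of a family of scores converge uniformly on `Θ` and are almost linear at
`θ₀`. -/
def ScoreLLN (z : ℕ → Obs 𝒳 𝒴 K) (ℓ : 𝒳 → 𝒴 → Par p → ℝ) (μ : Measure (Obs 𝒳 𝒴 K))
    (Θ : Set (Par p)) (θ₀ : Par p) (sel : Obs 𝒳 𝒴 K → 𝒳 × 𝒴) : Prop :=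
  TendstoUniformlyOn (fun n θ => sampleMean z n fun d => score ℓ (sel d).1 (sel d).2 θ)
    (fun θ => ∫ d, score ℓ (sel d).1 (sel d).2 θ ∂μ) atTop Θ ∧
  ∀ ε > 0, ∃ δ > 0, ∀ᶠ n in atTop, ∀ x, dist x θ₀ < δ →
    ‖sampleMean z n (fun d => score ℓ (sel d).1 (sel d).2 x) -
      sampleMean z n (fun d => score ℓ (sel d).1 (sel d).2 θ₀) -
        meanDeriv ℓ μ sel θ₀ (x - θ₀)‖ ≤ ε * ‖x - θ₀‖

lemma Regularity.ae_scoreLLN (hreg : Regularity ℓ μ Θ θ₀) (hlaw : ∀ i, HasLaw (Z i) μ P)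
    (hindep : iIndepFun Z P) : ∀ᵐ ω ∂P, ScoreLLN (fun i => Z i ω) ℓ μ Θ θ₀ selTrue ∧
      ∀ k, ScoreLLN (fun i => Z i ω) ℓ μ Θ θ₀ (selPred k) := by
  obtain ⟨O, hO, -, hΘO, hconv, hdiff, hmeas, hiT, hiP⟩ := hreg.convex_loss
  obtain ⟨U, hU, hd, -, b, hb, hbT, hbP⟩ := hreg.local_smooth
  have hθO : O ∈ 𝓝 θ₀ := hO.mem_nhds (hΘO (interior_subset hreg.mem_interior))
  have hgen : ∀ sel : Obs 𝒳 𝒴 K → 𝒳 × 𝒴, Measurable sel →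
      (∀ θ ∈ O, Integrable (fun d => score ℓ (sel d).1 (sel d).2 θ) μ) →
      Integrable (fun d => b (sel d).1 (sel d).2) μ →
      ∀ᵐ ω ∂P, ScoreLLN (fun i => Z i ω) ℓ μ Θ θ₀ sel := by
    intro sel hsel hi hbi
    have hm : ∀ θ ∈ O, Measurable fun d => score ℓ (sel d).1 (sel d).2 θ :=
      fun θ hθ => (hmeas θ hθ).comp hsel
    refine (ae_tendstoUniformlyOn_sampleMean hlaw hindep hreg.compact
      (q := fun d θ => score ℓ (sel d).1 (sel d).2 θ) (fun θ hθ => hm θ (hΘO hθ))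
      (fun θ hθ => hi θ (hΘO hθ)) fun θ hθ ε hε =>
        exists_oscillation_envelope hO hconv hdiff hm hi (hΘO hθ) hε).and ?_
    exact ae_sampleMean_almost_linear hlaw hindep (q := fun d θ => score ℓ (sel d).1 (sel d).2 θ)
      (measurable_fderiv_score hθO hm fun x y => hd x y _ (mem_of_mem_nhds hU))
      (integrable_fderiv_score hθO hm hU hd hb hbi)
      fun ε hε => exists_linearization_envelope hθO hm hU hd hb hbi hε
  exact (hgen selTrue measurable_selTrue hiT hbT).and
    (ae_all_iff.2 fun k => hgen (selPred k) (measurable_selPred k) (fun θ hθ => hiP θ hθ k) (hbP k))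

lemma Regularity.continuousOn_meanScore (hreg : Regularity ℓ μ Θ θ₀) :
    ContinuousOn (fun θ => ∫ d, scoreTrue ℓ θ d ∂μ) Θ := by
  obtain ⟨O, hO, -, hΘO, hconv, hdiff, hmeas, hiT, -⟩ := hreg.convex_loss
  exact continuousOn_integral_of_oscillation (q := fun d θ => scoreTrue ℓ θ d)
    (fun θ hθ => hiT θ (hΘO hθ)) fun θ hθ ε hε =>
      exists_oscillation_envelope (sel := selTrue) hO hconv hdiff
        (fun θ hθ => (hmeas θ hθ).comp measurable_selTrue) hiT (hΘO hθ) hε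

lemma Regularity.hessian_apply (hreg : Regularity ℓ μ Θ θ₀) (i j : Fin p) :
    hessian ℓ μ θ₀ i j = meanDeriv ℓ μ selTrue θ₀ (EuclideanSpace.single i 1) j := by
  obtain ⟨O, hO, -, hΘO, hconv, hdiff, hmeas, hiT, -⟩ := hreg.convex_loss
  obtain ⟨U, hU, hd, -, b, hb, hbT, hbP⟩ := hreg.local_smooth
  have hθO : O ∈ 𝓝 θ₀ := hO.mem_nhds (hΘO (interior_subset hreg.mem_interior))
  have hi := integrable_fderiv_score (sel := selTrue) (μ := μ) hθO
    (fun θ hθ => (hmeas θ hθ).comp measurable_selTrue) hU hd hb hbT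
  rw [meanDeriv, ContinuousLinearMap.integral_apply hi,
    ← integral_coord (hi.apply_continuousLinearMap _)]
  rfl

/-- Symmetry holds for each observation before integration: near `θ₀` the score is the gradient of
the loss, and it is differentiable at `θ₀`, which suffices for symmetry of the second derivative. -/
lemma Regularity.isSymm_hessian (hreg : Regularity ℓ μ Θ θ₀) :
    (hessian ℓ μ θ₀)ᵀ = hessian ℓ μ θ₀ := by
  obtain ⟨O, hO, -, hΘO, -, hdiff, -⟩ := hreg.convex_loss
  obtain ⟨U, hU, hd, -⟩ := hreg.local_smooth
  have hθO : O ∈ 𝓝 θ₀ := hO.mem_nhds (hΘO (interior_subset hreg.mem_interior))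
  ext i j
  simp only [Matrix.transpose_apply, hessian, Matrix.of_apply]
  congr 1
  funext d
  -- The Riesz map, which turns the gradient back into the Fréchet derivative.
  let L : Par p →L[ℝ] StrongDual ℝ (Par p) := LinearMap.toContinuousLinearMap
    { toFun := fun v => innerSL ℝ v
      map_add' := fun v w => map_add _ v w
      map_smul' := fun c v => by simp }
  have hf : ∀ᶠ θ in 𝓝 θ₀, HasFDerivAt (ℓ d.1 d.2.1)
      (L (score ℓ d.1 d.2.1 θ)) θ := by
    filter_upwards [hO.mem_nhds (mem_of_mem_nhds hθO)] with θ hθ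
    exact ((hdiff d.1 d.2.1).differentiableAt (hO.mem_nhds hθ)).hasGradientAt.hasFDerivAt
  have hx := L.hasFDerivAt.comp θ₀ (hd d.1 d.2.1 θ₀ (mem_of_mem_nhds hU)).hasFDerivAt
  have h : inner ℝ (fderiv ℝ (score ℓ d.1 d.2.1) θ₀ (EuclideanSpace.single j 1))
      (EuclideanSpace.single i (1 : ℝ)) =
      inner ℝ (fderiv ℝ (score ℓ d.1 d.2.1) θ₀ (EuclideanSpace.single i 1))
      (EuclideanSpace.single j (1 : ℝ)) :=
    second_derivative_symmetric_of_eventually_of_real hf hx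
      (EuclideanSpace.single j 1) (EuclideanSpace.single i 1)
  simpa [EuclideanSpace.inner_single_right] using h

/-- The mean derivative of the score as a continuous linear equivalence. -/
noncomputable def hessianEquiv (H : Matrix (Fin p) (Fin p) ℝ) (hH : IsUnit H.det) :
    Par p ≃L[ℝ] Par p :=
  ContinuousLinearEquiv.equivOfInverse (Matrix.toEuclideanCLM (𝕜 := ℝ) H)
    (Matrix.toEuclideanCLM (𝕜 := ℝ) H⁻¹)
    (fun v => by
      rw [← mul_apply_eq_comp, ← map_mul, Matrix.nonsing_inv_mul _ hH, map_one]; rfl)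
    (fun v => by
      rw [← mul_apply_eq_comp, ← map_mul, Matrix.mul_nonsing_inv _ hH, map_one]; rfl)

lemma neg_hessianEquiv_symm_apply {H : Matrix (Fin p) (Fin p) ℝ} (hH : IsUnit H.det)
    (v : Par p) : -(hessianEquiv H hH).symm v = negHessInv H v :=
  rfl

/-- The entries of `hessian` are indexed as the transpose of the Jacobian, so the identification
rests on symmetry. -/
lemma Regularity.meanDeriv_eq (hreg : Regularity ℓ μ Θ θ₀) :
    meanDeriv ℓ μ selTrue θ₀ = hessianEquiv (hessian ℓ μ θ₀) hreg.hessian_nonsing := by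
  ext v j
  have h1 : meanDeriv ℓ μ selTrue θ₀ v = ∑ i, v i •
      meanDeriv ℓ μ selTrue θ₀ (EuclideanSpace.single i 1) := by
    conv_lhs => rw [← (EuclideanSpace.basisFun (Fin p) ℝ).sum_repr v]
    simp
  have h2 : (hessianEquiv (hessian ℓ μ θ₀) hreg.hessian_nonsing v) j =
      ((hessian ℓ μ θ₀) *ᵥ v) j := rfl
  rw [h1]
  simp only [WithLp.ofLp_sum, Finset.sum_apply, PiLp.smul_apply, smul_eq_mul,
    ← hreg.hessian_apply]
  change _ = (hessianEquiv (hessian ℓ μ θ₀) hreg.hessian_nonsing v) j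
  rw [h2]
  refine Finset.sum_congr rfl fun i _ => ?_
  rw [mul_comm]
  exact congrArg (· * v i) (congr_fun (congr_fun hreg.isSymm_hessian j) i)

end ScoreMeans

/-! ### The weight matrix as a linear map. -/

section WeightMap

variable {p K : ℕ}

/-- The map `v ↦ Wᵀ v`, linear in the weight matrix `W`. -/
noncomputable def weightMap : Matrix (Fin K × Fin p) (Fin p) ℝ →ₗ[ℝ]
    (Fin K × Fin p → ℝ) →L[ℝ] Par p where
  toFun W := LinearMap.toContinuousLinearMap
    ((WithLp.linearEquiv 2 ℝ (Fin p → ℝ)).symm.toLinearMap ∘ₗ Wᵀ.mulVecLin)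
  map_add' W W' := by
    ext v
    simp
  map_smul' c W := by
    ext v
    simp

lemma weightMap_apply (W : Matrix (Fin K × Fin p) (Fin p) ℝ) (v : Fin K × Fin p → ℝ) :
    weightMap W v = WithLp.toLp 2 (Wᵀ *ᵥ v) :=
  rfl

lemma tendsto_weightMap {B : ℕ → Matrix (Fin K × Fin p) (Fin p) ℝ}
    {A : Matrix (Fin K × Fin p) (Fin p) ℝ}
    (h : ∀ a b, Tendsto (fun m => B m a b) atTop (𝓝 (A a b))) :
    Tendsto (fun m => weightMap (B m)) atTop (𝓝 (weightMap A)) := by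
  have hc : Continuous (weightMap (p := p) (K := K)) :=
    LinearMap.continuous_of_finiteDimensional _
  exact (hc.tendsto A).comp (tendsto_pi_nhds.2 fun a => tendsto_pi_nhds.2 fun b => h a b)

end WeightMap

/-! ### Limit theorems for the stacked score. -/

section StackedScore

variable {𝒳 𝒴 : Type*} {p K : ℕ} {ℓ : 𝒳 → 𝒴 → Par p → ℝ} {z : ℕ → Obs 𝒳 𝒴 K}

lemma sampleMean_stackedScore_apply (n : ℕ) (θ : Par p) (a : Fin K × Fin p) :
    sampleMean z n (stackedScore ℓ θ) a = sampleMean z n (scorePred ℓ a.1 θ) a.2 := by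
  simp [sampleMean, stackedScore]

variable [MeasurableSpace 𝒳] [MeasurableSpace 𝒴] {μ : Measure (Obs 𝒳 𝒴 K)} {Θ : Set (Par p)}
  {θ₀ : Par p}

lemma tendstoUniformlyOn_stackedScore (h : ∀ k, ScoreLLN z ℓ μ Θ θ₀ (selPred k)) :
    TendstoUniformlyOn (fun n θ => sampleMean z n (stackedScore ℓ θ))
      (fun θ a => (∫ d, scorePred ℓ a.1 θ d ∂μ) a.2) atTop Θ := by
  rw [Metric.tendstoUniformlyOn_iff]
  intro ε hε
  have h1 := eventually_all.2 fun k => Metric.tendstoUniformlyOn_iff.1 (h k).1 ε hε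
  filter_upwards [h1] with n hn θ hθ
  rw [dist_pi_lt_iff hε]
  intro a
  rw [sampleMean_stackedScore_apply]
  refine lt_of_le_of_lt ?_ (hn a.1 θ hθ)
  rw [dist_eq_norm, dist_eq_norm]
  exact PiLp.norm_apply_le (∫ d, scorePred ℓ a.1 θ d ∂μ - sampleMean z n (scorePred ℓ a.1 θ)) a.2

/-- The mean derivative of the stacked score. -/
noncomputable def stackedDeriv (ℓ : 𝒳 → 𝒴 → Par p → ℝ) (μ : Measure (Obs 𝒳 𝒴 K))
    (θ : Par p) : Par p →L[ℝ] (Fin K × Fin p → ℝ) :=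
  ContinuousLinearMap.pi fun a =>
    (EuclideanSpace.proj a.2 : Par p →L[ℝ] ℝ) ∘L meanDeriv ℓ μ (selPred a.1) θ

lemma stackedScore_almost_linear (h : ∀ k, ScoreLLN z ℓ μ Θ θ₀ (selPred k)) :
    ∀ ε > 0, ∃ δ > 0, ∀ᶠ n in atTop, ∀ x, dist x θ₀ < δ →
      ‖sampleMean z n (stackedScore ℓ x) - sampleMean z n (stackedScore ℓ θ₀) -
        stackedDeriv ℓ μ θ₀ (x - θ₀)‖ ≤ ε * ‖x - θ₀‖ := by
  intro ε hε
  choose δ hδ hlin using fun k => (h k).2 ε hε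
  -- A common radius for all labels, taken from a right neighbourhood of zero because a minimum over
  -- `k` does not exist when `K = 0`.
  have h1 : ∀ᶠ r in 𝓝[>] (0 : ℝ), ∀ k, r ≤ δ k := eventually_all.2 fun k => by
    filter_upwards [Ioc_mem_nhdsGT (hδ k)] with r hr using hr.2
  obtain ⟨r, hr, hr0⟩ := (h1.and self_mem_nhdsWithin).exists
  refine ⟨r, hr0, (eventually_all.2 hlin).mono fun n hn x hx => ?_⟩
  rw [pi_norm_le_iff_of_nonneg (by positivity)]
  intro a
  refine le_trans ?_ (hn a.1 x (hx.trans_le (hr a.1)))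
  rw [Pi.sub_apply, Pi.sub_apply, sampleMean_stackedScore_apply, sampleMean_stackedScore_apply]
  exact PiLp.norm_apply_le (sampleMean z n (scorePred ℓ a.1 x) -
    sampleMean z n (scorePred ℓ a.1 θ₀) - meanDeriv ℓ μ (selPred a.1) θ₀ (x - θ₀)) a.2

end StackedScore

/-! ### The `n^{-1/2}` bound in `L¹`. -/

section LinearStatisticBound

variable {D Ω : Type*} [MeasurableSpace D] [MeasurableSpace Ω] {μ : Measure D} {P : Measure Ω}
  [IsProbabilityMeasure μ] [IsProbabilityMeasure P] {Z : ℕ → Ω → D} {p : ℕ}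
  {h₁ h₂ : D → Par p}

/-- `n E‖T‖²` is the trace of `mixedMoment` at `n/N`, a continuous function on `[0, 1]`, so one
constant serves all `n ≤ N`. The inequality `x ≤ 1 + x²` passes from second to first moments. -/
lemma exists_integral_norm_linearStatistic_le (hlaw : ∀ i, HasLaw (Z i) μ P)
    (hindep : iIndepFun Z P)
    (hm₁ : Measurable h₁) (hm₂ : Measurable h₂) (hL₁ : MemLp h₁ 2 μ) (hL₂ : MemLp h₂ 2 μ)
    (h0₁ : ∫ d, h₁ d ∂μ = 0) (h0₂ : ∫ d, h₂ d ∂μ = 0) :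
    ∃ C : ℝ, ∀ n N : ℕ, 0 < n → n ≤ N →
      √n * ∫ ω, ‖sampleMean (fun i => Z i ω) n h₁ + sampleMean (fun i => Z i ω) N h₂‖ ∂P ≤ C := by
  have hcont : ContinuousOn (fun r => ∑ i, mixedMoment μ h₁ h₂ r i i) (Set.Icc 0 1) :=
    (continuous_finsetSum _ fun i _ => continuous_mixedMoment_apply i i).continuousOn
  obtain ⟨C, hC⟩ := isCompact_Icc.exists_bound_of_continuousOn hcont
  refine ⟨1 + C, fun n N hn hnN => ?_⟩
  set T : Ω → Par p := fun ω => sampleMean (fun i => Z i ω) n h₁ + sampleMean (fun i => Z i ω) N h₂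
    with hT
  have hTL : MemLp T 2 P := (memLp_sampleMean hlaw hL₁ n).add (memLp_sampleMean hlaw hL₂ N)
  have hn0 : (0 : ℝ) < n := by exact_mod_cast hn
  have hsq : ∫ ω, ‖T ω‖ ^ 2 ∂P = (n : ℝ)⁻¹ * ∑ i, mixedMoment μ h₁ h₂ (n / N) i i := by
    simp_rw [EuclideanSpace.norm_sq_eq, Real.norm_eq_abs, sq_abs]
    rw [integral_finsetSum _ fun i _ => (memLp_coord hTL i).integrable_sq, Finset.mul_sum]
    refine Finset.sum_congr rfl fun i _ => ?_
    have h := congr_fun (congr_fun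
      (crossMoment_linearStatistic hlaw hindep hm₁ hm₂ hL₁ hL₂ h0₁ h0₂ hn hnN) i) i
    simp only [crossMoment, Matrix.of_apply, Matrix.smul_apply, smul_eq_mul] at h
    rw [← h]
    exact integral_congr_ae (ae_of_all _ fun ω => sq _)
  have hbd := (Real.norm_eq_abs _ ▸ hC _ (div_mem_Icc_of_le hnN) : |_| ≤ C)
  have h1 : ∀ ω, √n * ‖T ω‖ ≤ 1 + n * ‖T ω‖ ^ 2 := fun ω => by
    have e : (√(n : ℝ) * ‖T ω‖) ^ 2 = n * ‖T ω‖ ^ 2 := by rw [mul_pow, Real.sq_sqrt hn0.le]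
    nlinarith [sq_nonneg (√(n : ℝ) * ‖T ω‖ - 1)]
  calc √n * ∫ ω, ‖T ω‖ ∂P = ∫ ω, √n * ‖T ω‖ ∂P := (integral_const_mul _ _).symm
    _ ≤ ∫ ω, (1 + n * ‖T ω‖ ^ 2) ∂P :=
        integral_mono ((hTL.integrable one_le_two).norm.const_mul _)
          ((integrable_const _).add ((hTL.integrable_norm_pow two_ne_zero).const_mul _)) h1
    _ = 1 + n * ((n : ℝ)⁻¹ * ∑ i, mixedMoment μ h₁ h₂ (n / N) i i) := by
        rw [integral_add (integrable_const _) ((hTL.integrable_norm_pow two_ne_zero).const_mul _),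
          integral_const_mul, hsq]
        simp
    _ = 1 + ∑ i, mixedMoment μ h₁ h₂ (n / N) i i := by field_simp
    _ ≤ 1 + C := by linarith [(abs_le.1 hbd).2]

end LinearStatisticBound

/-! ### Further rules for convergence in probability. -/

section InProbability

variable {Ω : Type*} [MeasurableSpace Ω] {P : Measure Ω}

lemma tendstoInMeasure_finsetSum {ι E : Type*} [NormedAddCommGroup E] (s : Finset ι)
    {X : ι → ℕ → Ω → E} (h : ∀ i ∈ s, TendstoInMeasure P (X i) atTop fun _ => 0) :
    TendstoInMeasure P (fun m ω => ∑ i ∈ s, X i m ω) atTop fun _ => 0 := by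
  classical
  induction s using Finset.induction_on with
  | empty =>
    rw [tendstoInMeasure_iff_norm]
    intro ε hε
    simp [not_le.2 hε]
  | insert j t hj ih =>
    simp_rw [Finset.sum_insert hj]
    exact TendstoInMeasure.add_of_norm (h j (Finset.mem_insert_self j t))
      (ih fun i hi => h i (Finset.mem_insert_of_mem hi))

lemma tendstoInMeasure_indicator {s : ℕ → Set Ω} (h : Tendsto (fun m => P (s m)) atTop (𝓝 0)) :
    TendstoInMeasure P (fun m => (s m).indicator fun _ => (1 : ℝ)) atTop fun _ => 0 := by
  rw [tendstoInMeasure_iff_norm]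
  intro ε hε
  refine tendsto_of_tendsto_of_tendsto_of_le_of_le tendsto_const_nhds h (fun _ => zero_le)
    fun m => measure_mono fun ω hω => ?_
  by_contra hcon
  simp only [Set.mem_ofPred_eq, Set.indicator_of_notMem hcon, sub_zero, norm_zero] at hω
  linarith

lemma TendstoInMeasure.norm_zero {E : Type*} [NormedAddCommGroup E] {X : ℕ → Ω → E}
    (h : TendstoInMeasure P X atTop fun _ => 0) :
    TendstoInMeasure P (fun m ω => ‖X m ω‖) atTop fun _ => 0 := by
  rw [tendstoInMeasure_iff_norm] at h ⊢
  simpa using h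

end InProbability

/-! ### Asymptotic linearity of the estimators. -/

section AsymptoticExpansion

variable {𝒳 𝒴 Ω : Type*} [MeasurableSpace 𝒳] [MeasurableSpace 𝒴] [MeasurableSpace Ω] {p K : ℕ}
  {ℓ : 𝒳 → 𝒴 → Par p → ℝ} {μ : Measure (Obs 𝒳 𝒴 K)} {Θ : Set (Par p)} {θ₀ : Par p}
  {P : Measure Ω} {Z : ℕ → Ω → Obs 𝒳 𝒴 K}

/-- The estimating function with the weight `B` applied to the difference of the stacked score
means over the first `N` and the first `n` units. -/
noncomputable def contrastEE (ℓ : 𝒳 → 𝒴 → Par p → ℝ) (z : ℕ → Obs 𝒳 𝒴 K) (n N : ℕ)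
    (B : Matrix (Fin K × Fin p) (Fin p) ℝ) (θ : Par p) : Par p :=
  sampleMean z n (scoreTrue ℓ θ) +
    weightMap B (sampleMean z N (stackedScore ℓ θ) - sampleMean z n (stackedScore ℓ θ))

lemma Regularity.measurable_score (hreg : Regularity ℓ μ Θ θ₀) :
    Measurable fun z : 𝒳 × 𝒴 => score ℓ z.1 z.2 θ₀ := by
  obtain ⟨O, hO, -, hΘO, -, -, hmeas, -⟩ := hreg.convex_loss
  exact hmeas θ₀ (hΘO (interior_subset hreg.mem_interior))

lemma Regularity.measurable_scoreTrue (hreg : Regularity ℓ μ Θ θ₀) :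
    Measurable (scoreTrue (K := K) ℓ θ₀) :=
  hreg.measurable_score.comp measurable_selTrue

lemma Regularity.measurable_scorePred (hreg : Regularity ℓ μ Θ θ₀) (k : Fin K) :
    Measurable (scorePred ℓ k θ₀) :=
  hreg.measurable_score.comp (measurable_selPred k)

lemma Regularity.memLp_scoreTrue (hreg : Regularity ℓ μ Θ θ₀) :
    MemLp (scoreTrue ℓ θ₀) 2 μ := by
  obtain ⟨U, hU, -, ⟨C, hC⟩, -⟩ := hreg.local_smooth
  exact (hC θ₀ (mem_of_mem_nhds hU)).1.1

lemma Regularity.memLp_scorePred (hreg : Regularity ℓ μ Θ θ₀) (k : Fin K) :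
    MemLp (scorePred ℓ k θ₀) 2 μ := by
  obtain ⟨U, hU, -, ⟨C, hC⟩, -⟩ := hreg.local_smooth
  exact ((hC θ₀ (mem_of_mem_nhds hU)).2 k).1

lemma memLp_sampleMean_stackedScore (hreg : Regularity ℓ μ Θ θ₀) (hlaw : ∀ i, HasLaw (Z i) μ P)
    (n : ℕ) : MemLp (fun ω => sampleMean (fun i => Z i ω) n (stackedScore ℓ θ₀)) 2 P := by
  rw [memLp_pi_iff]
  intro a
  simp_rw [sampleMean_stackedScore_apply]
  exact memLp_coord (memLp_sampleMean hlaw (hreg.memLp_scorePred a.1) n) a.2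

lemma memLp_contrastEE (hreg : Regularity ℓ μ Θ θ₀) (hlaw : ∀ i, HasLaw (Z i) μ P)
    (n N : ℕ) (A : Matrix (Fin K × Fin p) (Fin p) ℝ) :
    MemLp (fun ω => contrastEE ℓ (fun i => Z i ω) n N A θ₀) 2 P :=
  (memLp_sampleMean hlaw hreg.memLp_scoreTrue n).add
    ((weightMap A).comp_memLp' ((memLp_sampleMean_stackedScore hreg hlaw N).sub
      (memLp_sampleMean_stackedScore hreg hlaw n)))

end AsymptoticExpansion

section

variable {𝒳 𝒴 : Type*} {p K : ℕ} {ℓ : 𝒳 → 𝒴 → Par p → ℝ} {θ₀ : Par p}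

lemma sampleMean_const {D F : Type*} [AddCommGroup F] [Module ℝ F] {z : ℕ → D} {n : ℕ}
    (hn : 0 < n) (c : F) : sampleMean z n (fun _ => c) = c := by
  have : (n : ℝ) ≠ 0 := by exact_mod_cast hn.ne'
  simp only [sampleMean, Finset.sum_const, Finset.card_range]
  rw [← Nat.cast_smul_eq_nsmul ℝ, smul_smul, inv_mul_cancel₀ this, one_smul]

lemma norm_stackedContrast_le {z : ℕ → Obs 𝒳 𝒴 K} (n N : ℕ) (θ : Par p) :
    ‖sampleMean z N (stackedScore ℓ θ) - sampleMean z n (stackedScore ℓ θ)‖ ≤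
      ∑ k, ‖sampleMean z N (scorePred ℓ k θ) - sampleMean z n (scorePred ℓ k θ)‖ := by
  rw [pi_norm_le_iff_of_nonneg (by positivity)]
  intro a
  rw [Pi.sub_apply, sampleMean_stackedScore_apply, sampleMean_stackedScore_apply]
  refine (PiLp.norm_apply_le (sampleMean z N (scorePred ℓ a.1 θ) -
    sampleMean z n (scorePred ℓ a.1 θ)) a.2).trans ?_
  exact Finset.single_le_sum (f := fun k => ‖sampleMean z N (scorePred ℓ k θ) -
    sampleMean z n (scorePred ℓ k θ)‖) (fun k _ => norm_nonneg _) (Finset.mem_univ a.1)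

end

section AsymptoticExpansion

variable {𝒳 𝒴 Ω : Type*} [MeasurableSpace 𝒳] [MeasurableSpace 𝒴] [MeasurableSpace Ω] {p K : ℕ}
  {ℓ : 𝒳 → 𝒴 → Par p → ℝ} {μ : Measure (Obs 𝒳 𝒴 K)} {Θ : Set (Par p)} {θ₀ : Par p}
  {P : Measure Ω} {Z : ℕ → Ω → Obs 𝒳 𝒴 K}

lemma memLp_negHessInv {f : Ω → Par p} (H : Matrix (Fin p) (Fin p) ℝ) (hf : MemLp f 2 P) :
    MemLp (fun ω => negHessInv H (f ω)) 2 P :=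
  (-(Matrix.toEuclideanCLM (𝕜 := ℝ) H⁻¹ : Par p →L[ℝ] Par p)).comp_memLp' hf

lemma eventually_norm_zEstimator_sub_le (hreg : Regularity ℓ μ Θ θ₀) {z : ℕ → Obs 𝒳 𝒴 K}
    (hT : ScoreLLN z ℓ μ Θ θ₀ selTrue) (hP : ∀ k, ScoreLLN z ℓ μ Θ θ₀ (selPred k))
    {n N : ℕ → ℕ} (hn : Tendsto n atTop atTop) (hN : Tendsto N atTop atTop)
    {B : ℕ → Matrix (Fin K × Fin p) (Fin p) ℝ} {A : Matrix (Fin K × Fin p) (Fin p) ℝ}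
    (hB : ∀ a b, Tendsto (fun m => B m a b) atTop (𝓝 (A a b))) {θ : ℕ → Par p}
    (hθ : ∀ᶠ m in atTop, θ m ∈ Θ ∧ contrastEE ℓ z (n m) (N m) (B m) (θ m) = 0)
    {ε : ℝ} (hε : 0 < ε) :
    ∀ᶠ m in atTop,
      ‖θ m - θ₀ - negHessInv (hessian ℓ μ θ₀) (contrastEE ℓ z (n m) (N m) A θ₀)‖ ≤
        ε * (‖negHessInv (hessian ℓ μ θ₀) (contrastEE ℓ z (n m) (N m) A θ₀)‖ +
          ‖sampleMean z (N m) (stackedScore ℓ θ₀) - sampleMean z (n m) (stackedScore ℓ θ₀)‖) := by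
  have hsl := hT.2
  rw [hreg.meanDeriv_eq] at hsl
  exact zEstimator_expansion hreg.compact (θ₀ := θ₀)
      (s := fun n θ => sampleMean z n (scoreTrue ℓ θ))
      (S := fun n θ => sampleMean z n (stackedScore ℓ θ))
      (sLim := fun θ => ∫ d, scoreTrue ℓ θ d ∂μ)
      hT.1 (tendstoUniformlyOn_stackedScore hP) hreg.continuousOn_meanScore
      hreg.identifiable (J := hessianEquiv (hessian ℓ μ θ₀) hreg.hessian_nonsing)
      (J' := stackedDeriv ℓ μ θ₀) hsl
      (stackedScore_almost_linear hP) hn hN (tendsto_weightMap hB) hθ hε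

variable [IsProbabilityMeasure μ] [IsProbabilityMeasure P]

/-- The mean of `h` need not vanish: a constant cancels in the difference of two sample means, so
`h` may be centred. -/
lemma exists_integral_norm_contrast_le (hlaw : ∀ i, HasLaw (Z i) μ P) (hindep : iIndepFun Z P)
    {h : Obs 𝒳 𝒴 K → Par p} (hm : Measurable h) (hL : MemLp h 2 μ) :
    ∃ C : ℝ, ∀ n N : ℕ, 0 < n → n ≤ N →
      √n * ∫ ω, ‖sampleMean (fun i => Z i ω) N h - sampleMean (fun i => Z i ω) n h‖ ∂P ≤ C := by
  have hi := hL.integrable one_le_two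
  set e := ∫ d, h d ∂μ with he
  obtain ⟨C, hC⟩ := exists_integral_norm_linearStatistic_le hlaw hindep
    (h₁ := fun d => e - h d) (h₂ := fun d => h d - e) (measurable_const.sub hm)
    (hm.sub measurable_const) ((memLp_const e).sub hL) (hL.sub (memLp_const e))
    (by rw [integral_sub (integrable_const _) hi]; simp [he])
    (by rw [integral_sub hi (integrable_const _)]; simp [he])
  refine ⟨C, fun n N hn hnN => (le_of_eq ?_).trans (hC n N hn hnN)⟩
  congr 2
  funext ω
  rw [sampleMean_sub, sampleMean_sub, sampleMean_const hn, sampleMean_const (hn.trans_le hnN)]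
  congr 1
  abel

/-- The integrand is the quantity against which `zEstimator_expansion` measures the remainder. -/
lemma exists_lintegral_leadingTerm_le (hreg : Regularity ℓ μ Θ θ₀)
    (hlaw : ∀ i, HasLaw (Z i) μ P) (hindep : iIndepFun Z P)
    (A : Matrix (Fin K × Fin p) (Fin p) ℝ) :
    ∃ C : ℝ, ∀ n N : ℕ, 0 < n → n ≤ N →
      √n * ∫ ω, (‖negHessInv (hessian ℓ μ θ₀) (contrastEE ℓ (fun i => Z i ω) n N A θ₀)‖ +
        ‖sampleMean (fun i => Z i ω) N (stackedScore ℓ θ₀) -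
          sampleMean (fun i => Z i ω) n (stackedScore ℓ θ₀)‖) ∂P ≤ C := by
  set J := hessianEquiv (hessian ℓ μ θ₀) hreg.hessian_nonsing with hJ
  set c : ℝ := ‖(J.symm : Par p →L[ℝ] Par p)‖ with hc
  set a : ℝ := ‖weightMap A‖ with ha
  obtain ⟨C₁, hC₁⟩ := exists_integral_norm_linearStatistic_le hlaw hindep
    (h₁ := scoreTrue ℓ θ₀) (h₂ := fun _ => 0) hreg.measurable_scoreTrue measurable_const
    hreg.memLp_scoreTrue MemLp.zero' hreg.solves (by simp)
  choose C₂ hC₂ using fun k : Fin K => exists_integral_norm_contrast_le hlaw hindep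
    (hreg.measurable_scorePred k) (hreg.memLp_scorePred k)
  refine ⟨c * C₁ + (c * a + 1) * ∑ k, C₂ k, fun n N hn hnN => ?_⟩
  have hs := memLp_sampleMean hlaw hreg.memLp_scoreTrue n
  have hk : ∀ k, MemLp (fun ω => sampleMean (fun i => Z i ω) N (scorePred ℓ k θ₀) -
      sampleMean (fun i => Z i ω) n (scorePred ℓ k θ₀)) 2 P := fun k =>
    (memLp_sampleMean hlaw (hreg.memLp_scorePred k) N).sub
      (memLp_sampleMean hlaw (hreg.memLp_scorePred k) n)
  have hpt : ∀ ω, ‖negHessInv (hessian ℓ μ θ₀) (contrastEE ℓ (fun i => Z i ω) n N A θ₀)‖ +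
      ‖sampleMean (fun i => Z i ω) N (stackedScore ℓ θ₀) -
        sampleMean (fun i => Z i ω) n (stackedScore ℓ θ₀)‖ ≤
      c * ‖sampleMean (fun i => Z i ω) n (scoreTrue ℓ θ₀)‖ +
      (c * a + 1) * ∑ k, ‖sampleMean (fun i => Z i ω) N (scorePred ℓ k θ₀) -
        sampleMean (fun i => Z i ω) n (scorePred ℓ k θ₀)‖ := by
    intro ω
    have h1 := norm_stackedContrast_le (ℓ := ℓ) (z := fun i => Z i ω) n N θ₀
    set Dω := sampleMean (fun i => Z i ω) N (stackedScore ℓ θ₀) -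
        sampleMean (fun i => Z i ω) n (stackedScore ℓ θ₀) with hD
    have h2 : ‖negHessInv (hessian ℓ μ θ₀) (contrastEE ℓ (fun i => Z i ω) n N A θ₀)‖ ≤
        c * (‖sampleMean (fun i => Z i ω) n (scoreTrue ℓ θ₀)‖ + a * ‖Dω‖) := by
      rw [← neg_hessianEquiv_symm_apply hreg.hessian_nonsing, norm_neg]
      refine ((J.symm : Par p →L[ℝ] Par p).le_opNorm _).trans ?_
      gcongr
      exact (norm_add_le _ _).trans (by gcongr; exact ContinuousLinearMap.le_opNorm _ _)
    have h3 : 0 ≤ c * a + 1 := by positivity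
    nlinarith [mul_le_mul_of_nonneg_left h1 h3]
  have hi1 : Integrable (fun ω => c * ‖sampleMean (fun i => Z i ω) n (scoreTrue ℓ θ₀)‖) P :=
    (hs.integrable one_le_two).norm.const_mul c
  have hi2 : Integrable (fun ω => (c * a + 1) * ∑ k,
      ‖sampleMean (fun i => Z i ω) N (scorePred ℓ k θ₀) -
        sampleMean (fun i => Z i ω) n (scorePred ℓ k θ₀)‖) P :=
    (integrable_finsetSum _ fun k _ => ((hk k).integrable one_le_two).norm).const_mul _
  have hint : ∫ ω, (‖negHessInv (hessian ℓ μ θ₀) (contrastEE ℓ (fun i => Z i ω) n N A θ₀)‖ +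
      ‖sampleMean (fun i => Z i ω) N (stackedScore ℓ θ₀) -
        sampleMean (fun i => Z i ω) n (stackedScore ℓ θ₀)‖) ∂P ≤
      c * ∫ ω, ‖sampleMean (fun i => Z i ω) n (scoreTrue ℓ θ₀)‖ ∂P +
      (c * a + 1) * ∑ k, ∫ ω, ‖sampleMean (fun i => Z i ω) N (scorePred ℓ k θ₀) -
        sampleMean (fun i => Z i ω) n (scorePred ℓ k θ₀)‖ ∂P := by
    refine (integral_mono_of_nonneg (ae_of_all _ fun ω => by positivity) (hi1.add hi2)
      (ae_of_all _ hpt)).trans (le_of_eq ?_)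
    simp only [Pi.add_apply]
    rw [integral_add hi1 hi2, integral_const_mul, integral_const_mul, integral_finsetSum]
    exact fun k _ => ((hk k).integrable one_le_two).norm
  have e1 := hC₁ n N hn hnN
  have e0 : ∀ z : ℕ → Obs 𝒳 𝒴 K, sampleMean z N (fun _ => (0 : Par p)) = 0 := fun z => by
    simp [sampleMean]
  simp only [e0, add_zero] at e1
  calc _ ≤ √n * _ := mul_le_mul_of_nonneg_left hint (Real.sqrt_nonneg _)
    _ = c * (√n * ∫ ω, ‖sampleMean (fun i => Z i ω) n (scoreTrue ℓ θ₀)‖ ∂P) +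
      (c * a + 1) * ∑ k, √n * ∫ ω, ‖sampleMean (fun i => Z i ω) N (scorePred ℓ k θ₀) -
        sampleMean (fun i => Z i ω) n (scorePred ℓ k θ₀)‖ ∂P := by
        rw [← Finset.mul_sum]; ring
    _ ≤ _ := by
        gcongr with k
        exact hC₂ k n N hn hnN

/-- The bridge from paths to probability. Every subsequence has a further one along which `κ → 0`
almost surely, so the ratio of `‖R‖` to (essentially) `Q` tends to zero in measure; `√n Q` is
bounded in `L¹`. The subsequence is quantified inside the almost sure event because it is extracted
only later. -/
lemma tendstoInMeasure_sqrt_smul_of_subseq_le {E : Type*} [NormedAddCommGroup E]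
    [NormedSpace ℝ E] [MeasurableSpace E] [BorelSpace E] [SecondCountableTopology E]
    {n : ℕ → ℕ} {R : ℕ → Ω → E} (hR : ∀ m, AEMeasurable (R m) P)
    {Q : ℕ → Ω → ℝ} (hQ0 : ∀ m ω, 0 ≤ Q m ω) (hQi : ∀ m, Integrable (Q m) P) {C : ℝ}
    (hQC : ∀ᶠ m in atTop, √(n m) * ∫ ω, Q m ω ∂P ≤ C)
    {κ : ℕ → Ω → ℝ} (hκ : TendstoInMeasure P κ atTop fun _ => 0)
    (h : ∀ᵐ ω ∂P, ∀ ns : ℕ → ℕ, Tendsto ns atTop atTop →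
      Tendsto (fun i => κ (ns i) ω) atTop (𝓝 0) →
      ∀ ε > 0, ∀ᶠ i in atTop, ‖R (ns i) ω‖ ≤ ε * Q (ns i) ω) :
    TendstoInMeasure P (fun m ω => √(n m) • R m ω) atTop fun _ => 0 := by
  -- The added term keeps the denominator positive where `Q` vanishes; after scaling by `√n` it
  -- costs at most one.
  set G : ℕ → Ω → ℝ := fun m ω => Q m ω + 1 / ((n m : ℝ) + 1) with hG
  have hGpos : ∀ m ω, 0 < G m ω := fun m ω => add_pos_of_nonneg_of_pos (hQ0 m ω) (by positivity)
  have hGi : ∀ m, Integrable (G m) P := fun m => (hQi m).add (integrable_const _)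
  have hratio : TendstoInMeasure P (fun m ω => ‖R m ω‖ / G m ω) atTop fun _ => 0 := by
    have hmeas : ∀ m, AEStronglyMeasurable (fun ω => ‖R m ω‖ / G m ω) P := fun m =>
      ((hR m).norm.div (hGi m).aestronglyMeasurable.aemeasurable).aestronglyMeasurable
    rw [exists_seq_tendstoInMeasure_atTop_iff hmeas]
    intro ns hns
    obtain ⟨ms, hms, hlim⟩ := (hκ.comp hns.tendsto_atTop).exists_seq_tendsto_ae
    refine ⟨ms, hms, ?_⟩
    filter_upwards [hlim, h] with ω hω hb
    rw [Metric.tendsto_nhds]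
    intro ε hε
    filter_upwards [hb (fun i => ns (ms i)) (hns.tendsto_atTop.comp hms.tendsto_atTop) hω (ε / 2)
      (half_pos hε)] with i hi
    rw [Real.dist_eq, sub_zero, abs_of_nonneg (div_nonneg (norm_nonneg _) (hGpos _ _).le)]
    refine lt_of_le_of_lt (div_le_of_le_mul₀ (hGpos _ _).le (half_pos hε).le ?_) (half_lt_self hε)
    refine hi.trans (mul_le_mul_of_nonneg_left ?_ (half_pos hε).le)
    exact le_add_of_nonneg_right (by positivity)
  have hprod := tendstoInMeasure_mul_of_lintegral_le hratio
    (Y := fun m ω => √(n m) * G m ω)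
    (fun m => (hGi m).aestronglyMeasurable.aemeasurable.const_mul _)
    (C := ENNReal.ofReal (C + 1)) ENNReal.ofReal_ne_top (by
      filter_upwards [hQC] with m hm
      have h1 : ∫⁻ ω, ‖√(n m : ℝ) * G m ω‖ₑ ∂P = ENNReal.ofReal (∫ ω, √(n m : ℝ) * G m ω ∂P) := by
        rw [ofReal_integral_eq_lintegral_ofReal ((hGi m).const_mul _)
          (ae_of_all _ fun ω => mul_nonneg (Real.sqrt_nonneg _) (hGpos m ω).le)]
        refine lintegral_congr fun ω => ?_
        rw [← ofReal_norm, Real.norm_of_nonneg (mul_nonneg (Real.sqrt_nonneg _) (hGpos m ω).le)]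
      rw [h1]
      refine ENNReal.ofReal_le_ofReal ?_
      have h2 : √(n m : ℝ) * (1 / ((n m : ℝ) + 1)) ≤ 1 := by
        rw [mul_one_div, div_le_one (by positivity)]
        have := Real.sq_sqrt (Nat.cast_nonneg (α := ℝ) (n m))
        nlinarith [sq_nonneg (√(n m : ℝ) - 1)]
      have h3 : ∫ ω, G m ω ∂P = ∫ ω, Q m ω ∂P + 1 / ((n m : ℝ) + 1) := by
        simp only [hG]
        rw [integral_add (hQi m) (integrable_const _)]
        simp
      rw [integral_const_mul, h3, mul_add]
      exact add_le_add hm h2)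
  rw [tendstoInMeasure_iff_norm] at hprod ⊢
  refine fun ε hε => (hprod ε hε).congr fun m => ?_
  congr 1
  ext ω
  simp only [sub_zero, Set.mem_ofPred_eq]
  rw [show ‖R m ω‖ / G m ω * (√(n m) * G m ω) = √(n m) * ‖R m ω‖ by
    field_simp [(hGpos m ω).ne'], norm_smul, norm_mul, norm_norm]

/-- Solutions of the weighted estimating equation are asymptotically linear. -/
theorem tendstoInMeasure_zEstimator_sub_linear (hreg : Regularity ℓ μ Θ θ₀)
    (hlaw : ∀ i, HasLaw (Z i) μ P) (hindep : iIndepFun Z P) {n N : ℕ → ℕ}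
    (hn : Tendsto n atTop atTop) (hnN : ∀ m, n m ≤ N m)
    {B : ℕ → Ω → Matrix (Fin K × Fin p) (Fin p) ℝ} {A : Matrix (Fin K × Fin p) (Fin p) ℝ}
    (hB : ∀ a b, TendstoInMeasure P (fun m ω => B m ω a b - A a b) atTop fun _ => 0)
    {θhat : ℕ → Ω → Par p} (hest : IsZEstimator P Θ
      (fun m ω => contrastEE ℓ (fun i => Z i ω) (n m) (N m) (B m ω)) θhat) :
    TendstoInMeasure P (fun m ω => √(n m) • (θhat m ω - θ₀ -
      negHessInv (hessian ℓ μ θ₀) (contrastEE ℓ (fun i => Z i ω) (n m) (N m) A θ₀)))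
      atTop fun _ => 0 := by
  have hTL := fun m => memLp_negHessInv (hessian ℓ μ θ₀)
    (memLp_contrastEE hreg hlaw (n m) (N m) A)
  have hDL : ∀ m, MemLp _ 2 P := fun m =>
    (memLp_sampleMean_stackedScore hreg hlaw (N m)).sub
      (memLp_sampleMean_stackedScore hreg hlaw (n m))
  obtain ⟨C, hC⟩ := exists_lintegral_leadingTerm_le hreg hlaw hindep A
  set bad : ℕ → Set Ω := fun m => {ω | ¬ (θhat m ω ∈ Θ ∧
    contrastEE ℓ (fun i => Z i ω) (n m) (N m) (B m ω) (θhat m ω) = 0)} with hbad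
  -- One control variable for both random failures. When it tends to zero along a path, the
  -- indicator is eventually below one, so the equation is solved, and the weights converge.
  have hκ : TendstoInMeasure P (fun m ω => (bad m).indicator (fun _ => (1 : ℝ)) ω +
      ∑ a, ∑ b, ‖B m ω a b - A a b‖) atTop fun _ => 0 :=
    TendstoInMeasure.add_of_norm (tendstoInMeasure_indicator hest.solves)
      (tendstoInMeasure_finsetSum _ fun a _ => tendstoInMeasure_finsetSum _ fun b _ =>
        TendstoInMeasure.norm_zero (hB a b))
  refine tendstoInMeasure_sqrt_smul_of_subseq_le (C := C)
    (fun m => ((hest.aemeasurable m).sub_const θ₀).sub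
      (hTL m).aestronglyMeasurable.aemeasurable)
    (fun m ω => add_nonneg (norm_nonneg _) (norm_nonneg _))
    (fun m => ((hTL m).integrable one_le_two).norm.add ((hDL m).integrable one_le_two).norm)
    ?_ hκ ?_
  · filter_upwards [hn.eventually_gt_atTop 0] with m hm using hC (n m) (N m) hm (hnN m)
  filter_upwards [hreg.ae_scoreLLN hlaw hindep] with ω hlln ns hns hω ε hε
  have hnnB : ∀ m, 0 ≤ ∑ a, ∑ b, ‖B m ω a b - A a b‖ := fun m => by positivity
  have hnnI : ∀ m, 0 ≤ (bad m).indicator (fun _ => (1 : ℝ)) ω := fun m =>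
    Set.indicator_nonneg (fun _ _ => zero_le_one) ω
  refine eventually_norm_zEstimator_sub_le hreg hlln.1 hlln.2 (hn.comp hns)
    ((tendsto_atTop_mono hnN hn).comp hns) (B := fun i => B (ns i) ω)
    (θ := fun i => θhat (ns i) ω) (fun a b => ?_) ?_ hε
  · rw [tendsto_iff_norm_sub_tendsto_zero]
    refine squeeze_zero (fun i => norm_nonneg _) (fun i => ?_) hω
    have h1 : ‖B (ns i) ω a b - A a b‖ ≤ ∑ b, ‖B (ns i) ω a b - A a b‖ :=
      Finset.single_le_sum (f := fun b => ‖B (ns i) ω a b - A a b‖)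
        (fun _ _ => norm_nonneg _) (Finset.mem_univ b)
    have h2 : ∑ b, ‖B (ns i) ω a b - A a b‖ ≤ ∑ a, ∑ b, ‖B (ns i) ω a b - A a b‖ :=
      Finset.single_le_sum (f := fun a => ∑ b, ‖B (ns i) ω a b - A a b‖)
        (fun _ _ => by positivity) (Finset.mem_univ a)
    linarith [hnnI (ns i)]
  · filter_upwards [hω.eventually_lt_const one_pos] with i hi
    by_contra hcon
    have : (bad (ns i)).indicator (fun _ => (1 : ℝ)) ω = 1 :=
      Set.indicator_of_mem (s := bad (ns i)) hcon _
    rw [this] at hi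
    linarith [hnnB (ns i)]

end AsymptoticExpansion

/-! ### Algebra of cross moments. -/

section CrossMoment

variable {D ι κ ι' κ' : Type*} [MeasurableSpace D] {μ : Measure D}

lemma crossMoment_sub_self {U V : D → ι → ℝ} (hU : ∀ i, MemLp (fun d => U d i) 2 μ)
    (hV : ∀ i, MemLp (fun d => V d i) 2 μ) :
    crossMoment μ (fun d => U d - V d) (fun d => U d - V d) =
      crossMoment μ U U - (crossMoment μ U V + crossMoment μ V U - crossMoment μ V V) := by
  ext i j
  have i1 : Integrable (fun d => U d i * U d j) μ := (hU i).integrable_mul (hU j)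
  have i2 : Integrable (fun d => U d i * V d j) μ := (hU i).integrable_mul (hV j)
  have i3 : Integrable (fun d => V d i * U d j) μ := (hV i).integrable_mul (hU j)
  have i4 : Integrable (fun d => V d i * V d j) μ := (hV i).integrable_mul (hV j)
  simp only [crossMoment, Matrix.of_apply, Matrix.sub_apply, Matrix.add_apply, Pi.sub_apply]
  have h1 : ∀ d, (U d i - V d i) * (U d j - V d j) =
      U d i * U d j - (U d i * V d j + V d i * U d j - V d i * V d j) := fun d => by ring
  simp_rw [h1]
  have i23 : Integrable (fun d => U d i * V d j + V d i * U d j) μ := i2.add i3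
  have i234 : Integrable (fun d => U d i * V d j + V d i * U d j - V d i * V d j) μ := i23.sub i4
  rw [integral_sub i1 i234, integral_sub i23 i4, integral_add i2 i3]

lemma transpose_crossMoment (U : D → ι → ℝ) (V : D → κ → ℝ) :
    (crossMoment μ U V)ᵀ = crossMoment μ V U := by
  ext i j
  simp [crossMoment, mul_comm]

variable [Fintype ι] [Fintype κ]

lemma crossMoment_mulVec {U : D → ι → ℝ} {V : D → κ → ℝ} (hU : ∀ i, MemLp (fun d => U d i) 2 μ)
    (hV : ∀ i, MemLp (fun d => V d i) 2 μ) (M : Matrix ι' ι ℝ) (M' : Matrix κ' κ ℝ) :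
    crossMoment μ (fun d => M *ᵥ U d) (fun d => M' *ᵥ V d) = M * crossMoment μ U V * M'ᵀ := by
  have hint : ∀ i j, Integrable (fun d => U d i * V d j) μ := fun i j =>
    (hU i).integrable_mul (hV j)
  ext i j
  simp only [crossMoment, Matrix.of_apply, Matrix.mulVec, dotProduct, Matrix.mul_apply,
    Matrix.transpose_apply]
  have h1 : ∀ d, (∑ a, M i a * U d a) * ∑ b, M' j b * V d b =
      ∑ b, ∑ a, M i a * M' j b * (U d a * V d b) := fun d => by
    rw [Finset.sum_mul_sum, Finset.sum_comm]
    refine Finset.sum_congr rfl fun b _ => Finset.sum_congr rfl fun a _ => ?_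
    ring
  simp_rw [h1]
  rw [integral_finsetSum _ fun b _ => integrable_finsetSum _ fun a _ => (hint a b).const_mul _]
  refine Finset.sum_congr rfl fun b _ => ?_
  rw [integral_finsetSum _ fun a _ => (hint a b).const_mul _, Finset.sum_mul]
  refine Finset.sum_congr rfl fun a _ => ?_
  rw [integral_const_mul]
  ring

end CrossMoment

/-! ### Influence functions and their second moments. -/

section Influence

variable {𝒳 𝒴 Ω : Type*} [MeasurableSpace 𝒳] [MeasurableSpace 𝒴] [MeasurableSpace Ω] {p K : ℕ}
  {ℓ : 𝒳 → 𝒴 → Par p → ℝ} {μ : Measure (Obs 𝒳 𝒴 K)} {Θ : Set (Par p)} {θ₀ : Par p}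
  {P : Measure Ω} {Z : ℕ → Ω → Obs 𝒳 𝒴 K}

/-- The stacked score at the predicted labels, centred at its mean. -/
noncomputable def centredStacked (ℓ : 𝒳 → 𝒴 → Par p → ℝ) (μ : Measure (Obs 𝒳 𝒴 K)) (θ : Par p)
    (d : Obs 𝒳 𝒴 K) : Fin K × Fin p → ℝ :=
  stackedScore ℓ θ d - fun a => ∫ d', stackedScore ℓ θ d' a ∂μ

/-- The influence function of a labelled unit. -/
noncomputable def labelledInfluence (ℓ : 𝒳 → 𝒴 → Par p → ℝ) (μ : Measure (Obs 𝒳 𝒴 K))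
    (θ : Par p) (A : Matrix (Fin K × Fin p) (Fin p) ℝ) (d : Obs 𝒳 𝒴 K) : Par p :=
  negHessInv (hessian ℓ μ θ) (scoreTrue ℓ θ d - weightMap A (centredStacked ℓ μ θ d))

/-- The influence function that all units have in common. -/
noncomputable def commonInfluence (ℓ : 𝒳 → 𝒴 → Par p → ℝ) (μ : Measure (Obs 𝒳 𝒴 K))
    (θ : Par p) (A : Matrix (Fin K × Fin p) (Fin p) ℝ) (d : Obs 𝒳 𝒴 K) : Par p :=
  negHessInv (hessian ℓ μ θ) (weightMap A (centredStacked ℓ μ θ d))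

/-- The map `v ↦ -H⁻¹ v` as a continuous linear map. -/
noncomputable def negHessInvL (H : Matrix (Fin p) (Fin p) ℝ) : Par p →L[ℝ] Par p :=
  -(Matrix.toEuclideanCLM (𝕜 := ℝ) H⁻¹ : Par p →L[ℝ] Par p)

lemma negHessInvL_apply (H : Matrix (Fin p) (Fin p) ℝ) (v : Par p) :
    negHessInvL H v = negHessInv H v :=
  rfl

lemma map_sampleMean {D F G : Type*} [NormedAddCommGroup F] [NormedSpace ℝ F]
    [NormedAddCommGroup G] [NormedSpace ℝ G] (z : ℕ → D) (n : ℕ) (L : F →L[ℝ] G) (f : D → F) :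
    sampleMean z n (fun d => L (f d)) = L (sampleMean z n f) := by
  simp [sampleMean]

/-- Centring is free because the contrast annihilates constants. Positive sample sizes are needed:
an empty sample mean is zero, even of a constant. -/
lemma negHessInv_contrastEE_eq {z : ℕ → Obs 𝒳 𝒴 K} {n N : ℕ} (hn : 0 < n) (hN : 0 < N)
    (A : Matrix (Fin K × Fin p) (Fin p) ℝ) :
    negHessInv (hessian ℓ μ θ₀) (contrastEE ℓ z n N A θ₀) =
      sampleMean z n (labelledInfluence ℓ μ θ₀ A) + sampleMean z N (commonInfluence ℓ μ θ₀ A) := by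
  have e1 : sampleMean z n (labelledInfluence ℓ μ θ₀ A) = negHessInvL (hessian ℓ μ θ₀)
      (sampleMean z n (scoreTrue ℓ θ₀) - weightMap A (sampleMean z n (centredStacked ℓ μ θ₀))) := by
    rw [← map_sampleMean, ← sampleMean_sub, ← map_sampleMean]
    rfl
  have e2 : sampleMean z N (commonInfluence ℓ μ θ₀ A) = negHessInvL (hessian ℓ μ θ₀)
      (weightMap A (sampleMean z N (centredStacked ℓ μ θ₀))) := by
    rw [← map_sampleMean, ← map_sampleMean]
    rfl
  have e3 : ∀ k : ℕ, 0 < k → sampleMean z k (centredStacked ℓ μ θ₀) =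
      sampleMean z k (stackedScore ℓ θ₀) - fun a => ∫ d', stackedScore ℓ θ₀ d' a ∂μ := by
    intro k hk
    conv_rhs => rw [← sampleMean_const (z := z) hk fun a => ∫ d', stackedScore ℓ θ₀ d' a ∂μ]
    rw [← sampleMean_sub]
    rfl
  rw [e1, e2, ← map_add, ← negHessInvL_apply, e3 n hn, e3 N hN]
  congr 1
  simp only [contrastEE, map_sub]
  abel

section Moments

lemma Regularity.memLp_stackedScore (hreg : Regularity ℓ μ Θ θ₀) (a : Fin K × Fin p) :
    MemLp (fun d => stackedScore ℓ θ₀ d a) 2 μ :=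
  memLp_coord (hreg.memLp_scorePred a.1) a.2

lemma Regularity.measurable_centredStacked (hreg : Regularity ℓ μ Θ θ₀) :
    Measurable (centredStacked ℓ μ θ₀) :=
  measurable_pi_iff.2 fun a =>
    (measurable_coord (hreg.measurable_scorePred a.1) a.2).sub measurable_const

lemma varStacked_eq : varStacked ℓ μ θ₀ =
    crossMoment μ (centredStacked ℓ μ θ₀) (centredStacked ℓ μ θ₀) := by
  ext i j
  simp only [varStacked, varMatrix, crossMoment, Matrix.of_apply, covariance, centredStacked,
    Pi.sub_apply]

lemma sigmaGain_eq : sigmaGain ℓ μ θ₀ =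
    (crossStacked ℓ μ θ₀)ᵀ * (varStacked ℓ μ θ₀)⁻¹ * crossStacked ℓ μ θ₀ := by
  rw [sigmaGain, crossStacked, transpose_crossMoment]

lemma Regularity.isSymm_inv_hessian (hreg : Regularity ℓ μ Θ θ₀) :
    ((hessian ℓ μ θ₀)⁻¹)ᵀ = (hessian ℓ μ θ₀)⁻¹ := by
  rw [Matrix.transpose_nonsing_inv, hreg.isSymm_hessian]

lemma crossMoment_negHessInv {f : Obs 𝒳 𝒴 K → Par p} (hf : MemLp f 2 μ)
    (H : Matrix (Fin p) (Fin p) ℝ) :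
    crossMoment μ (fun d i => negHessInv H (f d) i) (fun d i => negHessInv H (f d) i) =
      H⁻¹ * crossMoment μ (fun d i => f d i) (fun d i => f d i) * (H⁻¹)ᵀ := by
  rw [← crossMoment_mulVec (fun i => memLp_coord hf i) (fun i => memLp_coord hf i)]
  ext i j
  simp [crossMoment, negHessInv]

lemma labelledInfluence_add_commonInfluence (A : Matrix (Fin K × Fin p) (Fin p) ℝ)
    (d : Obs 𝒳 𝒴 K) : labelledInfluence ℓ μ θ₀ A d + commonInfluence ℓ μ θ₀ A d =
      negHessInv (hessian ℓ μ θ₀) (scoreTrue ℓ θ₀ d) := by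
  rw [labelledInfluence, commonInfluence, ← negHessInvL_apply, ← negHessInvL_apply, ← map_add,
    sub_add_cancel, negHessInvL_apply]

lemma Regularity.measurable_labelledInfluence (hreg : Regularity ℓ μ Θ θ₀)
    (A : Matrix (Fin K × Fin p) (Fin p) ℝ) : Measurable (labelledInfluence ℓ μ θ₀ A) :=
  (negHessInvL _).continuous.measurable.comp (hreg.measurable_scoreTrue.sub
    ((weightMap A).continuous.measurable.comp hreg.measurable_centredStacked))

lemma Regularity.measurable_commonInfluence (hreg : Regularity ℓ μ Θ θ₀)
    (A : Matrix (Fin K × Fin p) (Fin p) ℝ) : Measurable (commonInfluence ℓ μ θ₀ A) :=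
  (negHessInvL _).continuous.measurable.comp
    ((weightMap A).continuous.measurable.comp hreg.measurable_centredStacked)

variable [IsProbabilityMeasure μ]

lemma Regularity.memLp_centredStacked_apply (hreg : Regularity ℓ μ Θ θ₀) (a : Fin K × Fin p) :
    MemLp (fun d => centredStacked ℓ μ θ₀ d a) 2 μ :=
  (hreg.memLp_stackedScore a).sub (memLp_const _)

lemma Regularity.memLp_centredStacked (hreg : Regularity ℓ μ Θ θ₀) :
    MemLp (centredStacked ℓ μ θ₀) 2 μ := by
  rw [memLp_pi_iff]
  exact hreg.memLp_centredStacked_apply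

lemma Regularity.integral_centredStacked (hreg : Regularity ℓ μ Θ θ₀) :
    ∫ d, centredStacked ℓ μ θ₀ d ∂μ = 0 := by
  have hi := hreg.memLp_centredStacked.integrable one_le_two
  ext a
  refine (eval_integral (fun a => (hreg.memLp_centredStacked_apply a).integrable one_le_two) a).trans
    ?_
  simp only [centredStacked, Pi.sub_apply]
  rw [integral_sub ((hreg.memLp_stackedScore a).integrable one_le_two) (integrable_const _)]
  simp

lemma Regularity.integral_scoreTrue_apply (hreg : Regularity ℓ μ Θ θ₀) (i : Fin p) :
    ∫ d, scoreTrue ℓ θ₀ d i ∂μ = 0 := by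
  rw [integral_coord (hreg.memLp_scoreTrue.integrable one_le_two), hreg.solves]
  rfl

lemma Regularity.sigmaNaive_eq (hreg : Regularity ℓ μ Θ θ₀) :
    sigmaNaive ℓ μ θ₀ = crossMoment μ (fun d i => scoreTrue ℓ θ₀ d i)
      (fun d i => scoreTrue ℓ θ₀ d i) := by
  ext i j
  simp only [sigmaNaive, varMatrix, crossMoment, Matrix.of_apply, covariance,
    hreg.integral_scoreTrue_apply, sub_zero]

/-- Centring one factor suffices, as the true score has mean zero. -/
lemma Regularity.crossStacked_eq (hreg : Regularity ℓ μ Θ θ₀) : crossStacked ℓ μ θ₀ =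
    crossMoment μ (centredStacked ℓ μ θ₀) fun d i => scoreTrue ℓ θ₀ d i := by
  ext a i
  have h1 := memLp_coord hreg.memLp_scoreTrue i
  simp only [crossStacked, crossMoment, Matrix.of_apply, centredStacked, Pi.sub_apply, sub_mul]
  have h2 : Integrable (fun d => stackedScore ℓ θ₀ d a * scoreTrue ℓ θ₀ d i) μ :=
    (hreg.memLp_stackedScore a).integrable_mul h1
  rw [integral_sub h2 ((h1.integrable one_le_two).const_mul _), integral_const_mul,
    hreg.integral_scoreTrue_apply, mul_zero, sub_zero]

lemma Regularity.posSemidef_varStacked (hreg : Regularity ℓ μ Θ θ₀) :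
    (varStacked ℓ μ θ₀).PosSemidef := by
  rw [varStacked_eq]
  exact posSemidef_crossMoment_self hreg.memLp_centredStacked_apply

lemma Regularity.posSemidef_sigmaGain (hreg : Regularity ℓ μ Θ θ₀) :
    (sigmaGain ℓ μ θ₀).PosSemidef := by
  rw [sigmaGain_eq, ← Matrix.conjTranspose_eq_transpose_of_trivial]
  exact hreg.posSemidef_varStacked.inv.conjTranspose_mul_mul_same _

/-- The difference is `ρ H⁻¹ Σ_g H⁻¹`, a congruence of a positive semidefinite matrix since `H⁻¹` is
symmetric. -/
lemma Regularity.posSemidef_asympVarNaive_sub (hreg : Regularity ℓ μ Θ θ₀) {ρ : ℝ} (hρ : 0 ≤ ρ) :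
    (asympVarNaive ℓ μ θ₀ - asympVarSada ℓ μ θ₀ ρ).PosSemidef := by
  have h := (hreg.posSemidef_sigmaGain.smul hρ).mul_mul_conjTranspose_same (hessian ℓ μ θ₀)⁻¹
  rw [Matrix.conjTranspose_eq_transpose_of_trivial, hreg.isSymm_inv_hessian] at h
  convert h using 1
  rw [asympVarNaive, asympVarSada, ← Matrix.sub_mul, ← Matrix.mul_sub, sigmaOpt, sub_sub_cancel]

lemma Regularity.memLp_labelledInfluence (hreg : Regularity ℓ μ Θ θ₀)
    (A : Matrix (Fin K × Fin p) (Fin p) ℝ) : MemLp (labelledInfluence ℓ μ θ₀ A) 2 μ :=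
  memLp_negHessInv _ (hreg.memLp_scoreTrue.sub ((weightMap A).comp_memLp'
    hreg.memLp_centredStacked))

lemma Regularity.memLp_commonInfluence (hreg : Regularity ℓ μ Θ θ₀)
    (A : Matrix (Fin K × Fin p) (Fin p) ℝ) : MemLp (commonInfluence ℓ μ θ₀ A) 2 μ :=
  memLp_negHessInv _ ((weightMap A).comp_memLp' hreg.memLp_centredStacked)

lemma Regularity.integral_commonInfluence (hreg : Regularity ℓ μ Θ θ₀)
    (A : Matrix (Fin K × Fin p) (Fin p) ℝ) : ∫ d, commonInfluence ℓ μ θ₀ A d ∂μ = 0 := by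
  have h := (negHessInvL (hessian ℓ μ θ₀) ∘L weightMap A).integral_comp_comm
    (hreg.memLp_centredStacked.integrable one_le_two)
  rw [hreg.integral_centredStacked, map_zero] at h
  exact h

lemma Regularity.integral_labelledInfluence (hreg : Regularity ℓ μ Θ θ₀)
    (A : Matrix (Fin K × Fin p) (Fin p) ℝ) : ∫ d, labelledInfluence ℓ μ θ₀ A d ∂μ = 0 := by
  have hs := hreg.memLp_scoreTrue.integrable one_le_two
  have h := (negHessInvL (hessian ℓ μ θ₀)).integral_comp_comm hs
  rw [hreg.solves, map_zero] at h
  have e : ∀ d, labelledInfluence ℓ μ θ₀ A d =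
      negHessInvL (hessian ℓ μ θ₀) (scoreTrue ℓ θ₀ d) - commonInfluence ℓ μ θ₀ A d := fun d =>
    map_sub (negHessInvL (hessian ℓ μ θ₀)) _ _
  simp_rw [e]
  rw [integral_sub ((negHessInvL _).integrable_comp hs)
    ((hreg.memLp_commonInfluence A).integrable one_le_two), h, hreg.integral_commonInfluence,
    sub_zero]

/-- The asymptotic variance for an arbitrary weight matrix. -/
lemma Regularity.mixedMoment_influence (hreg : Regularity ℓ μ Θ θ₀)
    (A : Matrix (Fin K × Fin p) (Fin p) ℝ) (r : ℝ) :
    mixedMoment μ (labelledInfluence ℓ μ θ₀ A) (commonInfluence ℓ μ θ₀ A) r =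
      (hessian ℓ μ θ₀)⁻¹ * (sigmaNaive ℓ μ θ₀ - (1 - r) • ((crossStacked ℓ μ θ₀)ᵀ * A +
        Aᵀ * crossStacked ℓ μ θ₀ - Aᵀ * varStacked ℓ μ θ₀ * A)) * (hessian ℓ μ θ₀)⁻¹ := by
  have hs : ∀ i, MemLp (fun d => scoreTrue ℓ θ₀ d i) 2 μ := memLp_coord hreg.memLp_scoreTrue
  have hS := hreg.memLp_centredStacked_apply
  have hf : MemLp (fun d => scoreTrue ℓ θ₀ d - weightMap A (centredStacked ℓ μ θ₀ d)) 2 μ :=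
    hreg.memLp_scoreTrue.sub ((weightMap A).comp_memLp' hreg.memLp_centredStacked)
  have hAS : ∀ i, MemLp (fun d => (Aᵀ *ᵥ centredStacked ℓ μ θ₀ d) i) 2 μ := fun i =>
    memLp_coord ((weightMap A).comp_memLp' hreg.memLp_centredStacked) i
  have e1 : crossMoment μ (fun d i => scoreTrue ℓ θ₀ d i)
      (fun d => Aᵀ *ᵥ centredStacked ℓ μ θ₀ d) = (crossStacked ℓ μ θ₀)ᵀ * A := by
    have h := crossMoment_mulVec hs hS (1 : Matrix (Fin p) (Fin p) ℝ) Aᵀ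
    simp only [Matrix.one_mulVec, Matrix.one_mul, Matrix.transpose_transpose] at h
    rw [h, hreg.crossStacked_eq, transpose_crossMoment]
  have e2 : crossMoment μ (fun d => Aᵀ *ᵥ centredStacked ℓ μ θ₀ d)
      (fun d i => scoreTrue ℓ θ₀ d i) = Aᵀ * crossStacked ℓ μ θ₀ := by
    rw [← transpose_crossMoment, e1, Matrix.transpose_mul, Matrix.transpose_transpose]
  have e3 := crossMoment_mulVec hS hS Aᵀ Aᵀ
  rw [← varStacked_eq, Matrix.transpose_transpose] at e3
  have e4 : crossMoment μ (fun d i => (scoreTrue ℓ θ₀ d - weightMap A (centredStacked ℓ μ θ₀ d)) i)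
      (fun d i => (scoreTrue ℓ θ₀ d - weightMap A (centredStacked ℓ μ θ₀ d)) i) =
      sigmaNaive ℓ μ θ₀ - ((crossStacked ℓ μ θ₀)ᵀ * A +
        Aᵀ * crossStacked ℓ μ θ₀ - Aᵀ * varStacked ℓ μ θ₀ * A) := by
    rw [hreg.sigmaNaive_eq, ← e1, ← e2, ← e3, ← crossMoment_sub_self hs hAS]
    rfl
  -- In the convex combination the `r`-part is the moment of `-H⁻¹ s`, free of `A`; only the `(1 -
  -- r)`-part sees the weight.
  rw [mixedMoment_eq (hreg.memLp_labelledInfluence A) (hreg.memLp_commonInfluence A)]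
  simp_rw [labelledInfluence_add_commonInfluence]
  simp only [labelledInfluence]
  rw [crossMoment_negHessInv hf, crossMoment_negHessInv hreg.memLp_scoreTrue, e4,
    ← hreg.sigmaNaive_eq, hreg.isSymm_inv_hessian]
  simp only [Matrix.mul_sub, Matrix.sub_mul, Matrix.mul_smul, Matrix.smul_mul, sub_smul, smul_sub,
    one_smul]
  abel

/-- For `A = V⁻¹C`, with `V = Var(𝒮)` and `C = E[𝒮sᵀ]`, each of `CᵀA`, `AᵀC` and `AᵀVA` equals
`Σ_g`, so exactly one copy is left. -/
lemma Regularity.mixedMoment_influence_optimal (hreg : Regularity ℓ μ Θ θ₀) (r : ℝ) :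
    mixedMoment μ (labelledInfluence ℓ μ θ₀ ((varStacked ℓ μ θ₀)⁻¹ * crossStacked ℓ μ θ₀))
      (commonInfluence ℓ μ θ₀ ((varStacked ℓ μ θ₀)⁻¹ * crossStacked ℓ μ θ₀)) r =
      asympVarSada ℓ μ θ₀ (1 - r) := by
  have hV : ((varStacked ℓ μ θ₀)⁻¹)ᵀ = (varStacked ℓ μ θ₀)⁻¹ := by
    rw [← Matrix.conjTranspose_eq_transpose_of_trivial]
    exact hreg.posSemidef_varStacked.inv.isHermitian
  rw [hreg.mixedMoment_influence, asympVarSada, sigmaOpt, sigmaGain_eq, Matrix.transpose_mul, hV,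
    Matrix.mul_assoc _ _ (varStacked ℓ μ θ₀), Matrix.nonsing_inv_mul _ hreg.varStacked_nonsing,
    Matrix.mul_one, ← Matrix.mul_assoc, add_sub_cancel_right]

lemma Regularity.mixedMoment_influence_zero (hreg : Regularity ℓ μ Θ θ₀) (r : ℝ) :
    mixedMoment μ (labelledInfluence ℓ μ θ₀ 0) (commonInfluence ℓ μ θ₀ 0) r =
      asympVarNaive ℓ μ θ₀ := by
  rw [hreg.mixedMoment_influence, asympVarNaive]
  simp

end Moments

end Influence

/-! ### Reduction of both estimators to a single weighted equation. -/

section Main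

variable {𝒳 𝒴 Ω : Type*} {p K : ℕ} {ℓ : 𝒳 → 𝒴 → Par p → ℝ} {Z : ℕ → Ω → Obs 𝒳 𝒴 K}

/-- The mean over `N` units is `n/N` times the labelled mean plus `ρ` times the unlabelled mean. The
right-hand side avoids means over the unlabelled block, whose size need not tend to infinity. -/
lemma scoreContrast_eq {n N : ℕ} (hnN : n < N) (ω : Ω) (θ : Par p) :
    scoreContrast ℓ Z n N ω θ = (unlabFrac n N)⁻¹ •
      (sampleMean (fun i => Z i ω) N (stackedScore ℓ θ) -
        sampleMean (fun i => Z i ω) n (stackedScore ℓ θ)) := by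
  have hN : (N : ℝ) ≠ 0 := by exact_mod_cast (Nat.zero_le n |>.trans_lt hnN).ne'
  have hNn : (N : ℝ) - n ≠ 0 := sub_ne_zero.2 (by exact_mod_cast hnN.ne')
  ext a
  simp only [scoreContrast, sampleMean, unlabFrac, Finset.sum_Ico_eq_sub _ hnN.le, Pi.sub_apply,
    Pi.smul_apply, smul_eq_mul]
  rcases Nat.eq_zero_or_pos n with rfl | hn
  · simp [hN]
  · have hn0 : (n : ℝ) ≠ 0 := by exact_mod_cast hn.ne'
    field_simp
    ring

lemma weightedEE_eq_contrastEE {n N : ℕ} (hnN : n < N) (W : Matrix (Fin K × Fin p) (Fin p) ℝ)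
    (ω : Ω) : weightedEE ℓ Z n N W ω =
      contrastEE ℓ (fun i => Z i ω) n N ((unlabFrac n N)⁻¹ • W) := by
  funext θ
  rw [weightedEE, scoreContrast_eq hnN, contrastEE, map_smul, _root_.smul_apply, ← map_smul,
    weightMap_apply]
  rfl

/-- Taking `N = n` makes the naive estimator an instance of the general result. -/
lemma naiveEE_eq_contrastEE (n : ℕ) (ω : Ω) :
    naiveEE ℓ Z n ω = contrastEE ℓ (fun i => Z i ω) n n 0 := by
  funext θ
  rw [contrastEE, map_zero, _root_.zero_apply, add_zero]
  rfl

lemma unlabFrac_pos {n N : ℕ} (h : n < N) : 0 < unlabFrac n N := by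
  have h1 : (n : ℝ) < N := by exact_mod_cast h
  have h2 : (0 : ℝ) ≤ n := n.cast_nonneg
  exact div_pos (by linarith) (by linarith)

lemma one_sub_div_eq_unlabFrac {n N : ℕ} (h : n < N) : 1 - (n : ℝ) / N = unlabFrac n N := by
  have hN : (N : ℝ) ≠ 0 := by exact_mod_cast (Nat.zero_le n |>.trans_lt h).ne'
  rw [unlabFrac, sub_div, div_self hN]

variable [MeasurableSpace 𝒳] [MeasurableSpace 𝒴] [MeasurableSpace Ω]
  {μ : Measure (Obs 𝒳 𝒴 K)} {Θ : Set (Par p)} {θ₀ : Par p} {P : Measure Ω}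

/-- The two forms of the leading term are identified only for `n m > 0`, which is all that the
asymptotic clauses need; square integrability is required for every `m` and is supplied separately.
-/
lemma FirstOrderAsymptotics.congr_leadingTerm {n : ℕ → ℕ} {θhat T T' : ℕ → Ω → Par p}
    {V : ℕ → Matrix (Fin p) (Fin p) ℝ} (hT : FirstOrderAsymptotics P n θhat θ₀ T V)
    (hn : Tendsto n atTop atTop) (hL : ∀ m, MemLp (T' m) 2 P)
    (h : ∀ m, 0 < n m → T m = T' m) : FirstOrderAsymptotics P n θhat θ₀ T' V where
  posSemidef := hT.posSemidef
  normal := hT.normal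
  linear := hT.linear.congr' (by
    filter_upwards [hn.eventually_gt_atTop 0] with m hm
    rw [h m hm]) (ae_of_all _ fun _ => rfl)
  memLp := hL
  mean := fun m hm => h m hm ▸ hT.mean m hm
  secondMoment := fun m hm => h m hm ▸ hT.secondMoment m hm
  mse := hT.mse
  variance := hT.variance

variable [IsProbabilityMeasure μ] [IsProbabilityMeasure P]

lemma tendstoInMeasure_zEstimator_sub_influence (hreg : Regularity ℓ μ Θ θ₀)
    (hlaw : ∀ i, HasLaw (Z i) μ P) (hindep : iIndepFun Z P) {n N : ℕ → ℕ}
    (hn : Tendsto n atTop atTop) (hnN : ∀ m, n m ≤ N m)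
    {B : ℕ → Ω → Matrix (Fin K × Fin p) (Fin p) ℝ} {A : Matrix (Fin K × Fin p) (Fin p) ℝ}
    (hB : ∀ a b, TendstoInMeasure P (fun m ω => B m ω a b - A a b) atTop fun _ => 0)
    {θhat : ℕ → Ω → Par p} (hest : IsZEstimator P Θ
      (fun m ω => contrastEE ℓ (fun i => Z i ω) (n m) (N m) (B m ω)) θhat) :
    TendstoInMeasure P (fun m ω => √(n m) • (θhat m ω - θ₀ -
      (sampleMean (fun i => Z i ω) (n m) (labelledInfluence ℓ μ θ₀ A) +
        sampleMean (fun i => Z i ω) (N m) (commonInfluence ℓ μ θ₀ A)))) atTop fun _ => 0 := by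
  refine (tendstoInMeasure_zEstimator_sub_linear hreg hlaw hindep hn hnN hB hest).congr' ?_
    (ae_of_all _ fun _ => rfl)
  filter_upwards [hn.eventually_gt_atTop 0] with m hm
  refine ae_of_all _ fun ω => ?_
  simp only
  rw [negHessInv_contrastEE_eq hm (hm.trans_le (hnN m))]

/-- First-order asymptotics of a solution of the weighted estimating equation. -/
theorem firstOrderAsymptotics_zEstimator (hreg : Regularity ℓ μ Θ θ₀)
    (hlaw : ∀ i, HasLaw (Z i) μ P) (hindep : iIndepFun Z P) {n N : ℕ → ℕ}
    (hn : Tendsto n atTop atTop) (hnN : ∀ m, n m ≤ N m)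
    {B : ℕ → Ω → Matrix (Fin K × Fin p) (Fin p) ℝ} {A : Matrix (Fin K × Fin p) (Fin p) ℝ}
    (hB : ∀ a b, TendstoInMeasure P (fun m ω => B m ω a b - A a b) atTop fun _ => 0)
    {θhat : ℕ → Ω → Par p} (hest : IsZEstimator P Θ
      (fun m ω => contrastEE ℓ (fun i => Z i ω) (n m) (N m) (B m ω)) θhat) :
    FirstOrderAsymptotics P n θhat θ₀
      (fun m ω => negHessInv (hessian ℓ μ θ₀) (contrastEE ℓ (fun i => Z i ω) (n m) (N m) A θ₀))
      (fun m => mixedMoment μ (labelledInfluence ℓ μ θ₀ A) (commonInfluence ℓ μ θ₀ A)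
        (n m / N m)) := by
  refine (firstOrderAsymptotics_of_linear hlaw hindep (hreg.measurable_labelledInfluence A)
    (hreg.measurable_commonInfluence A) (hreg.memLp_labelledInfluence A)
    (hreg.memLp_commonInfluence A) (hreg.integral_labelledInfluence A)
    (hreg.integral_commonInfluence A) hn hnN hest.aemeasurable
    (tendstoInMeasure_zEstimator_sub_influence hreg hlaw hindep hn hnN hB hest)).congr_leadingTerm
    hn (fun m => memLp_negHessInv _ (memLp_contrastEE hreg hlaw (n m) (N m) A)) fun m hm => ?_
  funext ω
  rw [negHessInv_contrastEE_eq hm (hm.trans_le (hnN m))]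

theorem tendstoInDistribution_zEstimator (hreg : Regularity ℓ μ Θ θ₀)
    (hlaw : ∀ i, HasLaw (Z i) μ P) (hindep : iIndepFun Z P) {n N : ℕ → ℕ}
    (hn : Tendsto n atTop atTop) (hnN : ∀ m, n m ≤ N m)
    {B : ℕ → Ω → Matrix (Fin K × Fin p) (Fin p) ℝ} {A : Matrix (Fin K × Fin p) (Fin p) ℝ}
    (hB : ∀ a b, TendstoInMeasure P (fun m ω => B m ω a b - A a b) atTop fun _ => 0)
    {θhat : ℕ → Ω → Par p} (hest : IsZEstimator P Θ
      (fun m ω => contrastEE ℓ (fun i => Z i ω) (n m) (N m) (B m ω)) θhat)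
    {r : ℝ} (hr : Tendsto (fun m => (n m : ℝ) / N m) atTop (𝓝 r)) :
    TendstoInDistribution (fun m ω => √(n m) • (θhat m ω - θ₀)) atTop id (fun _ => P)
      (multivariateGaussian 0
        (mixedMoment μ (labelledInfluence ℓ μ θ₀ A) (commonInfluence ℓ μ θ₀ A) r)) :=
  tendstoInDistribution_of_linear hlaw hindep (hreg.measurable_labelledInfluence A)
    (hreg.measurable_commonInfluence A) (hreg.memLp_labelledInfluence A)
    (hreg.memLp_commonInfluence A) (hreg.integral_labelledInfluence A)
    (hreg.integral_commonInfluence A) hn hnN hest.aemeasurable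
    (tendstoInMeasure_zEstimator_sub_influence hreg hlaw hindep hn hnN hB hest) hr

end Main

end SADA

theorem mainTheorem1
    {𝒳 𝒴 Ω : Type*} [MeasurableSpace 𝒳] [MeasurableSpace 𝒴] [MeasurableSpace Ω] {p K : ℕ}
    -- the loss, the law of `(X, Y, Ŷ)`, the parameter set and the true parameter
    (ℓ : 𝒳 → 𝒴 → SADA.Par p → ℝ) (μ : Measure (SADA.Obs 𝒳 𝒴 K))
    (Θ : Set (SADA.Par p)) (θ₀ : SADA.Par p) (hreg : SADA.Regularity ℓ μ Θ θ₀)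
    -- an i.i.d. sample, with `n m` labelled units among the first `N m`
    (P : Measure Ω) [IsProbabilityMeasure P] (Z : ℕ → Ω → SADA.Obs 𝒳 𝒴 K)
    (hZ : ∀ i, Measurable (Z i)) (hlaw : ∀ i, HasLaw (Z i) μ P) (hindep : iIndepFun Z P)
    (n N : ℕ → ℕ) (hn : Tendsto n atTop atTop) (hnN : ∀ m, n m < N m)
    -- estimated weights, consistent for the optimal weight
    (What : ℕ → Ω → Matrix (Fin K × Fin p) (Fin p) ℝ)
    (hWmeas : ∀ m a b, Measurable fun ω => What m ω a b)
    (hW : ∀ a b, TendstoInMeasure P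
      (fun m ω => (SADA.unlabFrac (n m) (N m))⁻¹ *
        (What m ω a b - SADA.optWeight ℓ μ θ₀ (SADA.unlabFrac (n m) (N m)) a b))
      atTop fun _ => (0 : ℝ))
    -- the SADA estimator
    (θsada : ℕ → Ω → SADA.Par p)
    (hsada : SADA.IsZEstimator P Θ
      (fun m ω => SADA.weightedEE ℓ Z (n m) (N m) (What m ω) ω) θsada) :
    -- asymptotic normality and mean squared error of the SADA estimator
    SADA.FirstOrderAsymptotics P n θsada θ₀
      (fun m ω => SADA.negHessInv (SADA.hessian ℓ μ θ₀)
        (SADA.weightedEE ℓ Z (n m) (N m)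
          (SADA.optWeight ℓ μ θ₀ (SADA.unlabFrac (n m) (N m))) ω θ₀))
      (fun m => SADA.asympVarSada ℓ μ θ₀ (SADA.unlabFrac (n m) (N m))) ∧
    -- convergence in distribution when `(N - n) / N` has a limit
    (∀ ρ : ℝ, Tendsto (fun m => SADA.unlabFrac (n m) (N m)) atTop (𝓝 ρ) →
      TendstoInDistribution (fun m ω => √(n m) • (θsada m ω - θ₀)) atTop id (fun _ => P)
        (multivariateGaussian 0 (SADA.asympVarSada ℓ μ θ₀ ρ))) ∧
    -- the gain is positive semidefinite
    (SADA.sigmaGain ℓ μ θ₀).PosSemidef ∧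
    -- the asymptotic variance does not exceed that of the naive estimator
    (∀ m, (SADA.asympVarNaive ℓ μ θ₀ -
      SADA.asympVarSada ℓ μ θ₀ (SADA.unlabFrac (n m) (N m))).PosSemidef) ∧
    (∀ θnv : ℕ → Ω → SADA.Par p,
      SADA.IsZEstimator P Θ (fun m ω => SADA.naiveEE ℓ Z (n m) ω) θnv →
      SADA.FirstOrderAsymptotics P n θnv θ₀
        (fun m ω => SADA.negHessInv (SADA.hessian ℓ μ θ₀) (SADA.naiveEE ℓ Z (n m) ω θ₀))
        (fun _ => SADA.asympVarNaive ℓ μ θ₀) ∧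
      TendstoInDistribution (fun m ω => √(n m) • (θnv m ω - θ₀)) atTop id (fun _ => P)
        (multivariateGaussian 0 (SADA.asympVarNaive ℓ μ θ₀))) := by
  have hμ : IsProbabilityMeasure μ :=
    (hlaw 0).map_eq ▸ Measure.isProbabilityMeasure_map (hlaw 0).aemeasurable
  have hnN' : ∀ m, n m ≤ N m := fun m => (hnN m).le
  have hopt : ∀ m, (SADA.unlabFrac (n m) (N m))⁻¹ •
      SADA.optWeight ℓ μ θ₀ (SADA.unlabFrac (n m) (N m)) =
        (SADA.varStacked ℓ μ θ₀)⁻¹ * SADA.crossStacked ℓ μ θ₀ := fun m =>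
    inv_smul_smul₀ (SADA.unlabFrac_pos (hnN m)).ne' _
  -- After rescaling by `ρ⁻¹` the target no longer depends on `m`, so the weight hypothesis becomes
  -- ordinary consistency.
  have hB : ∀ a b, TendstoInMeasure P (fun m ω =>
      ((SADA.unlabFrac (n m) (N m))⁻¹ • What m ω) a b -
        ((SADA.varStacked ℓ μ θ₀)⁻¹ * SADA.crossStacked ℓ μ θ₀) a b) atTop fun _ => 0 :=
    fun a b => (hW a b).congr (fun m => ae_of_all _ fun ω => by
      simp only
      rw [← hopt m, Matrix.smul_apply, Matrix.smul_apply, smul_eq_mul, smul_eq_mul, mul_sub])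
      (ae_of_all _ fun _ => rfl)
  simp_rw [SADA.weightedEE_eq_contrastEE (hnN _)] at hsada ⊢
  refine ⟨?_, fun ρ hρ => ?_, hreg.posSemidef_sigmaGain, fun m =>
    hreg.posSemidef_asympVarNaive_sub (SADA.unlabFrac_pos (hnN m)).le, fun θnv hnv => ?_⟩
  · have h := SADA.firstOrderAsymptotics_zEstimator hreg hlaw hindep hn hnN' hB hsada
    simp_rw [hreg.mixedMoment_influence_optimal, SADA.one_sub_div_eq_unlabFrac (hnN _)] at h
    simp_rw [hopt]
    exact h
  · have hr : Tendsto (fun m => (n m : ℝ) / N m) atTop (𝓝 (1 - ρ)) := by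
      refine (tendsto_const_nhds.sub hρ).congr fun m => ?_
      rw [← SADA.one_sub_div_eq_unlabFrac (hnN m), sub_sub_cancel]
    have h := SADA.tendstoInDistribution_zEstimator hreg hlaw hindep hn hnN' hB hsada hr
    rwa [hreg.mixedMoment_influence_optimal, sub_sub_cancel] at h
  · simp_rw [SADA.naiveEE_eq_contrastEE] at hnv ⊢
    have h0 : ∀ (a : Fin K × Fin p) (b : Fin p), TendstoInMeasure P (fun (_ : ℕ) (_ : Ω) =>
        (0 : Matrix (Fin K × Fin p) (Fin p) ℝ) a b -
          (0 : Matrix (Fin K × Fin p) (Fin p) ℝ) a b) atTop fun _ => 0 := fun a b => by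
      rw [sub_self]
      exact tendstoInMeasure_of_tendsto_ae (fun _ => aestronglyMeasurable_const)
        (ae_of_all _ fun _ => tendsto_const_nhds)
    have h1 := SADA.firstOrderAsymptotics_zEstimator (N := n) (B := fun _ _ => 0) hreg hlaw hindep
      hn (fun _ => le_rfl) h0 hnv
    -- With `N = n` the ratio is `1` as soon as `n m > 0`; at `n m = 0` it is `0 / 0 = 0`, so it is
    -- only eventually constant.
    have h2 := SADA.tendstoInDistribution_zEstimator (N := n) (B := fun _ _ => 0) hreg hlaw hindep
      hn (fun _ => le_rfl) h0 hnv (r := 1) (by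
        refine tendsto_const_nhds.congr' ?_
        filter_upwards [hn.eventually_gt_atTop 0] with m hm
        rw [div_self (by exact_mod_cast hm.ne')])
    simp_rw [hreg.mixedMoment_influence_zero] at h1 h2
    exact ⟨h1, h2⟩
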